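/- Let $d\ge 1$, let $X_1,X_2,\dots$ be i.i.d. $\mathbb R^d$-valued random vectors with bounded probability density $f$, let $K:\mathbb R^d\to\mathbb R$, let $(h_n)_{n\ge1}$ and $(v_n)_{n\ge 1}$ be sequences with $v_n>0$, let $[\alpha]\in\mathbb N^d$, $|\alpha|=\alpha_1+\dots+\alpha_d$, $\partial^{[\alpha]}g=\partial^{|\alpha|}g/\partial x_1^{\alpha_1}\cdots\partial x_d^{\alpha_d}$ (with $\partial^{[\alpha]}g=g$ if $|\alpha|=0$), and let $a\in\mathbb R$. Let $D^{(j)}$ denote the $j$-th differential, put $a_n=\sum_{i=1}^n h_i^{d+2|\alpha|}$ and $$\partial^{[\alpha]}f_n(x)=\frac1n\sum_{i=1}^n\frac1{h_i^{d+|\alpha|}}\,\partial^{[\alpha]}K\Big(\frac{x-X_i}{h_i}\Big).$$ Consider the following conditions. (A) $K$ is bounded and integrable, $\int_{\mathbb R^d}K(z)\,dz=1$ and $\lim_{\|z\|\to\infty}K(z)=0$. (B) There is an integer $q\ge 2$ such that: for all $s\in\{1,\dots,q-1\}$ and $j\in\{1,\dots,d\}$, $\int_{\mathbb R}y_j^sK(y)\,dy_j=0$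 (integration over the $j$-th coordinate only) for almost every value of the other coordinates of $y$; $\int_{\mathbb R^d}|y_j^qK(y)|\,dy<\infty$ for all $j$; $\lim_n \frac{v_n}{n}\sum_{i=1}^nh_i^q=0$; and $\partial^{[\alpha]}f$ is $q$ times differentiable on $\mathbb R^d$ with $\sup_x\|D^{(q)}\partial^{[\alpha]}f(x)\|<\infty$. (C) $f$ is uniformly continuous and $\int\|x\|^{\xi}f(x)\,dx<\infty$ for some $\xi>0$. (D) $\partial^{[\alpha]}K$ is Hölder continuous, and $z\mapsto\|z\|^\gamma\partial^{[\alpha]}K(z)$ is bounded for some $\gamma>0$. (E) $\lim_n v_n^2\log(1/h_n)/a_n=0$ and $\lim_n v_n^2\log(v_n)/a_n=0$. (F) $\int\|z\|^\zeta|K(z)|\,dz<\infty$ for some $\zeta>0$, and $z\mapsto\|z\|^\eta\partial^{[\alpha]}f(z)$ is bounded for some $\eta>0$. (P) $0<a<1/d$ and $h_n=cn^{-a}$ for all $n\ge 1$, with some $c>0$. (R) $0<a<1/(d+2|\alpha|)$ and $h_n=h(n)$ for all $n\ge 1$, where $h$ is locally bounded on $]0,\infty[$ and varies regularly with exponent $-a$,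 i.e. $h(x)=x^{-a}L(x)$ for $x>0$, where $L:{]0,\infty[}\to{]0,\infty[}$ is measurable and $\lim_{t\to\infty}L(tx)/L(t)=1$ for every $x>0$. (S) $K$ is $|\alpha|$ times differentiable on $\mathbb R^d$ with $\lim_{\|x\|\to\infty}\|D^{(j)}K(x)\|=0$ for $0\le j\le|\alpha|-1$; $\partial^{[\alpha]}K$ is bounded and integrable with $\int[\partial^{[\alpha]}K(x)]^2dx\ne0$; $f$ is $|\alpha|$ times differentiable on $\mathbb R^d$ and $D^{(j)}f$ is bounded for $0\le j\le|\alpha|-1$. (M) $\lim_nv_n=\infty$ and $\lim_nv_n^2/a_n=0$. Assume (A)–(F), and assume that one of the following holds: either $|\alpha|=0$, $v_n=1$ for all $n$, and (P); or [either $|\alpha|\ge1$ and $v_n=1$ for all $n$, or $|\alpha|\ge 0$ and (M)], together with (R) and (S). Assume moreover that all moments of $f$ are finite: $\int_{\mathbb R^d}\|x\|^\xi f(x)\,dx<\infty$ for every $\xi>0$. For $U\subseteq\mathbb R^d$ let $\|f\|_{U,\infty}=\sup_{x\in U}|f(x)|$ ($=0$ if $U=\emptyset$), $$\psi(u)=\int_{[0,1]\times\mathbb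 R^d}s^{-ad}\Big(e^{s^{ad}\frac{u}{1-ad}K(z)}-1\Big)ds\,dz,\qquad I(t)=\sup_{u\in\mathbb R}\{ut-\psi(u)\}\in[0,\infty],$$ $$g_U(\delta)=\begin{cases}\|f\|_{U,\infty}(1-ad)\,I\Big(\frac1{1-ad}+\frac{\delta}{\|f\|_{U,\infty}(1-ad)}\Big)&\text{if }|\alpha|=0\text{ and }v_n=1\text{ for all }n,\\[2mm] \dfrac{\delta^2\,(1-a^2(d+2|\alpha|)^2)}{2\|f\|_{U,\infty}\int_{\mathbb R^d}[\partial^{[\alpha]}K(z)]^2dz}&\text{otherwise,}\end{cases}$$ with the convention that $g_U(0)=0$ and $g_U(\delta)=+\infty$ for $\delta\ne0$ if $\|f\|_{U,\infty}=0$, and let $\tilde g_U(\delta)=\min\{g_U(\delta),g_U(-\delta)\}$. Then for every subset $U$ of $\mathbb R^d$ and every $\delta>0$, with $\log 0=-\infty$ and $\sup\emptyset=-\infty$ inside the probability, $$\lim_{n\to\infty}\frac{v_n^2}{\sum_{i=1}^nh_i^{d+2|\alpha|}}\log\mathbb P\Big[\sup_{x\in U}v_n\big|\partial^{[\alpha]}f_n(x)-\partial^{[\alpha]}f(x)\big|\ge\delta\Big]=-\tilde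 g_U(\delta).$$ -/

import Mathlib

open MeasureTheory ProbabilityTheory Filter Topology Set

noncomputable section

namespace RecKernel

/-- The Euclidean space `ℝ^d`. -/
abbrev E (d : ℕ) : Type := EuclideanSpace ℝ (Fin d)

/-- The length `|α| = α₁ + ⋯ + α_d` of a multi-index. -/
def mlen {d : ℕ} (α : Fin d → ℕ) : ℕ := ∑ j, α j

/-- The first partial derivative `∂g/∂x_j`. -/
def pderiv {d : ℕ} (j : Fin d) (g : E d → ℝ) : E d → ℝ :=
  fun x => lineDeriv ℝ g x (EuclideanSpace.single j 1)

/-- The partial derivative `∂^{|α|} g / ∂x₁^{α₁} ⋯ ∂x_d^{α_d}`. -/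
def mderiv {d : ℕ} (α : Fin d → ℕ) (g : E d → ℝ) : E d → ℝ :=
  (List.finRange d).foldr (fun j G => (pderiv j)^[α j] G) g

/-- `g` is `m` times (Fréchet) differentiable on `ℝ^d`; no continuity of the last
differential is required. -/
def TimesDiff {d : ℕ} (m : ℕ) (g : E d → ℝ) : Prop :=
  ∀ j < m, Differentiable ℝ (iteratedFDeriv ℝ j g)

/-- `g` is a bounded function. -/
def Bdd {d : ℕ} (g : E d → ℝ) : Prop := ∃ C : ℝ, ∀ x, |g x| ≤ C

/-- The vector `y` with its `j`-th coordinate replaced by `t`. -/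
def setCoord {d : ℕ} (y : E d) (j : Fin d) (t : ℝ) : E d :=
  WithLp.toLp 2 (Function.update y.ofLp j t)

/-- A slowly varying function: measurable and positive on `(0, ∞)`, with
`L (t x) / L t → 1` as `t → ∞` for every `x > 0`. -/
structure SlowlyVarying (L : ℝ → ℝ) : Prop where
  measurable : Measurable (fun x : Ioi (0 : ℝ) => L x)
  pos : ∀ x, 0 < x → 0 < L x
  tendsto : ∀ x, 0 < x → Tendsto (fun t => L (t * x) / L t) atTop (𝓝 1)

/-- `G` varies regularly (at infinity) with exponent `ρ`. -/
def RegularlyVarying (G : ℝ → ℝ) (ρ : ℝ) : Prop :=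
  ∃ L : ℝ → ℝ, SlowlyVarying L ∧ ∀ x, 0 < x → G x = x ^ ρ * L x

/-- The sum `∑_{i=1}^n h_i^{d+2|α|}`. -/
def hsum {d : ℕ} (α : Fin d → ℕ) (h : ℕ → ℝ) (n : ℕ) : ℝ :=
  ∑ i ∈ Finset.Icc 1 n, h i ^ (d + 2 * mlen α)

/-- `X₁, X₂, …` are independent, each with the bounded probability density `f`.
(The value of `X` at the index `0` plays no role.) -/
structure IIDWithDensity {d : ℕ} {Ω : Type*} [MeasurableSpace Ω] (μ : Measure Ω)
    (X : ℕ → Ω → E d) (f : E d → ℝ) : Prop where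
  measurable_f : Measurable f
  nonneg : ∀ x, 0 ≤ f x
  bounded : Bdd f
  measurable_X : ∀ i, 1 ≤ i → Measurable (X i)
  indep : iIndepFun (fun i : ℕ => X (i + 1)) μ
  law : ∀ i, 1 ≤ i → μ.map (X i) = volume.withDensity (fun x => ENNReal.ofReal (f x))

/-- The recursive kernel estimator of `∂^α f`:
`(1/n) ∑_{i=1}^n h_i^{-(d+|α|)} ∂^α K ((x - X_i)/h_i)`. -/
def estimator {d : ℕ} {Ω : Type*} (α : Fin d → ℕ) (K : E d → ℝ) (h : ℕ → ℝ)
    (X : ℕ → Ω → E d) (n : ℕ) (ω : Ω) (x : E d) : ℝ :=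
  (1 / (n : ℝ)) * ∑ i ∈ Finset.Icc 1 n,
    (1 / h i ^ (d + mlen α)) * mderiv α K ((h i)⁻¹ • (x - X i ω))

/-! ### Conditions on the kernel, the bandwidth, the normalisation and the density -/

/-- `K` is bounded and integrable, has integral one and vanishes at infinity. -/
structure IsKernel {d : ℕ} (K : E d → ℝ) : Prop where
  bounded : Bdd K
  integrable : Integrable K
  integral_eq_one : ∫ z, K z = 1
  vanishes : Tendsto K (cocompact (E d)) (𝓝 0)

/-- Power bandwidth `h_n = c n^{-a}` with `0 < a < 1/d` and `c > 0`. -/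
def PowerBandwidth (d : ℕ) (a : ℝ) (h : ℕ → ℝ) : Prop :=
  0 < a ∧ a < 1 / (d : ℝ) ∧ ∃ c : ℝ, 0 < c ∧ ∀ n : ℕ, 1 ≤ n → h n = c * (n : ℝ) ^ (-a)

/-- `h_n = η(n)` where `η` is locally bounded on `(0, ∞)` and varies regularly with
exponent `-a`, `0 < a < 1/(d+2|α|)`. -/
def RegularBandwidth {d : ℕ} (α : Fin d → ℕ) (a : ℝ) (h : ℕ → ℝ) : Prop :=
  0 < a ∧ a < 1 / ((d : ℝ) + 2 * (mlen α : ℝ)) ∧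
    ∃ η : ℝ → ℝ, (∀ t, 0 < t → ∃ C : ℝ, ∀ᶠ x in 𝓝 t, |η x| ≤ C) ∧
      RegularlyVarying η (-a) ∧ ∀ n : ℕ, 1 ≤ n → h n = η n

/-- Differentiability of the kernel. -/
structure KernelDiff {d : ℕ} (α : Fin d → ℕ) (K : E d → ℝ) : Prop where
  diff : TimesDiff (mlen α) K
  vanishes : ∀ j < mlen α,
    Tendsto (fun x => ‖iteratedFDeriv ℝ j K x‖) (cocompact (E d)) (𝓝 0)
  bounded : Bdd (mderiv α K)
  integrable : Integrable (mderiv α K)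
  integral_sq_ne_zero : ∫ z, mderiv α K z ^ 2 ≠ 0

/-- Differentiability of the density. -/
structure DensityDiff {d : ℕ} (α : Fin d → ℕ) (f : E d → ℝ) : Prop where
  diff : TimesDiff (mlen α) f
  bounded : ∀ j < mlen α, ∃ C : ℝ, ∀ x, ‖iteratedFDeriv ℝ j f x‖ ≤ C

/-- `v_n = 1` for all `n ≥ 1`. -/
def IsOne (v : ℕ → ℝ) : Prop := ∀ n : ℕ, 1 ≤ n → v n = 1

/-- The moderate deviations scale: `v_n → ∞` and `v_n² / ∑_{i≤n} h_i^{d+2|α|} → 0`. -/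
structure ModerateScale {d : ℕ} (α : Fin d → ℕ) (h v : ℕ → ℝ) : Prop where
  tendsto_atTop : Tendsto v atTop atTop
  tendsto_zero : Tendsto (fun n => v n ^ 2 / hsum α h n) atTop (𝓝 0)

/-- The bias conditions of order `q`. The integral in `moments` is over the single
coordinate `y_j`, the other coordinates being fixed. -/
structure BiasOrder {d : ℕ} (α : Fin d → ℕ) (K f : E d → ℝ) (h v : ℕ → ℝ) (q : ℕ) :
    Prop where
  two_le : 2 ≤ q
  moments : ∀ s : ℕ, 1 ≤ s → s ≤ q - 1 → ∀ j : Fin d,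
    ∀ᵐ y : E d, ∫ t : ℝ, t ^ s * K (setCoord y j t) = 0
  integrable : ∀ j : Fin d, Integrable (fun y : E d => |(y j) ^ q * K y|)
  bandwidth : Tendsto (fun n : ℕ => v n / (n : ℝ) * ∑ i ∈ Finset.Icc 1 n, h i ^ q)
    atTop (𝓝 0)
  diff : TimesDiff q (mderiv α f)
  bounded : ∃ M : ℝ, ∀ x, ‖iteratedFDeriv ℝ q (mderiv α f) x‖ ≤ M

/-- `f` has some finite moment of positive order and is uniformly continuous. -/
structure DensityRegular {d : ℕ} (f : E d → ℝ) : Prop where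
  moment : ∃ ξ : ℝ, 0 < ξ ∧ Integrable (fun x => ‖x‖ ^ ξ * f x)
  uniformContinuous : UniformContinuous f

/-- `∂^α K` is Hölder continuous and `‖z‖^γ ∂^α K(z)` is bounded for some `γ > 0`. -/
structure KernelRegular {d : ℕ} (α : Fin d → ℕ) (K : E d → ℝ) : Prop where
  holder : ∃ C r : NNReal, 0 < r ∧ HolderWith C r (mderiv α K)
  decay : ∃ γ : ℝ, 0 < γ ∧ Bdd (fun z => ‖z‖ ^ γ * mderiv α K z)

/-- Logarithmic conditions relating `h_n` and `v_n`. -/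
structure LogScale {d : ℕ} (α : Fin d → ℕ) (h v : ℕ → ℝ) : Prop where
  bandwidth : Tendsto (fun n => v n ^ 2 * Real.log (1 / h n) / hsum α h n) atTop (𝓝 0)
  scale : Tendsto (fun n => v n ^ 2 * Real.log (v n) / hsum α h n) atTop (𝓝 0)

/-- Decay of the kernel and of `∂^α f`. -/
structure TailDecay {d : ℕ} (α : Fin d → ℕ) (K f : E d → ℝ) : Prop where
  kernel : ∃ ζ : ℝ, 0 < ζ ∧ Integrable (fun z => ‖z‖ ^ ζ * |K z|)
  density : ∃ η : ℝ, 0 < η ∧ Bdd (fun z => ‖z‖ ^ η * mderiv α f z)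

/-- All the hypotheses for the uniform deviations on an unbounded set. -/
structure UniformHyp {d : ℕ} {Ω : Type*} [MeasurableSpace Ω] (μ : Measure Ω)
    (X : ℕ → Ω → E d) (f K : E d → ℝ) (α : Fin d → ℕ) (a : ℝ) (h v : ℕ → ℝ) : Prop where
  sample : IIDWithDensity μ X f
  v_pos : ∀ n : ℕ, 1 ≤ n → 0 < v n
  kernel : IsKernel K
  bias : ∃ q : ℕ, BiasOrder α K f h v q
  density : DensityRegular f
  kernelRegular : KernelRegular α K
  logScale : LogScale α h v
  tail : TailDecay α K f
  regime : (mlen α = 0 ∧ IsOne v ∧ PowerBandwidth d a h) ∨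
    (((1 ≤ mlen α ∧ IsOne v) ∨ ModerateScale α h v) ∧
      RegularBandwidth α a h ∧ KernelDiff α K ∧ DensityDiff α f)

/-! ### The rate functions -/

/-- `ψ(u) = ∫_{[0,1]×ℝ^d} s^{-ad} (exp(s^{ad} u/(1-ad) K(z)) - 1) ds dz`. -/
def psi {d : ℕ} (a : ℝ) (K : E d → ℝ) (u : ℝ) : ℝ :=
  ∫ p in Icc (0 : ℝ) 1 ×ˢ (univ : Set (E d)),
    p.1 ^ (-(a * d)) * (Real.exp (p.1 ^ (a * d) * (u / (1 - a * d)) * K p.2) - 1)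

/-- `I(t) = sup_u (u t - ψ(u))`, with values in the extended reals. -/
def rateI {d : ℕ} (a : ℝ) (K : E d → ℝ) (t : ℝ) : EReal :=
  ⨆ u : ℝ, ((u * t - psi a K u : ℝ) : EReal)

/-- `‖f‖_{U,∞} = sup_{x ∈ U} |f(x)|` (zero if `U` is empty). -/
def supOn {d : ℕ} (U : Set (E d)) (f : E d → ℝ) : ℝ := ⨆ x : U, |f x|

open scoped Classical in
/-- The function `g_U`. If `‖f‖_{U,∞} = 0`, it is `0` at `0` and `+∞` elsewhere. -/
def gU {d : ℕ} (f K : E d → ℝ) (α : Fin d → ℕ) (a : ℝ) (v : ℕ → ℝ) (U : Set (E d))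
    (δ : ℝ) : EReal :=
  if supOn U f = 0 then (if δ = 0 then 0 else ⊤)
  else if mlen α = 0 ∧ IsOne v then
    ((supOn U f * (1 - a * d) : ℝ) : EReal) *
      rateI a K (1 / (1 - a * d) + δ / (supOn U f * (1 - a * d)))
  else
    ((δ ^ 2 * (1 - a ^ 2 * ((d : ℝ) + 2 * (mlen α : ℝ)) ^ 2) /
      (2 * supOn U f * ∫ z, mderiv α K z ^ 2) : ℝ) : EReal)

/-- `g̃_U(δ) = min (g_U(δ)) (g_U(-δ))`. -/
def gUtilde {d : ℕ} (f K : E d → ℝ) (α : Fin d → ℕ) (a : ℝ) (v : ℕ → ℝ) (U : Set (E d))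
    (δ : ℝ) : EReal :=
  min (gU f K α a v U δ) (gU f K α a v U (-δ))

/-- `sup_{x ∈ U} v_n |∂^α f_n(x) - ∂^α f(x)|`, as an extended real. -/
def supDev {d : ℕ} {Ω : Type*} (X : ℕ → Ω → E d) (f K : E d → ℝ) (α : Fin d → ℕ)
    (h v : ℕ → ℝ) (U : Set (E d)) (n : ℕ) (ω : Ω) : EReal :=
  ⨆ x ∈ U, ((v n * |estimator α K h X n ω x - mderiv α f x| : ℝ) : EReal)

end RecKernel

end

noncomputable section

namespace RecKernel

/-! ### Slow variation -/

/-! Let s_n = a_n / v_n² be the speed, κ = ∂^α K, and Z_n(x) = v_n (∂^α f_n(x) - E ∂^α f_n(x)). As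
Z_n(x) is a sum of independent terms, its cumulant at s_n θ is a sum over i. Centering removes the
linear parts; what remains of the i-th term is, to leading order, a weight times the integral of κ²
(e^{cκ} - 1 - cκ)/(cκ)² against f(x - h_i z). Uniform continuity of f lets f(x) be pulled out, and
regular variation of h turns the sum over i into an integral over s in (0, 1]. Hence s_n⁻¹ log E
exp(s_n θ Z_n(x)) tends to f(x) Ψ(θ) uniformly in x (`eventually_abs_cgf_centered_sub_le`), where Ψ
≥ 0 depends on v_n only through ℓ = lim h_n^{|α|} / v_n.

The bias is negligible: the derivatives are moved from K to f by differentiating the convolution on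
either side, and a Taylor expansion, one coordinate at a time, kills the moments of order 1, ..., q
- 1 (`eventually_bias_le`).

Upper bound (`eventually_measure_le`). A polynomial in v_n, 1/h_n and n is at most e^{η s_n} for
every η > 0. So a net of at most e^{η s_n} points of U controls the supremum over a ball of radius
e^{ρ s_n}, by Hölder continuity of κ. Outside that ball κ and ∂^α f are negligible unless some
observation is huge, which by the moment assumption has probability at most e^{-A s_n} for any A.
Chernoff's bound at each point of the net, with f(x) ≤ b = sup_U f and Ψ ≥ 0, gives the smaller of
the Legendre transforms of bΨ at δ and at -δ.

Lower bound (`eventually_le_measure`). A single point x of U with f(x) close to b suffices, by the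
lower half of the Gärtner-Ellis theorem (`eventually_exp_le_measureReal`). This needs the derivative
of Ψ to reach the required slope, which holds on the side of a sign that κ takes (`Steep`). If K ≥ 0
in the large deviations regime, the negative side fails, but there Ψ(-θ) ≤ Ψ(θ), so the positive
side already gives the minimum.

It remains to identify the rate. If ℓ = 0, Ψ is quadratic and its Legendre transform is the Gaussian
rate. If ℓ = 1, then ψ(u) = (u + Ψ(u)) / (1 - ad), and the shift 1/(1 - ad) in the argument of I
cancels the linear part. -/

theorem exists_forall_abs_sub_le_of_tendsto_sub {l : ℝ → ℝ} (hl : Measurable l)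
    (h : ∀ u, Tendsto (fun x => l (x + u) - l x) atTop (𝓝 0)) {ε : ℝ} (hε : 0 < ε) :
    ∃ X, ∀ x, X ≤ x → ∀ u ∈ Icc (0 : ℝ) 1, |l (x + u) - l x| ≤ ε := by
  -- Uniform convergence theorem for slow variation, in additive form. A failure gives x_n → ∞ and
  -- u_n in [0, 1] with |l(x_n + u_n) - l(x_n)| > ε. For t in [1, 2], l(x_n + t) is then ε/2-far
  -- from l(x_n) or from l(x_n + u_n). So two bad subsets of [0, 2], one of them translated by u_n,
  -- cover an interval of length 1, although their measures tend to 0.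
  by_contra! hcon
  choose x hx u hu hlt using fun n : ℕ => hcon n
  have key : ∀ y : ℕ → ℝ, Tendsto y atTop atTop →
      Tendsto (fun n => (volume.restrict (Icc (0 : ℝ) 2))
        {t | ε / 2 ≤ ‖(l (y n + t) - l (y n)) - 0‖}) atTop (𝓝 0) := by
    intro y hy
    have := tendstoInMeasure_of_tendsto_ae (μ := volume.restrict (Icc (0 : ℝ) 2))
      (f := fun n t => l (y n + t) - l (y n)) (g := fun _ => 0)
      (fun n => ((hl.comp (measurable_const_add _)).sub_const _).aestronglyMeasurable)
      (ae_of_all _ fun t => (h t).comp hy)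
    exact tendstoInMeasure_iff_norm.1 this (ε / 2) (by positivity)
  have hxt : Tendsto x atTop atTop :=
    tendsto_atTop_mono hx tendsto_natCast_atTop_atTop
  have hxu : Tendsto (fun n => x n + u n) atTop atTop :=
    tendsto_atTop_mono (fun n => (by linarith [(hu n).1] : x n ≤ x n + u n)) hxt
  have hsum := (key x hxt).add (key _ hxu)
  rw [add_zero] at hsum
  obtain ⟨n, hn⟩ := (hsum.eventually_lt_const (zero_lt_one)).exists
  refine absurd hn (not_lt.2 ?_)
  set A : Set ℝ := {t | ε / 2 ≤ ‖(l (x n + t) - l (x n)) - 0‖}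
  set B : Set ℝ := {t | ε / 2 ≤ ‖(l (x n + u n + t) - l (x n + u n)) - 0‖}
  have hmB : MeasurableSet B := by
    refine measurableSet_le measurable_const ?_
    exact (((hl.comp (measurable_const_add _)).sub_const _).sub_const 0).norm
  have hmA : MeasurableSet A := by
    refine measurableSet_le measurable_const ?_
    exact (((hl.comp (measurable_const_add _)).sub_const _).sub_const 0).norm
  have hsub : Icc (1 : ℝ) 2 ⊆ (A ∩ Icc 0 2) ∪ (fun t => t + (-u n)) ⁻¹' (B ∩ Icc 0 2) := by
    intro t ht
    by_cases hA : t ∈ A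
    · exact Or.inl ⟨hA, by linarith [ht.1], ht.2⟩
    · right
      have h1 := (hu n).1
      have h2 := (hu n).2
      refine ⟨?_, by linarith [ht.1], by linarith [ht.2]⟩
      simp only [A, mem_ofPred_eq, not_le, sub_zero, Real.norm_eq_abs] at hA
      simp only [B, mem_ofPred_eq, sub_zero, Real.norm_eq_abs]
      rw [show x n + u n + (t + -u n) = x n + t by ring]
      have h3 := hlt n
      by_contra! hB
      have : |l (x n + u n) - l (x n)| ≤
          |l (x n + t) - l (x n)| + |l (x n + t) - l (x n + u n)| := by
        rw [show l (x n + u n) - l (x n) =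
          (l (x n + t) - l (x n)) - (l (x n + t) - l (x n + u n)) by ring]
        exact abs_sub _ _
      linarith
  calc (1 : ENNReal) = volume (Icc (1 : ℝ) 2) := by rw [Real.volume_Icc]; norm_num
    _ ≤ volume (A ∩ Icc 0 2) + volume ((fun t => t + (-u n)) ⁻¹' (B ∩ Icc 0 2)) :=
        (measure_mono hsub).trans (measure_union_le _ _)
    _ = _ := by
        rw [measure_preimage_add_right, Measure.restrict_apply hmA, Measure.restrict_apply hmB]

/-- Potter's bound in additive form: chain the uniform estimate over unit steps. -/
theorem exists_forall_abs_sub_le_mul {l : ℝ → ℝ} (hl : Measurable l)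
    (h : ∀ u, Tendsto (fun x => l (x + u) - l x) atTop (𝓝 0)) {ε : ℝ} (hε : 0 < ε) :
    ∃ X, ∀ x, X ≤ x → ∀ u, 0 ≤ u → |l (x + u) - l x| ≤ ε * (u + 1) := by
  obtain ⟨X, hX⟩ := exists_forall_abs_sub_le_of_tendsto_sub hl h hε
  refine ⟨X, ?_⟩
  have key : ∀ k : ℕ, ∀ x, X ≤ x → ∀ u : ℝ, 0 ≤ u → u ≤ k + 1 → |l (x + u) - l x| ≤ ε * (k + 1) := by
    intro k
    induction k with
    | zero => intro x hx u h0 h1; simpa using hX x hx u ⟨h0, by simpa using h1⟩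
    | succ k ih =>
      intro x hx u h0 h1
      push_cast at h1 ⊢
      by_cases hu : u ≤ 1
      · have := hX x hx u ⟨h0, hu⟩
        have hk : (0 : ℝ) ≤ k := k.cast_nonneg
        nlinarith
      · push Not at hu
        have e1 := hX x hx 1 ⟨by norm_num, le_rfl⟩
        have e2 := ih (x + 1) (by linarith) (u - 1) (by linarith) (by linarith)
        rw [show x + 1 + (u - 1) = x + u by ring] at e2
        calc |l (x + u) - l x| = |(l (x + u) - l (x + 1)) + (l (x + 1) - l x)| := by ring_nf
          _ ≤ _ := abs_add_le _ _
          _ ≤ _ := by linarith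
  intro x hx u hu
  have h1 := key ⌊u⌋₊ x hx u hu (Nat.lt_floor_add_one u).le
  have h2 := Nat.floor_le hu
  nlinarith

theorem SlowlyVarying.measurable_log {L : ℝ → ℝ} (hL : SlowlyVarying L) :
    Measurable fun x => Real.log (L (Real.exp x)) :=
  Real.measurable_log.comp <| hL.measurable.comp
    ((Real.measurable_exp).subtype_mk (h := fun x => Real.exp_pos x))

theorem SlowlyVarying.tendsto_log {L : ℝ → ℝ} (hL : SlowlyVarying L) (u : ℝ) :
    Tendsto (fun x => Real.log (L (Real.exp (x + u))) - Real.log (L (Real.exp x)))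
      atTop (𝓝 0) := by
  have h1 := (hL.tendsto (Real.exp u) (Real.exp_pos u)).comp Real.tendsto_exp_atTop
  have h2 := h1.log one_ne_zero
  rw [Real.log_one] at h2
  refine h2.congr fun x => ?_
  have p1 := hL.pos (Real.exp x * Real.exp u) (by positivity)
  have p2 := hL.pos (Real.exp x) (by positivity)
  simp only [Function.comp]
  rw [Real.log_div p1.ne' p2.ne', Real.exp_add]

theorem SlowlyVarying.exists_abs_log_sub_le {L : ℝ → ℝ} (hL : SlowlyVarying L) {ε : ℝ}
    (hε : 0 < ε) : ∃ X, 1 ≤ X ∧ ∀ x y, X ≤ x → x ≤ y →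
      |Real.log (L y) - Real.log (L x)| ≤ ε * (Real.log (y / x) + 1) := by
  obtain ⟨X, hX⟩ := exists_forall_abs_sub_le_mul hL.measurable_log hL.tendsto_log hε
  refine ⟨max 1 (Real.exp X), le_max_left _ _, fun x y hx hxy => ?_⟩
  have hx0 : 0 < x := lt_of_lt_of_le one_pos ((le_max_left _ _).trans hx)
  have hy0 : 0 < y := hx0.trans_le hxy
  have h1 := hX (Real.log x) ((Real.le_log_iff_exp_le hx0).2 ((le_max_right _ _).trans hx))
    (Real.log (y / x)) (Real.log_nonneg ((one_le_div hx0).2 hxy))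
  rwa [Real.log_div hy0.ne' hx0.ne', add_sub_cancel, Real.exp_log hx0, Real.exp_log hy0,
    ← Real.log_div hy0.ne' hx0.ne'] at h1

/-- Along the integers Potter's bound holds from the first index on: the finitely many indices below
the threshold only enlarge the constant. -/
theorem SlowlyVarying.exists_abs_log_sub_nat_le {L : ℝ → ℝ} (hL : SlowlyVarying L) {ε : ℝ}
    (hε : 0 < ε) : ∃ C, ∀ i n : ℕ, 1 ≤ i → i ≤ n →
      |Real.log (L n) - Real.log (L i)| ≤ ε * Real.log (n / i) + C := by
  obtain ⟨X, hX1, hX⟩ := hL.exists_abs_log_sub_le hε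
  set N := ⌈X⌉₊
  have hN : X ≤ N := Nat.le_ceil X
  have hN1 : (1 : ℝ) ≤ N := hX1.trans hN
  set D := ∑ i ∈ Finset.range (N + 1), |Real.log (L N) - Real.log (L i)|
  have hD : ∀ i ≤ N, |Real.log (L N) - Real.log (L i)| ≤ D := fun i hi =>
    Finset.single_le_sum (f := fun i : ℕ => |Real.log (L N) - Real.log (L i)|)
      (fun _ _ => abs_nonneg _) (by simp; omega)
  have hD0 : 0 ≤ D := Finset.sum_nonneg fun _ _ => abs_nonneg _
  -- The ε is the additive term of Potter's bound; each of i and n below the threshold `N` costs at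
  -- most `D`.
  refine ⟨ε + 2 * D, fun i n hi hin => ?_⟩
  have hi0 : (1 : ℝ) ≤ i := by exact_mod_cast hi
  have hin' : (i : ℝ) ≤ n := by exact_mod_cast hin
  have hlog : 0 ≤ Real.log (n / i) := Real.log_nonneg ((one_le_div (by linarith)).2 hin')
  by_cases hiN : N ≤ i
  · have := hX i n (hN.trans (by exact_mod_cast hiN)) hin'
    linarith
  · push Not at hiN
    by_cases hnN : N ≤ n
    · have h1 := hX N n hN (by exact_mod_cast hnN)
      have h2 := hD i hiN.le
      have h3 : Real.log (n / N) ≤ Real.log (n / i) := by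
        have : (i : ℝ) ≤ N := by exact_mod_cast hiN.le
        apply Real.log_le_log (by have : (1 : ℝ) ≤ n := hi0.trans hin'; positivity)
        exact div_le_div_of_nonneg_left (by linarith) (by linarith) this
      calc _ ≤ |Real.log (L n) - Real.log (L N)| + |Real.log (L N) - Real.log (L i)| :=
            abs_sub_le _ _ _
        _ ≤ _ := by nlinarith
    · push Not at hnN
      have h1 := hD n hnN.le
      rw [abs_sub_comm] at h1
      have h2 := hD i hiN.le
      calc _ ≤ |Real.log (L n) - Real.log (L N)| + |Real.log (L N) - Real.log (L i)| :=
            abs_sub_le _ _ _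
        _ ≤ _ := by nlinarith

/-- The ratio ⌈sn⌉ / (sn) varies with n, so the pointwise definition of slow variation is not
enough. Potter's bound applies because this ratio lies in [1, 2] eventually. -/
theorem SlowlyVarying.tendsto_ceil {L : ℝ → ℝ} (hL : SlowlyVarying L) {s : ℝ} (hs : 0 < s) :
    Tendsto (fun n : ℕ => Real.log (L n) - Real.log (L (⌈s * n⌉₊ : ℕ)))
      atTop (𝓝 0) := by
  have hn := tendsto_natCast_atTop_atTop (R := ℝ)
  have hlim : Tendsto (fun n : ℕ => (Real.log (L n) - Real.log (L (s * n)))) atTop (𝓝 0) := by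
    have h1 := ((hL.tendsto s hs).comp hn).log one_ne_zero
    rw [Real.log_one] at h1
    have h2 := h1.neg
    rw [neg_zero] at h2
    refine h2.congr' ?_
    filter_upwards [eventually_ge_atTop 1] with n hn1
    have hn0 : (0 : ℝ) < n := by exact_mod_cast hn1
    simp only [Function.comp]
    rw [Real.log_div (hL.pos _ (by positivity)).ne' (hL.pos _ hn0).ne', mul_comm (n : ℝ) s]
    ring
  have hlim2 : Tendsto (fun n : ℕ =>
      Real.log (L (⌈s * n⌉₊ : ℕ)) - Real.log (L (s * n))) atTop (𝓝 0) := by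
    rw [Metric.tendsto_atTop']
    intro ε hε
    obtain ⟨X, hX1, hX⟩ := hL.exists_abs_log_sub_le (ε := ε / 3) (by positivity)
    have hsn : Tendsto (fun n : ℕ => s * (n : ℝ)) atTop atTop := hn.const_mul_atTop hs
    obtain ⟨N, hN⟩ := eventually_atTop.1 (hsn.eventually_ge_atTop X)
    refine ⟨N, fun n hn => ?_⟩
    have h1 := hN n hn.le
    have h0 : (1 : ℝ) ≤ s * n := hX1.trans h1
    have h2 := Nat.le_ceil (s * n)
    have h3 := Nat.ceil_lt_add_one (a := s * n) (by linarith)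
    have h4 := hX _ _ h1 h2
    have h5 : Real.log ((⌈s * n⌉₊ : ℕ) / (s * n)) ≤ 1 := by
      refine (Real.log_le_sub_one_of_pos (by positivity)).trans ?_
      have : ((⌈s * n⌉₊ : ℕ) : ℝ) / (s * n) ≤ 2 := by
        rw [div_le_iff₀ (by linarith)]; linarith
      linarith
    rw [Real.dist_eq, sub_zero]
    nlinarith
  have := hlim.sub hlim2
  rw [sub_zero] at this
  exact this.congr fun n => by ring

/-- A sequence of positive numbers with the asymptotic properties of a regularly varying
function of exponent `-a`. -/
structure RegVarSeq (h : ℕ → ℝ) (a : ℝ) : Prop where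
  pos : ∀ i, 1 ≤ i → 0 < h i
  tendsto : ∀ s : ℝ, 0 < s → s ≤ 1 →
    Tendsto (fun n : ℕ => h ⌈s * n⌉₊ / h n) atTop (𝓝 (s ^ (-a)))
  potter : ∀ ε : ℝ, 0 < ε → ∃ C : ℝ, 0 < C ∧ ∀ i n : ℕ, 1 ≤ i → i ≤ n →
    h i / h n ≤ C * ((n : ℝ) / i) ^ (a + ε) ∧ h n / h i ≤ C * ((n : ℝ) / i) ^ (-a + ε)

theorem RegularlyVarying.regVarSeq {G : ℝ → ℝ} {a : ℝ} (hG : RegularlyVarying G (-a))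
    {h : ℕ → ℝ} (hh : ∀ n : ℕ, 1 ≤ n → h n = G n) : RegVarSeq h a := by
  obtain ⟨L, hL, hGL⟩ := hG
  have hh' : ∀ n : ℕ, 1 ≤ n → h n = (n : ℝ) ^ (-a) * L n := fun n hn => by
    rw [hh n hn, hGL n (by exact_mod_cast hn)]
  have hpos : ∀ n : ℕ, 1 ≤ n → 0 < h n := fun n hn => by
    have hn0 : (0 : ℝ) < n := by exact_mod_cast hn
    rw [hh' n hn]
    have := hL.pos n hn0
    positivity
  have hlog : ∀ n : ℕ, 1 ≤ n → Real.log (h n) = -a * Real.log n + Real.log (L n) := by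
    intro n hn
    have hn0 : (0 : ℝ) < n := by exact_mod_cast hn
    rw [hh' n hn, Real.log_mul (by positivity) (hL.pos n hn0).ne', Real.log_rpow hn0]
  refine ⟨hpos, fun s hs _ => ?_, fun ε hε => ?_⟩
  · have hn := tendsto_natCast_atTop_atTop (R := ℝ)
    have h1 := tendsto_nat_ceil_mul_div_atTop (R := ℝ) hs.le
    have h1' := (h1.comp hn).log hs.ne'
    have h2 := (h1'.const_mul (-a)).sub (hL.tendsto_ceil hs)
    have h3 := h2.rexp
    rw [sub_zero, mul_comm, ← Real.rpow_def_of_pos hs] at h3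
    refine h3.congr' ?_
    filter_upwards [eventually_ge_atTop 1] with n hn1
    have hn0 : (0 : ℝ) < n := by exact_mod_cast hn1
    have hc : 1 ≤ ⌈s * n⌉₊ := Nat.one_le_iff_ne_zero.2 (Nat.ceil_pos.2 (by positivity)).ne'
    have hc0 : (0 : ℝ) < (⌈s * n⌉₊ : ℕ) := by exact_mod_cast hc
    have e : h ⌈s * n⌉₊ / h n = Real.exp (Real.log (h ⌈s * n⌉₊) - Real.log (h n)) := by
      rw [Real.exp_sub, Real.exp_log (hpos _ hc), Real.exp_log (hpos _ hn1)]
    rw [e, hlog _ hc, hlog _ hn1]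
    simp only [Function.comp]
    rw [Real.log_div hc0.ne' hn0.ne']
    ring_nf
  · obtain ⟨C, hC⟩ := hL.exists_abs_log_sub_nat_le hε
    refine ⟨Real.exp C, Real.exp_pos _, fun i n hi hin => ?_⟩
    have hi0 : (0 : ℝ) < i := by exact_mod_cast hi
    have hn : 1 ≤ n := hi.trans hin
    have hn0 : (0 : ℝ) < n := by exact_mod_cast hn
    have hb := abs_le.1 (hC i n hi hin)
    have hni : (0 : ℝ) < n / i := by positivity
    have e : ∀ p q, 1 ≤ p → 1 ≤ q →
        h p / h q = Real.exp (Real.log (h p) - Real.log (h q)) := fun p q hp hq => by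
      rw [Real.exp_sub, Real.exp_log (hpos _ hp), Real.exp_log (hpos _ hq)]
    rw [Real.rpow_def_of_pos hni, Real.rpow_def_of_pos hni, ← Real.exp_add, ← Real.exp_add,
      e _ _ hi hn, e _ _ hn hi, hlog _ hi, hlog _ hn, Real.exp_le_exp, Real.exp_le_exp]
    rw [Real.log_div hn0.ne' hi0.ne'] at *
    constructor <;> nlinarith

theorem slowlyVarying_const {c : ℝ} (hc : 0 < c) : SlowlyVarying fun _ => c :=
  ⟨measurable_const, fun _ _ => hc, fun _ _ => by
    simp only [div_self hc.ne']; exact tendsto_const_nhds⟩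

end RecKernel

end

noncomputable section

namespace RecKernel

/-! ### Averages along regularly varying sequences -/

/-- The sum is the integral of a step function, which is constant on each interval (k, k+1]. In this
form the limits of averages follow from dominated convergence on (0, 1]. -/
theorem sum_Icc_eq_integral_ceil (u : ℕ → ℝ) (n : ℕ) :
    ∑ i ∈ Finset.Icc 1 n, u i = n * ∫ s in Ioc (0 : ℝ) 1, u ⌈s * n⌉₊ := by
  rcases Nat.eq_zero_or_pos n with rfl | hn
  · simp
  have hn0 : (0 : ℝ) < n := by exact_mod_cast hn
  have hk : ∀ k : ℕ, EqOn (fun t : ℝ => u ⌈t⌉₊) (fun _ => u (k + 1)) (Ioc (k : ℝ) (k + 1)) := by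
    intro k t ht
    have : ⌈t⌉₊ = k + 1 := by
      rw [Nat.ceil_eq_iff (by simp)]
      simpa using ht
    simp only [this]
  have hint : ∀ k : ℕ, IntervalIntegrable (fun t : ℝ => u ⌈t⌉₊) volume (k : ℝ) ((k + 1 : ℕ) : ℝ) := by
    intro k
    push_cast
    rw [intervalIntegrable_iff_integrableOn_Ioc_of_le (by linarith)]
    exact (integrableOn_congr_fun (hk k) measurableSet_Ioc).2 (by simp)
  have h1 := intervalIntegral.sum_integral_adjacent_intervals
    (f := fun t : ℝ => u ⌈t⌉₊) (μ := volume) (a := fun k : ℕ => (k : ℝ)) (n := n)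
    (fun k _ => hint k)
  have h2 : ∀ k : ℕ, ∫ t in (k : ℝ)..((k + 1 : ℕ) : ℝ), u ⌈t⌉₊ = u (k + 1) := by
    intro k
    push_cast
    rw [intervalIntegral.integral_of_le (by linarith),
      setIntegral_congr_fun measurableSet_Ioc (hk k)]
    simp
  rw [Finset.sum_congr rfl fun k _ => h2 k] at h1
  have h3 := intervalIntegral.integral_comp_mul_right (a := 0) (b := 1)
    (fun t : ℝ => u ⌈t⌉₊) hn0.ne'
  rw [← intervalIntegral.integral_of_le zero_le_one, h3, zero_mul, one_mul]
  have h4 : ∑ i ∈ Finset.Icc 1 n, u i = ∑ k ∈ Finset.range n, u (k + 1) := by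
    rw [Finset.range_eq_Ico, Finset.sum_Ico_add' u 0 n 1]
    rfl
  rw [h4, h1, smul_eq_mul, mul_inv_cancel_left₀ hn0.ne']
  simp

theorem ceil_mul_mem {s : ℝ} (hs : s ∈ Ioc (0 : ℝ) 1) {n : ℕ} (hn : 1 ≤ n) :
    1 ≤ ⌈s * n⌉₊ ∧ ⌈s * n⌉₊ ≤ n ∧ (n : ℝ) / (⌈s * n⌉₊ : ℕ) ≤ s⁻¹ := by
  have hn0 : (0 : ℝ) < n := by exact_mod_cast hn
  have h1 : 1 ≤ ⌈s * n⌉₊ :=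
    Nat.one_le_iff_ne_zero.2 (Nat.ceil_pos.2 (mul_pos hs.1 hn0)).ne'
  refine ⟨h1, Nat.ceil_le.2 ?_, ?_⟩
  · nlinarith [hs.2]
  · have hc0 : (0 : ℝ) < (⌈s * n⌉₊ : ℕ) := by exact_mod_cast h1
    rw [inv_eq_one_div, div_le_div_iff₀ hc0 hs.1, one_mul, mul_comm]
    exact Nat.le_ceil _

theorem tendsto_average_of_dominated {u : ℕ → ℕ → ℝ} {g B : ℝ → ℝ}
    (hB : IntegrableOn B (Ioc 0 1))
    (hbound : ∀ᶠ n in atTop, ∀ s ∈ Ioc (0 : ℝ) 1, |u n ⌈s * n⌉₊| ≤ B s)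
    (hlim : ∀ s ∈ Ioc (0 : ℝ) 1, Tendsto (fun n : ℕ => u n ⌈s * n⌉₊) atTop (𝓝 (g s))) :
    Tendsto (fun n : ℕ => (n : ℝ)⁻¹ * ∑ i ∈ Finset.Icc 1 n, u n i) atTop
      (𝓝 (∫ s in Ioc (0 : ℝ) 1, g s)) := by
  have h1 : Tendsto (fun n : ℕ => ∫ s in Ioc (0 : ℝ) 1, u n ⌈s * n⌉₊) atTop
      (𝓝 (∫ s in Ioc (0 : ℝ) 1, g s)) := by
    refine tendsto_integral_filter_of_dominated_convergence B ?_ ?_ hB ?_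
    · refine Eventually.of_forall fun n => Measurable.aestronglyMeasurable ?_
      exact (measurable_from_nat (f := u n)).comp
        (Nat.measurable_ceil.comp (measurable_id.mul_const _))
    · filter_upwards [hbound] with n hn
      exact (ae_restrict_iff' measurableSet_Ioc).2 (ae_of_all _ fun s hs => hn s hs)
    · exact (ae_restrict_iff' measurableSet_Ioc).2 (ae_of_all _ fun s hs => hlim s hs)
  refine h1.congr' ?_
  filter_upwards [eventually_ge_atTop 1] with n hn
  have hn0 : (n : ℝ) ≠ 0 := by positivity
  rw [sum_Icc_eq_integral_ceil, inv_mul_cancel_left₀ hn0]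

theorem integral_Ioc_rpow {r : ℝ} (hr : -1 < r) :
    ∫ s in Ioc (0 : ℝ) 1, s ^ r = 1 / (r + 1) := by
  rw [← intervalIntegral.integral_of_le zero_le_one, integral_rpow (Or.inl hr)]
  rw [Real.one_rpow, Real.zero_rpow (by linarith), sub_zero]

theorem integrableOn_Ioc_rpow {r : ℝ} (hr : -1 < r) :
    IntegrableOn (fun s : ℝ => s ^ r) (Ioc 0 1) :=
  (intervalIntegrable_iff_integrableOn_Ioc_of_le zero_le_one).1
    (intervalIntegral.intervalIntegrable_rpow' hr)

theorem rpow_pow_eq {s : ℝ} (hs : 0 ≤ s) (r : ℝ) (p : ℕ) : (s ^ r) ^ p = s ^ (r * p) := by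
  rw [Real.rpow_mul hs, Real.rpow_natCast]

section RegVarSeq

variable {h : ℕ → ℝ} {a : ℝ}

theorem RegVarSeq.exists_div_le (H : RegVarSeq h a) (ha : 0 < a) :
    ∃ C : ℝ, 0 < C ∧ ∀ i n : ℕ, 1 ≤ i → i ≤ n → h n / h i ≤ C := by
  obtain ⟨C, hC, hp⟩ := H.potter a ha
  refine ⟨C, hC, fun i n hi hin => ((hp i n hi hin).2).trans ?_⟩
  simp

theorem RegVarSeq.exists_le_rpow (H : RegVarSeq h a) (ha : 0 < a) :
    ∃ C : ℝ, 0 < C ∧ ∀ n : ℕ, 1 ≤ n → h n ≤ C * (n : ℝ) ^ (-(a / 2)) := by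
  obtain ⟨C, hC, hp⟩ := H.potter (a / 2) (by positivity)
  have h1 := H.pos 1 le_rfl
  refine ⟨C * h 1, by positivity, fun n hn => ?_⟩
  have := (hp 1 n le_rfl hn).2
  rw [div_le_iff₀ h1, Nat.cast_one, div_one, show -a + a / 2 = -(a / 2) by ring] at this
  linarith

theorem RegVarSeq.tendsto_zero (H : RegVarSeq h a) (ha : 0 < a) :
    Tendsto h atTop (𝓝 0) := by
  obtain ⟨C, hC, hp⟩ := H.exists_le_rpow ha
  have h1 : Tendsto (fun n : ℕ => C * (n : ℝ) ^ (-(a / 2))) atTop (𝓝 (C * 0)) :=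
    ((tendsto_rpow_neg_atTop (by positivity)).comp
      (tendsto_natCast_atTop_atTop (R := ℝ))).const_mul C
  rw [mul_zero] at h1
  refine squeeze_zero' ?_ ?_ h1
  · filter_upwards [eventually_ge_atTop 1] with n hn using (H.pos n hn).le
  · filter_upwards [eventually_ge_atTop 1] with n hn using hp n hn

theorem RegVarSeq.tendsto_ceil_pow (H : RegVarSeq h a) (p : ℕ) {s : ℝ}
    (hs : s ∈ Ioc (0 : ℝ) 1) :
    Tendsto (fun n : ℕ => (h ⌈s * n⌉₊ / h n) ^ p) atTop (𝓝 (s ^ (-(a * p)))) := by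
  have := (H.tendsto s hs.1 hs.2).pow p
  rwa [rpow_pow_eq hs.1.le, neg_mul] at this

theorem RegVarSeq.tendsto_ceil_inv_pow (H : RegVarSeq h a) (p : ℕ) {s : ℝ}
    (hs : s ∈ Ioc (0 : ℝ) 1) :
    Tendsto (fun n : ℕ => (h n / h ⌈s * n⌉₊) ^ p) atTop (𝓝 (s ^ (a * p))) := by
  have := (H.tendsto_ceil_pow p hs).inv₀ (Real.rpow_pos_of_pos hs.1 _).ne'
  rw [Real.rpow_neg hs.1.le, inv_inv] at this
  refine this.congr fun n => ?_
  rw [← inv_pow, inv_div]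

theorem RegVarSeq.tendsto_average_pow (H : RegVarSeq h a) (ha : 0 < a) {p : ℕ}
    (hp : a * p < 1) :
    Tendsto (fun n : ℕ => (n : ℝ)⁻¹ * ∑ i ∈ Finset.Icc 1 n, (h i / h n) ^ p) atTop
      (𝓝 (1 / (1 - a * p))) := by
  -- The strict inequality a p < 1 leaves room for Potter's ε: the dominating function s^{-(a+ε)p}
  -- is still integrable at 0.
  obtain ⟨ε, hε, hεp⟩ : ∃ ε > 0, (a + ε) * p < 1 := by
    refine ⟨(1 - a * p) / (2 * (p + 1)), by have := sub_pos.2 hp; positivity, ?_⟩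
    have h1 : (1 - a * p) / (2 * (p + 1)) * p ≤ (1 - a * p) / 2 := by
      rw [div_mul_eq_mul_div, div_le_div_iff₀ (by positivity) (by positivity)]
      nlinarith
    nlinarith
  obtain ⟨C, hC, hpot⟩ := H.potter ε hε
  have hr : -1 < -((a + ε) * p) := by linarith
  have key := tendsto_average_of_dominated (u := fun n i => (h i / h n) ^ p)
    (g := fun s => s ^ (-(a * p))) (B := fun s => C ^ p * s ^ (-((a + ε) * p)))
    ((integrableOn_Ioc_rpow hr).const_mul _) ?_ (fun s hs => H.tendsto_ceil_pow p hs)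
  · rwa [integral_Ioc_rpow (by linarith), neg_add_eq_sub] at key
  · filter_upwards [eventually_ge_atTop 1] with n hn s hs
    obtain ⟨h1, h2, h3⟩ := ceil_mul_mem hs hn
    have h4 : 0 < h ⌈s * n⌉₊ / h n := div_pos (H.pos _ h1) (H.pos _ hn)
    have hs0 := hs.1
    rw [abs_of_nonneg (by positivity)]
    calc _ ≤ (C * (s⁻¹) ^ (a + ε)) ^ p := by
          refine pow_le_pow_left₀ h4.le ((hpot _ _ h1 h2).1.trans ?_) _
          gcongr
      _ = _ := by
          rw [mul_pow, rpow_pow_eq (by positivity), Real.inv_rpow hs.1.le, Real.rpow_neg hs.1.le]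

theorem RegVarSeq.tendsto_sum_pow_div (H : RegVarSeq h a) (ha : 0 < a) {p : ℕ}
    (hp : a * p < 1) :
    Tendsto (fun n : ℕ => (∑ i ∈ Finset.Icc 1 n, h i ^ p) / (n * h n ^ p)) atTop
      (𝓝 (1 / (1 - a * p))) := by
  refine (H.tendsto_average_pow ha hp).congr fun n => ?_
  simp only [div_pow]
  rw [← Finset.sum_div]
  rw [mul_comm (n : ℝ), ← div_div, div_eq_inv_mul _ (n : ℝ)]

end RegVarSeq

/-! ### The normalisation of the exponential moments -/

/-- The speed of the deviation principle. -/
def speed {d : ℕ} (α : Fin d → ℕ) (h v : ℕ → ℝ) (n : ℕ) : ℝ := hsum α h n / v n ^ 2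

/-- The coefficient of the `i`-th summand in the exponential moment of order
`θ * speed α h v n`. -/
def coef {d : ℕ} (α : Fin d → ℕ) (h v : ℕ → ℝ) (θ : ℝ) (n i : ℕ) : ℝ :=
  θ * hsum α h n / (v n * n * h i ^ (d + mlen α))

/-- The weight of the `i`-th summand. -/
def weight {d : ℕ} (α : Fin d → ℕ) (h v : ℕ → ℝ) (θ : ℝ) (n i : ℕ) : ℝ :=
  (speed α h v n)⁻¹ * h i ^ d * coef α h v θ n i ^ 2

/-- Bandwidth and normalisation sequences for which the coefficients converge after
rescaling; `ℓ` is the limit of `h_n^{|α|} / v_n`. -/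
structure ScaleHyp {d : ℕ} (α : Fin d → ℕ) (a : ℝ) (h v : ℕ → ℝ) (ℓ : ℝ) : Prop where
  d_ne_zero : d ≠ 0
  reg : RegVarSeq h a
  a_pos : 0 < a
  lt_one : a * (d + 2 * mlen α : ℕ) < 1
  v_pos : ∀ n : ℕ, 1 ≤ n → 0 < v n
  lim : Tendsto (fun n => h n ^ mlen α / v n) atTop (𝓝 ℓ)

namespace ScaleHyp

variable {d : ℕ} {α : Fin d → ℕ} {a : ℝ} {h v : ℕ → ℝ} {ℓ : ℝ}

theorem hsum_pos (H : ScaleHyp α a h v ℓ) {n : ℕ} (hn : 1 ≤ n) : 0 < hsum α h n :=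
  Finset.sum_pos (fun i hi => pow_pos (H.reg.pos i (Finset.mem_Icc.1 hi).1) _)
    ⟨1, Finset.mem_Icc.2 ⟨le_rfl, hn⟩⟩

theorem speed_pos (H : ScaleHyp α a h v ℓ) {n : ℕ} (hn : 1 ≤ n) : 0 < speed α h v n :=
  div_pos (H.hsum_pos hn) (pow_pos (H.v_pos n hn) _)

theorem tendsto_hsum (H : ScaleHyp α a h v ℓ) :
    Tendsto (fun n : ℕ => hsum α h n / (n * h n ^ (d + 2 * mlen α))) atTop
      (𝓝 (1 / (1 - a * (d + 2 * mlen α : ℕ)))) :=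
  H.reg.tendsto_sum_pow_div H.a_pos H.lt_one

/-- Each factor has a limit along i = ⌈sn⌉; the scale v_n enters only through h_n^{|α|} / v_n, hence
through ℓ in the limit. -/
theorem coef_eq (H : ScaleHyp α a h v ℓ) (θ : ℝ) {n i : ℕ} (hi : 1 ≤ i) (hin : i ≤ n) :
    coef α h v θ n i = θ * (hsum α h n / (n * h n ^ (d + 2 * mlen α))) *
      (h n / h i) ^ (d + mlen α) * (h n ^ mlen α / v n) := by
  have h1 := (H.reg.pos i hi).ne'
  have h2 := (H.reg.pos n (hi.trans hin)).ne'
  have h3 := (H.v_pos n (hi.trans hin)).ne'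
  have h4 : (n : ℝ) ≠ 0 := by have := hi.trans hin; positivity
  rw [coef, show d + 2 * mlen α = (d + mlen α) + mlen α by ring, pow_add, div_pow]
  field_simp
  ring

/-- Here v_n cancels between the inverse speed and the squared coefficient, so the weights have size
1/n in every regime. -/
theorem weight_eq (H : ScaleHyp α a h v ℓ) (θ : ℝ) {n i : ℕ} (hi : 1 ≤ i) (hin : i ≤ n) :
    weight α h v θ n i = (n : ℝ)⁻¹ * (θ ^ 2 * (hsum α h n / (n * h n ^ (d + 2 * mlen α))) *
      (h n / h i) ^ (d + 2 * mlen α)) := by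
  have h1 := (H.reg.pos i hi).ne'
  have h2 := (H.reg.pos n (hi.trans hin)).ne'
  have h3 := (H.v_pos n (hi.trans hin)).ne'
  have h4 : (n : ℝ) ≠ 0 := by have := hi.trans hin; positivity
  have h5 := (H.hsum_pos (hi.trans hin)).ne'
  rw [weight, coef, speed, div_pow, div_pow]
  rw [show d + 2 * mlen α = d + mlen α + mlen α by ring]
  simp only [pow_add, mul_pow]
  field_simp

theorem exists_bound (H : ScaleHyp α a h v ℓ) (θ : ℝ) :
    ∃ B, 0 < B ∧ ∀ n i : ℕ, 1 ≤ i → i ≤ n →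
      |coef α h v θ n i| ≤ B ∧ weight α h v θ n i ≤ B / n := by
  obtain ⟨C, hC, hCb⟩ := H.reg.exists_div_le H.a_pos
  obtain ⟨A, hA⟩ := H.tendsto_hsum.bddAbove_range
  obtain ⟨D, hD⟩ := H.lim.bddAbove_range
  have hA' : ∀ n : ℕ, hsum α h n / (n * h n ^ (d + 2 * mlen α)) ≤ A := fun n => hA ⟨n, rfl⟩
  have hD' : ∀ n : ℕ, h n ^ mlen α / v n ≤ D := fun n => hD ⟨n, rfl⟩
  have pA : ∀ n : ℕ, 1 ≤ n → 0 < hsum α h n / (n * h n ^ (d + 2 * mlen α)) := fun n hn => by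
    have h1 := H.reg.pos n hn
    have h2 := H.hsum_pos hn
    positivity
  have pD : ∀ n : ℕ, 1 ≤ n → 0 < h n ^ mlen α / v n := fun n hn => by
    have h1 := H.reg.pos n hn
    have h2 := H.v_pos n hn
    positivity
  have hA0 : 0 < A := (pA 1 le_rfl).trans_le (hA' 1)
  have hD0 : 0 < D := (pD 1 le_rfl).trans_le (hD' 1)
  refine ⟨max (|θ| * A * C ^ (d + mlen α) * D) (θ ^ 2 * A * C ^ (d + 2 * mlen α)) + 1,
    by positivity, fun n i hi hin => ⟨?_, ?_⟩⟩
  · have hn := hi.trans hin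
    have h1 := H.reg.pos n hn
    have h2 := H.reg.pos i hi
    have h3 : 0 < (h n / h i) ^ (d + mlen α) := by positivity
    rw [H.coef_eq θ hi hin, abs_mul, abs_mul, abs_mul, abs_of_pos (pA n hn),
      abs_of_pos (pD n hn), abs_of_pos h3]
    refine le_trans ?_ ((le_max_left _ _).trans (le_add_of_nonneg_right zero_le_one))
    have := pA n hn
    have := pD n hn
    gcongr
    · exact hA' n
    · exact hCb i n hi hin
    · exact hD' n
  · have hn := hi.trans hin
    have h1 := H.reg.pos n hn
    have h2 := H.reg.pos i hi
    rw [H.weight_eq θ hi hin, div_eq_inv_mul _ (n : ℝ)]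
    refine mul_le_mul_of_nonneg_left ?_ (inv_nonneg.2 n.cast_nonneg)
    refine le_trans ?_ ((le_max_right _ _).trans (le_add_of_nonneg_right zero_le_one))
    have := pA n hn
    gcongr
    · exact hA' n
    · exact hCb i n hi hin

theorem weight_nonneg (H : ScaleHyp α a h v ℓ) (θ : ℝ) {n i : ℕ} (hi : 1 ≤ i) (hin : i ≤ n) :
    0 ≤ weight α h v θ n i := by
  have h1 := H.reg.pos i hi
  have h2 := H.speed_pos (hi.trans hin)
  unfold weight
  positivity

/-- The limit of the weighted sums of `χ (coef)`. -/
def limitFun {d : ℕ} (α : Fin d → ℕ) (a ℓ : ℝ) (χ : ℝ → ℝ) (θ : ℝ) : ℝ :=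
  ∫ s in Ioc (0 : ℝ) 1, θ ^ 2 / (1 - a * (d + 2 * mlen α : ℕ)) * s ^ (a * (d + 2 * mlen α : ℕ)) *
    χ (θ * ℓ / (1 - a * (d + 2 * mlen α : ℕ)) * s ^ (a * (d + mlen α : ℕ)))

theorem tendsto_sum_weight (H : ScaleHyp α a h v ℓ) (θ : ℝ) {χ : ℝ → ℝ} (hχ : Continuous χ) :
    Tendsto (fun n => ∑ i ∈ Finset.Icc 1 n, weight α h v θ n i * χ (coef α h v θ n i)) atTop
      (𝓝 (limitFun α a ℓ χ θ)) := by
  obtain ⟨B, hB, hb⟩ := H.exists_bound θ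
  obtain ⟨D, hD⟩ := (isCompact_Icc (a := -B) (b := B)).exists_bound_of_continuousOn
    hχ.continuousOn
  have key := tendsto_average_of_dominated
    (u := fun n i => n * weight α h v θ n i * χ (coef α h v θ n i))
    (g := fun s => θ ^ 2 / (1 - a * (d + 2 * mlen α : ℕ)) * s ^ (a * (d + 2 * mlen α : ℕ)) *
      χ (θ * ℓ / (1 - a * (d + 2 * mlen α : ℕ)) * s ^ (a * (d + mlen α : ℕ))))
    (B := fun _ => B * D) (continuous_const.integrableOn_Ioc) ?_ ?_
  · refine key.congr' ?_
    filter_upwards [eventually_ge_atTop 1] with n hn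
    have hn0 : (n : ℝ) ≠ 0 := by positivity
    rw [Finset.mul_sum]
    refine Finset.sum_congr rfl fun i _ => ?_
    field_simp
  · filter_upwards [eventually_ge_atTop 1] with n hn s hs
    obtain ⟨h1, h2, h3⟩ := ceil_mul_mem hs hn
    obtain ⟨b1, b2⟩ := hb n _ h1 h2
    have hn0 : (0 : ℝ) < n := by positivity
    have hw := H.weight_nonneg θ h1 h2
    rw [abs_mul, abs_of_nonneg (by positivity)]
    have b3 := hD _ (abs_le.1 b1)
    rw [Real.norm_eq_abs] at b3
    have b4 : n * weight α h v θ n ⌈s * n⌉₊ ≤ B := by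
      rw [le_div_iff₀ hn0] at b2; linarith
    exact mul_le_mul b4 b3 (abs_nonneg _) hB.le
  · intro s hs
    have e1 : Tendsto (fun n : ℕ => n * weight α h v θ n ⌈s * n⌉₊) atTop
        (𝓝 (θ ^ 2 / (1 - a * (d + 2 * mlen α : ℕ)) * s ^ (a * (d + 2 * mlen α : ℕ)))) := by
      have := (H.tendsto_hsum.const_mul (θ ^ 2)).mul
        (H.reg.tendsto_ceil_inv_pow (d + 2 * mlen α) hs)
      rw [mul_one_div] at this
      refine this.congr' ?_
      filter_upwards [eventually_ge_atTop 1] with n hn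
      obtain ⟨h1, h2, h3⟩ := ceil_mul_mem hs hn
      rw [H.weight_eq θ h1 h2, mul_inv_cancel_left₀ (by positivity)]
    have e2 : Tendsto (fun n : ℕ => coef α h v θ n ⌈s * n⌉₊) atTop
        (𝓝 (θ * ℓ / (1 - a * (d + 2 * mlen α : ℕ)) * s ^ (a * (d + mlen α : ℕ)))) := by
      have := ((H.tendsto_hsum.const_mul θ).mul
        (H.reg.tendsto_ceil_inv_pow (d + mlen α) hs)).mul H.lim
      have e : θ * (1 / (1 - a * (d + 2 * mlen α : ℕ))) * s ^ (a * (d + mlen α : ℕ)) * ℓ =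
        θ * ℓ / (1 - a * (d + 2 * mlen α : ℕ)) * s ^ (a * (d + mlen α : ℕ)) := by ring
      rw [e] at this
      refine this.congr' ?_
      filter_upwards [eventually_ge_atTop 1] with n hn
      obtain ⟨h1, h2, h3⟩ := ceil_mul_mem hs hn
      rw [H.coef_eq θ h1 h2]
    exact e1.mul ((hχ.tendsto _).comp e2)

end ScaleHyp

end RecKernel

end

noncomputable section

namespace RecKernel

/-! ### A lower deviation bound from the convergence of the scaled cumulants -/

/-- Lower half of the Gärtner-Ellis theorem at one tilt θ. The mass of e^{sθS} outside [y - ε, y +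
ε] is compared with the exponential moments at θ + τ and θ - τ; differentiability at θ makes both
exponentially smaller than the moment at θ. So the window carries at least half of that moment, and
there e^{sθS} ≤ e^{sθ(y+ε)} because θ ≥ 0. -/
theorem eventually_exp_le_measureReal {Ω : Type*} {mΩ : MeasurableSpace Ω} {μ : Measure Ω}
    [IsProbabilityMeasure μ] {S : ℕ → Ω → ℝ} {s : ℕ → ℝ} (hs : Tendsto s atTop atTop)
    (hm : ∀ᶠ n in atTop, Measurable (S n))
    (hint : ∀ᶠ n in atTop, ∀ t, Integrable (fun ω => Real.exp (t * S n ω)) μ) {Λ : ℝ → ℝ}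
    (hΛ : ∀ θ, Tendsto (fun n => (s n)⁻¹ * cgf (S n) μ (s n * θ)) atTop (𝓝 (Λ θ)))
    {θ y : ℝ} (hθ : 0 ≤ θ) (hy : HasDerivAt Λ y θ) {ε : ℝ} (hε : 0 < ε) :
    ∀ᶠ n in atTop, Real.exp (-(s n * (θ * (y + ε) - Λ θ + ε))) ≤
      μ.real {ω | y - ε ≤ S n ω} := by
  -- For small τ the two difference quotients are within ε/2 of y; the other ε/2 of the window
  -- becomes the gain k = τ ε / 2 in the exponent.
  obtain ⟨τ, hτ, hτ1, hτ2⟩ : ∃ τ > 0, Λ (θ + τ) - Λ θ ≤ τ * (y + ε / 2) ∧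
      Λ (θ - τ) - Λ θ ≤ -(τ * (y - ε / 2)) := by
    have h1 := (hasDerivAt_iff_isLittleO_nhds_zero.1 hy).bound (half_pos hε)
    obtain ⟨r, hr, hb⟩ := Metric.eventually_nhds_iff.1 h1
    have p1 := hb (y := r / 2) (by rw [Real.dist_eq, sub_zero, abs_of_pos (by positivity)]; linarith)
    have p2 := hb (y := -(r / 2)) (by
      rw [Real.dist_eq, sub_zero, abs_neg, abs_of_pos (by positivity)]; linarith)
    have p1' := abs_le.1 p1
    have p2' := abs_le.1 p2
    simp only [smul_eq_mul, Real.norm_eq_abs, abs_neg, abs_of_pos (half_pos hr)] at p1' p2'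
    refine ⟨r / 2, half_pos hr, by linarith [p1'.2], ?_⟩
    rw [sub_eq_add_neg θ]
    linarith [p2'.2]
  set k := τ * ε / 2 with hk
  have hk0 : 0 < k := by positivity
  -- The bound k/4 keeps each tail below a quarter of the total: the exponent -k + e stays below -e
  -- by k/2, which absorbs a factor 4. The bound ε/2 leaves another ε/2 to absorb the final factor
  -- 2.
  set e := min (k / 4) (ε / 2)
  have he : 0 < e := by positivity
  have hek : e ≤ k / 4 := min_le_left _ _
  have heε : e ≤ ε / 2 := min_le_right _ _
  have hconv : ∀ t, ∀ᶠ n in atTop, |(s n)⁻¹ * cgf (S n) μ (s n * t) - Λ t| < e := fun t =>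
    (Metric.tendsto_nhds.1 (hΛ t) e he)
  filter_upwards [hm, hint, hconv θ, hconv (θ + τ), hconv (θ - τ),
    hs.eventually_gt_atTop 0, hs.eventually_ge_atTop (2 / k * Real.log 4),
    hs.eventually_ge_atTop (2 / ε * Real.log 2)] with n hm hint c0 c1 c2 hs0 hs1 hs2
  have hs1' : Real.log 4 ≤ s n * (k / 2) := by
    have := mul_le_mul_of_nonneg_right hs1 (half_pos hk0).le
    calc Real.log 4 = 2 / k * Real.log 4 * (k / 2) := by field_simp
      _ ≤ _ := this
  have hs2' : Real.log 2 ≤ s n * (ε / 2) := by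
    have := mul_le_mul_of_nonneg_right hs2 (half_pos hε).le
    calc Real.log 2 = 2 / ε * Real.log 2 * (ε / 2) := by field_simp
      _ ≤ _ := this
  have hup : ∀ t, |(s n)⁻¹ * cgf (S n) μ (s n * t) - Λ t| < e →
      mgf (S n) μ (s n * t) ≤ Real.exp (s n * (Λ t + e)) ∧
      Real.exp (s n * (Λ t - e)) ≤ mgf (S n) μ (s n * t) := by
    intro t ht
    rw [← exp_cgf (hint _), Real.exp_le_exp, Real.exp_le_exp]
    have h1 := abs_lt.1 ht
    have h2 : cgf (S n) μ (s n * t) = s n * ((s n)⁻¹ * cgf (S n) μ (s n * t)) := by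
      rw [mul_inv_cancel_left₀ hs0.ne']
    rw [h2]
    constructor <;> apply mul_le_mul_of_nonneg_left _ hs0.le <;> linarith
  set A := {ω | y - ε ≤ S n ω}
  have hA : MeasurableSet A := measurableSet_le measurable_const hm
  -- Pointwise splitting according to whether S lies in the window, above it or below it; an
  -- exponential Chebyshev factor replaces the indicator of each tail.
  have hptw : ∀ ω, Real.exp (s n * θ * S n ω) ≤
      A.indicator (fun _ => Real.exp (s n * (θ * (y + ε)))) ω +
      Real.exp (-(s n * (τ * (y + ε)))) * Real.exp (s n * (θ + τ) * S n ω) +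
      Real.exp (s n * (τ * (y - ε))) * Real.exp (s n * (θ - τ) * S n ω) := by
    intro ω
    rw [← Real.exp_add, ← Real.exp_add]
    have i1 : 0 ≤ A.indicator (fun _ => Real.exp (s n * (θ * (y + ε)))) ω :=
      indicator_nonneg (fun _ _ => (Real.exp_pos _).le) _
    have i2 := Real.exp_pos (-(s n * (τ * (y + ε))) + s n * (θ + τ) * S n ω)
    have i3 := Real.exp_pos (s n * (τ * (y - ε)) + s n * (θ - τ) * S n ω)
    by_cases hω : ω ∈ A
    · by_cases hω2 : S n ω ≤ y + ε
      · rw [indicator_of_mem hω]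
        have : Real.exp (s n * θ * S n ω) ≤ Real.exp (s n * (θ * (y + ε))) := by
          rw [Real.exp_le_exp, mul_assoc]
          gcongr
        linarith
      · push Not at hω2
        have : Real.exp (s n * θ * S n ω) ≤
            Real.exp (-(s n * (τ * (y + ε))) + s n * (θ + τ) * S n ω) := by
          rw [Real.exp_le_exp]
          have : 0 ≤ s n * τ * (S n ω - (y + ε)) :=
            mul_nonneg (by positivity) (by linarith)
          nlinarith
        linarith
    · have hω2 : S n ω < y - ε := not_le.1 hω
      have : Real.exp (s n * θ * S n ω) ≤
          Real.exp (s n * (τ * (y - ε)) + s n * (θ - τ) * S n ω) := by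
        rw [Real.exp_le_exp]
        have : 0 ≤ s n * τ * ((y - ε) - S n ω) := mul_nonneg (by positivity) (by linarith)
        nlinarith
      linarith
  have hI1 : Integrable (A.indicator fun _ => Real.exp (s n * (θ * (y + ε)))) μ :=
    (integrable_const _).indicator hA
  have hI2 : Integrable (fun ω => A.indicator (fun _ => Real.exp (s n * (θ * (y + ε)))) ω +
      Real.exp (-(s n * (τ * (y + ε)))) * Real.exp (s n * (θ + τ) * S n ω)) μ :=
    hI1.add ((hint _).const_mul _)
  have hint2 := integral_mono (hint (s n * θ)) (hI2.add ((hint _).const_mul _)) hptw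
  simp only [Pi.add_apply] at hint2
  rw [integral_add hI2 ((hint _).const_mul _),
    integral_add hI1 ((hint _).const_mul _), integral_const_mul, integral_const_mul,
    integral_indicator_const _ hA, smul_eq_mul] at hint2
  have u0 := (hup θ c0).2
  have u1 := (hup _ c1).1
  have u2 := (hup _ c2).1
  simp only [mgf] at u0 u1 u2
  have b1 : Real.exp (-(s n * (τ * (y + ε)))) * ∫ ω, Real.exp (s n * (θ + τ) * S n ω) ∂μ ≤
      Real.exp (s n * (Λ θ - k + e)) := by
    refine (mul_le_mul_of_nonneg_left u1 (Real.exp_pos _).le).trans ?_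
    rw [← Real.exp_add, Real.exp_le_exp, ← mul_neg, ← mul_add]
    apply mul_le_mul_of_nonneg_left _ hs0.le
    rw [hk]; linarith
  have b2 : Real.exp (s n * (τ * (y - ε))) * ∫ ω, Real.exp (s n * (θ - τ) * S n ω) ∂μ ≤
      Real.exp (s n * (Λ θ - k + e)) := by
    refine (mul_le_mul_of_nonneg_left u2 (Real.exp_pos _).le).trans ?_
    rw [← Real.exp_add, Real.exp_le_exp, ← mul_add]
    apply mul_le_mul_of_nonneg_left _ hs0.le
    rw [hk]; linarith
  have b3 : 4 * Real.exp (s n * (Λ θ - k + e)) ≤ Real.exp (s n * (Λ θ - e)) := by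
    have : (4 : ℝ) ≤ Real.exp (s n * (k / 2)) := by
      rwa [← Real.log_le_iff_le_exp (by norm_num)]
    calc _ ≤ Real.exp (s n * (k / 2)) * Real.exp (s n * (Λ θ - k + e)) := by gcongr
      _ ≤ _ := by
        rw [← Real.exp_add, Real.exp_le_exp, ← mul_add]
        apply mul_le_mul_of_nonneg_left _ hs0.le
        linarith
  have b4 : Real.exp (s n * (Λ θ - e)) ≤ 2 * (μ.real A * Real.exp (s n * (θ * (y + ε)))) := by
    linarith
  have b5 : (2 : ℝ) ≤ Real.exp (s n * (ε / 2)) := by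
    rwa [← Real.log_le_iff_le_exp (by norm_num)]
  have b6 : Real.exp (-(s n * (θ * (y + ε) - Λ θ + ε))) * Real.exp (s n * (ε / 2)) *
      Real.exp (s n * (θ * (y + ε))) ≤ Real.exp (s n * (Λ θ - e)) := by
    rw [← Real.exp_add, ← Real.exp_add, Real.exp_le_exp, ← mul_neg, ← mul_add, ← mul_add]
    apply mul_le_mul_of_nonneg_left _ hs0.le
    linarith
  have p1 := Real.exp_pos (-(s n * (θ * (y + ε) - Λ θ + ε)))
  have p2 := Real.exp_pos (s n * (θ * (y + ε)))
  have b7 : 2 * (Real.exp (-(s n * (θ * (y + ε) - Λ θ + ε))) * Real.exp (s n * (θ * (y + ε)))) ≤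
      Real.exp (-(s n * (θ * (y + ε) - Λ θ + ε))) * Real.exp (s n * (ε / 2)) *
      Real.exp (s n * (θ * (y + ε))) := by
    have := mul_le_mul_of_nonneg_right b5 (mul_pos p1 p2).le
    linarith
  have b8 : Real.exp (-(s n * (θ * (y + ε) - Λ θ + ε))) * Real.exp (s n * (θ * (y + ε))) ≤
      μ.real A * Real.exp (s n * (θ * (y + ε))) := by linarith
  exact le_of_mul_le_mul_right b8 p2

end RecKernel

end

noncomputable section

namespace RecKernel

/-! ### The second order remainder of the exponential -/

/-- `(e^y - 1 - y) / y²`, continuously extended to `0`. -/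
def expRem (y : ℝ) : ℝ := if y = 0 then 1 / 2 else (Real.exp y - 1 - y) / y ^ 2

theorem sq_mul_expRem (y : ℝ) : y ^ 2 * expRem y = Real.exp y - 1 - y := by
  by_cases hy : y = 0
  · simp [hy]
  · rw [expRem, if_neg hy]
    field_simp

theorem expRem_nonneg (y : ℝ) : 0 ≤ expRem y := by
  unfold expRem
  split_ifs
  · norm_num
  · exact div_nonneg (by linarith [Real.add_one_le_exp y]) (sq_nonneg _)

theorem continuous_expRem : Continuous expRem := by
  rw [continuous_iff_continuousAt]
  intro y
  by_cases hy : y = 0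
  · subst hy
    rw [Metric.continuousAt_iff]
    intro ε hε
    refine ⟨min 1 ε, by positivity, fun y hy => ?_⟩
    rw [Real.dist_eq, sub_zero] at hy
    have h1 : |y| ≤ 1 := hy.le.trans (min_le_left _ _)
    have h2 : |y| < ε := hy.trans_le (min_le_right _ _)
    rw [Real.dist_eq]
    by_cases h0 : y = 0
    · simp [h0, hε]
    · have hb := Real.exp_bound h1 (n := 3) (by norm_num)
      simp only [Finset.sum_range_succ, Finset.sum_range_zero] at hb
      norm_num [Nat.factorial] at hb
      rw [expRem, expRem, if_neg h0, if_pos rfl]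
      have e : (Real.exp y - 1 - y) / y ^ 2 - 1 / 2 =
          (Real.exp y - (1 + y + y ^ 2 / 2)) / y ^ 2 := by
        field_simp; ring
      have hy2 : 0 < y ^ 2 := by positivity
      rw [e, abs_div, abs_of_pos hy2, div_lt_iff₀ hy2]
      refine hb.trans_lt ?_
      have h3 : |y| ^ 3 = |y| * y ^ 2 := by rw [← sq_abs y]; ring
      rw [h3]
      have : 0 < |y| * y ^ 2 := by positivity
      nlinarith
  · have : expRem =ᶠ[𝓝 y] fun y => (Real.exp y - 1 - y) / y ^ 2 := by
      filter_upwards [isOpen_ne.mem_nhds hy] with z hz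
      rw [expRem, if_neg hz]
    refine ContinuousAt.congr ?_ this.symm
    exact ContinuousAt.div (by fun_prop) (by fun_prop) (by positivity)

theorem exists_expRem_le (R : ℝ) : ∃ D : ℝ, 0 ≤ D ∧ ∀ y, |y| ≤ R → expRem y ≤ D := by
  obtain ⟨D, hD⟩ := (isCompact_Icc (a := -R) (b := R)).exists_bound_of_continuousOn
    continuous_expRem.continuousOn
  refine ⟨max D 0, le_max_right _ _, fun y hy => ?_⟩
  have := hD y (abs_le.1 hy)
  exact (le_abs_self _).trans (this.trans (le_max_left _ _))

section Cumulant

variable {Ω : Type*} {mΩ : MeasurableSpace Ω} {μ : Measure Ω} [IsProbabilityMeasure μ]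
  {Z : Ω → ℝ} {R : ℝ}

theorem integrable_comp_of_abs_le (hZ : Measurable Z) (hR : ∀ ω, |Z ω| ≤ R) {G : ℝ → ℝ}
    (hG : Continuous G) : Integrable (fun ω => G (Z ω)) μ := by
  obtain ⟨D, hD⟩ := (isCompact_Icc (a := -R) (b := R)).exists_bound_of_continuousOn hG.continuousOn
  exact Integrable.of_bound (hG.measurable.comp hZ).aestronglyMeasurable D
    (ae_of_all _ fun ω => hD _ (abs_le.1 (hR ω)))

theorem mgf_eq_one_add (hZ : Measurable Z) (hR : ∀ ω, |Z ω| ≤ R) (c : ℝ) :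
    mgf Z μ c = 1 + (c * ∫ ω, Z ω ∂μ + ∫ ω, (c * Z ω) ^ 2 * expRem (c * Z ω) ∂μ) := by
  have i1 : Integrable (fun ω => c * Z ω) μ :=
    integrable_comp_of_abs_le hZ hR (G := fun y => c * y) (by fun_prop)
  have i2 : Integrable (fun ω => (c * Z ω) ^ 2 * expRem (c * Z ω)) μ :=
    integrable_comp_of_abs_le hZ hR (G := fun y => (c * y) ^ 2 * expRem (c * y))
      (by have := continuous_expRem; fun_prop)
  have : ∀ ω, Real.exp (c * Z ω) = 1 + (c * Z ω + (c * Z ω) ^ 2 * expRem (c * Z ω)) := by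
    intro ω; rw [sq_mul_expRem]; ring
  rw [mgf]
  simp_rw [this]
  rw [integral_add (integrable_const _) (by exact i1.add i2), integral_add i1 i2,
    integral_const_mul]
  simp

/-- Jensen's inequality, obtained by integrating the tangent line of the exponential at the mean. -/
theorem mul_integral_le_cgf (hZ : Measurable Z) (hR : ∀ ω, |Z ω| ≤ R) (c : ℝ) :
    c * ∫ ω, Z ω ∂μ ≤ cgf Z μ c := by
  have i0 : Integrable (fun ω => Real.exp (c * Z ω)) μ :=
    integrable_comp_of_abs_le hZ hR (G := fun y => Real.exp (c * y)) (by fun_prop)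
  have i1 : Integrable (fun ω => c * Z ω) μ :=
    integrable_comp_of_abs_le hZ hR (G := fun y => c * y) (by fun_prop)
  set m := ∫ ω, Z ω ∂μ
  have h1 : ∀ ω, Real.exp (c * m) * (1 + (c * Z ω - c * m)) ≤ Real.exp (c * Z ω) := by
    intro ω
    have : Real.exp (c * Z ω) = Real.exp (c * m) * Real.exp (c * Z ω - c * m) := by
      rw [← Real.exp_add]; ring_nf
    rw [this]
    have := Real.add_one_le_exp (c * Z ω - c * m)
    exact mul_le_mul_of_nonneg_left (by linarith) (Real.exp_pos _).le
  have i2 : Integrable (fun ω => c * Z ω - c * m) μ := i1.sub (integrable_const _)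
  have h2 := integral_mono (((integrable_const 1).add i2).const_mul _) i0 h1
  simp only [Pi.add_apply] at h2
  rw [integral_const_mul, integral_add (integrable_const _) i2,
    integral_sub i1 (integrable_const _), integral_const_mul] at h2
  simp only [integral_const, probReal_univ, smul_eq_mul, one_mul] at h2
  rw [cgf, Real.le_log_iff_exp_le (mgf_pos i0)]
  have h3 : Real.exp (c * m) * (1 + (c * m - c * m)) = Real.exp (c * m) := by ring
  rw [h3] at h2
  exact h2

theorem cgf_sub_le (hZ : Measurable Z) (hR : ∀ ω, |Z ω| ≤ R) (c : ℝ) :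
    cgf Z μ c - c * ∫ ω, Z ω ∂μ ≤ ∫ ω, (c * Z ω) ^ 2 * expRem (c * Z ω) ∂μ := by
  have i0 : Integrable (fun ω => Real.exp (c * Z ω)) μ :=
    integrable_comp_of_abs_le hZ hR (G := fun y => Real.exp (c * y)) (by fun_prop)
  have h1 := Real.log_le_sub_one_of_pos (mgf_pos i0)
  rw [mgf_eq_one_add hZ hR] at h1
  rw [cgf, mgf_eq_one_add hZ hR]
  linarith

/-- With mgf = 1 + x, this is log(1 + x) ≥ x - 2x² for |x| ≤ 1/2. -/
theorem le_cgf_sub (hZ : Measurable Z) (hR : ∀ ω, |Z ω| ≤ R) (c : ℝ)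
    (hle : |c * ∫ ω, Z ω ∂μ + ∫ ω, (c * Z ω) ^ 2 * expRem (c * Z ω) ∂μ| ≤ 1 / 2) :
    ∫ ω, (c * Z ω) ^ 2 * expRem (c * Z ω) ∂μ -
      2 * (c * ∫ ω, Z ω ∂μ + ∫ ω, (c * Z ω) ^ 2 * expRem (c * Z ω) ∂μ) ^ 2 ≤
      cgf Z μ c - c * ∫ ω, Z ω ∂μ := by
  rw [cgf, mgf_eq_one_add hZ hR]
  set x := c * ∫ ω, Z ω ∂μ + ∫ ω, (c * Z ω) ^ 2 * expRem (c * Z ω) ∂μ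
  have hx := abs_le.1 hle
  have hx0 : 0 < 1 + x := by linarith
  have h1 := Real.one_sub_inv_le_log_of_pos hx0
  have h2 : x - 2 * x ^ 2 ≤ 1 - (1 + x)⁻¹ := by
    have : 1 - (1 + x)⁻¹ = x / (1 + x) := by field_simp; ring
    rw [this, le_div_iff₀ hx0]
    nlinarith [sq_nonneg x, mul_nonneg (sq_nonneg x) (by linarith : 0 ≤ 1 / 2 + x)]
  linarith

end Cumulant

/-! ### Expectations of rescaled kernels -/

section Density

variable {d : ℕ} {Ω : Type*} [MeasurableSpace Ω] {μ : Measure Ω} {X : ℕ → Ω → E d}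
  {f : E d → ℝ}

theorem IIDWithDensity.integral_comp (hX : IIDWithDensity μ X f) {i : ℕ} (hi : 1 ≤ i)
    {F : E d → ℝ} (hF : Measurable F) : ∫ ω, F (X i ω) ∂μ = ∫ y, f y * F y := by
  rw [← integral_map (hX.measurable_X i hi).aemeasurable hF.aestronglyMeasurable, hX.law i hi,
    integral_withDensity_eq_integral_toReal_smul hX.measurable_f.ennreal_ofReal (by simp)]
  refine integral_congr_ae (ae_of_all _ fun y => ?_)
  simp [ENNReal.toReal_ofReal (hX.nonneg y)]

theorem integral_comp_sub_smul (F : E d → ℝ) (x : E d) {h : ℝ} (hh : 0 < h) :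
    ∫ y, F y = h ^ d * ∫ z, F (x - h • z) := by
  have h1 := Measure.integral_comp_smul (volume : Measure (E d)) (fun z => F (x - z)) h
  rw [integral_sub_left_eq_self F volume x, finrank_euclideanSpace, Fintype.card_fin,
    abs_of_pos (by positivity), smul_eq_mul] at h1
  rw [h1, mul_inv_cancel_left₀ (by positivity)]

theorem IIDWithDensity.integral_comp_scaled (hX : IIDWithDensity μ X f) {i : ℕ} (hi : 1 ≤ i)
    {G : E d → ℝ} (hG : Measurable G) (x : E d) {h : ℝ} (hh : 0 < h) :
    ∫ ω, G (h⁻¹ • (x - X i ω)) ∂μ = h ^ d * ∫ z, G z * f (x - h • z) := by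
  rw [hX.integral_comp hi (F := fun y => G (h⁻¹ • (x - y))) (by fun_prop),
    integral_comp_sub_smul _ x hh]
  congr 1
  refine integral_congr_ae (ae_of_all _ fun z => ?_)
  simp only [sub_sub_cancel, smul_smul, inv_mul_cancel₀ hh.ne', one_smul]
  ring

theorem IIDWithDensity.integrable (hX : IIDWithDensity μ X f) [IsProbabilityMeasure μ] :
    Integrable f := by
  refine ⟨hX.measurable_f.aestronglyMeasurable, ?_⟩
  rw [hasFiniteIntegral_iff_ofReal (ae_of_all _ hX.nonneg)]
  have h1 : (μ.map (X 1)) univ = 1 := by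
    rw [Measure.map_apply (hX.measurable_X 1 le_rfl) MeasurableSet.univ]
    simp
  rw [hX.law 1 le_rfl, withDensity_apply _ MeasurableSet.univ, Measure.restrict_univ] at h1
  rw [h1]
  exact ENNReal.one_lt_top

end Density

end RecKernel

end

/-! ### Cumulants of rescaled kernels under the law of one observation -/

noncomputable section

namespace RecKernel

/-- The second order remainder of the cumulant of a kernel `κ` under the Lebesgue measure,
divided by the square of the argument. -/
def kernelRem {d : ℕ} (κ : E d → ℝ) (c : ℝ) : ℝ := ∫ z, κ z ^ 2 * expRem (c * κ z)

/-- Continuous, bounded and integrable functions. -/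
structure NiceKernel {d : ℕ} (κ : E d → ℝ) (R : ℝ) : Prop where
  continuous : Continuous κ
  abs_le : ∀ z, |κ z| ≤ R
  integrable : Integrable κ

namespace NiceKernel

variable {d : ℕ} {κ : E d → ℝ} {R : ℝ}

theorem nonneg (hκ : NiceKernel κ R) : 0 ≤ R := (abs_nonneg _).trans (hκ.abs_le 0)

theorem integrable_sq (hκ : NiceKernel κ R) : Integrable fun z => κ z ^ 2 := by
  have := hκ.integrable.bdd_mul (c := R) hκ.continuous.aestronglyMeasurable
    (ae_of_all _ fun z => by simpa using hκ.abs_le z)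
  simpa only [sq] using this

theorem integrable_sq_mul (hκ : NiceKernel κ R) {G : E d → ℝ} (hG : Measurable G) {D : ℝ}
    (hD : ∀ z, |G z| ≤ D) : Integrable fun z => κ z ^ 2 * G z := by
  have := hκ.integrable_sq.bdd_mul (c := D) hG.aestronglyMeasurable
    (ae_of_all _ fun z => by simpa using hD z)
  simpa only [mul_comm] using this

theorem abs_mul_le (hκ : NiceKernel κ R) {c B : ℝ} (hc : |c| ≤ B) (z : E d) :
    |c * κ z| ≤ B * R := by
  rw [abs_mul]
  exact mul_le_mul hc (hκ.abs_le z) (abs_nonneg _) ((abs_nonneg _).trans hc)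

theorem measurable_expRem (hκ : NiceKernel κ R) (c : ℝ) :
    Measurable fun z => expRem (c * κ z) :=
  (continuous_expRem.comp (continuous_const.mul hκ.continuous)).measurable

theorem continuous_kernelRem (hκ : NiceKernel κ R) : Continuous (kernelRem κ) := by
  rw [continuous_iff_continuousAt]
  intro c
  obtain ⟨D, hD, hDb⟩ := exists_expRem_le ((|c| + 1) * R)
  refine continuousAt_of_dominated (bound := fun z => κ z ^ 2 * D) ?_ ?_
    (hκ.integrable_sq.mul_const D) ?_
  · exact Eventually.of_forall fun c =>
      ((hκ.continuous.pow 2).measurable.mul (hκ.measurable_expRem c)).aestronglyMeasurable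
  · have : ∀ᶠ c' in 𝓝 c, |c'| ≤ |c| + 1 :=
      (continuous_abs.tendsto c).eventually_le_const (by linarith)
    filter_upwards [this] with c' hc'
    refine ae_of_all _ fun z => ?_
    rw [Real.norm_eq_abs, abs_of_nonneg (mul_nonneg (sq_nonneg _) (expRem_nonneg _))]
    exact mul_le_mul_of_nonneg_left (hDb _ (hκ.abs_mul_le hc' z)) (sq_nonneg _)
  · exact ae_of_all _ fun z =>
      (continuous_const.mul (continuous_expRem.comp (continuous_id.mul continuous_const))).continuousAt

theorem kernelRem_nonneg (κ : E d → ℝ) (c : ℝ) : 0 ≤ kernelRem κ c :=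
  integral_nonneg fun _ => mul_nonneg (sq_nonneg _) (expRem_nonneg _)

/-- Uniform continuity of `f` makes `f (x - h z)` close to `f x` in the mean, uniformly in
`x`. -/
theorem exists_tendsto_zero (hκ : NiceKernel κ R) {f : E d → ℝ} (hf : UniformContinuous f)
    {M : ℝ} (hM : ∀ x, |f x| ≤ M) {h : ℕ → ℝ} (hpos : ∀ i, 1 ≤ i → 0 < h i)
    (hh : Tendsto h atTop (𝓝 0)) :
    ∃ e : ℕ → ℝ, Tendsto e atTop (𝓝 0) ∧
      ∀ i x, ∫ z, κ z ^ 2 * |f (x - h i • z) - f x| ≤ e i := by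
  have hM0 : 0 ≤ M := (abs_nonneg _).trans (hM 0)
  have hdiff : ∀ x y, |f x - f y| ≤ 2 * M := fun x y => by
    have := abs_sub (f x) (f y)
    linarith [hM x, hM y]
  have hint : ∀ i x, Integrable fun z => κ z ^ 2 * |f (x - h i • z) - f x| := fun i x => by
    have hfc := hf.continuous
    refine hκ.integrable_sq_mul (D := 2 * M) (by fun_prop) fun z => ?_
    rw [abs_abs]; exact hdiff _ _
  have hle : ∀ i x, ∫ z, κ z ^ 2 * |f (x - h i • z) - f x| ≤ ∫ z, κ z ^ 2 * (2 * M) :=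
    fun i x => integral_mono (hint i x) (hκ.integrable_sq.mul_const _) fun z =>
      mul_le_mul_of_nonneg_left (hdiff _ _) (sq_nonneg _)
  refine ⟨fun i => ⨆ x, ∫ z, κ z ^ 2 * |f (x - h i • z) - f x|, ?_, fun i x =>
    le_ciSup ⟨_, forall_mem_range.2 (hle i)⟩ x⟩
  rw [Metric.tendsto_atTop']
  intro ε hε
  set I := ∫ z, κ z ^ 2
  have hI : 0 ≤ I := integral_nonneg fun _ => sq_nonneg _
  obtain ⟨r, hr, hfr⟩ := Metric.uniformContinuous_iff.1 hf (ε / (4 * (I + 1))) (by positivity)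
  -- Where h_i ‖z‖ ≥ r uniform continuity says nothing and only the bound 2M is available; that
  -- region recedes to infinity as h_i → 0, so its contribution vanishes by dominated convergence.
  have htail : Tendsto (fun i => ∫ z, κ z ^ 2 * (if h i * ‖z‖ < r then 0 else 2 * M)) atTop
      (𝓝 0) := by
    have := tendsto_integral_filter_of_dominated_convergence (μ := volume) (l := atTop)
      (F := fun (i : ℕ) z => κ z ^ 2 * (if h i * ‖z‖ < r then 0 else 2 * M)) (f := fun _ => 0)
      (fun z => κ z ^ 2 * (2 * M)) ?_ ?_ (hκ.integrable_sq.mul_const _) ?_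
    · simpa using this
    · refine Eventually.of_forall fun i => Measurable.aestronglyMeasurable ?_
      refine (hκ.continuous.pow 2).measurable.mul (Measurable.ite ?_ measurable_const
        measurable_const)
      exact measurableSet_lt (by fun_prop) measurable_const
    · refine Eventually.of_forall fun i => ae_of_all _ fun z => ?_
      rw [Real.norm_eq_abs, abs_mul, abs_of_nonneg (sq_nonneg _)]
      refine mul_le_mul_of_nonneg_left ?_ (sq_nonneg _)
      split_ifs
      · rw [abs_zero]; positivity
      · rw [abs_of_nonneg (by positivity)]
    · refine ae_of_all _ fun z => ?_
      have h1 : Tendsto (fun i => h i * ‖z‖) atTop (𝓝 0) := by simpa using hh.mul_const ‖z‖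
      refine tendsto_const_nhds.congr' ?_
      filter_upwards [h1.eventually_lt_const hr] with i hi
      simp [hi]
  obtain ⟨N, hN⟩ := eventually_atTop.1 (htail.eventually_lt_const (half_pos (half_pos hε)))
  refine ⟨max N 1, fun i hi => ?_⟩
  have hi0 : 1 ≤ i := (le_max_right N 1).trans hi.le
  have hiN := hN i ((le_max_left N 1).trans hi.le)
  have hbound : ∀ x, ∫ z, κ z ^ 2 * |f (x - h i • z) - f x| ≤ ε / 2 := by
    intro x
    have hg : Integrable fun z => κ z ^ 2 * (if h i * ‖z‖ < r then 0 else 2 * M) := by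
      refine hκ.integrable_sq_mul (D := 2 * M) ?_ fun z => ?_
      · exact Measurable.ite (measurableSet_lt (by fun_prop) measurable_const) measurable_const
          measurable_const
      · split_ifs
        · rw [abs_zero]; positivity
        · rw [abs_of_nonneg (by positivity)]
    have h1 := integral_mono (hint i x)
      ((hκ.integrable_sq.mul_const (ε / (4 * (I + 1)))).add hg) fun z => by
        have : |f (x - h i • z) - f x| ≤ ε / (4 * (I + 1)) +
            (if h i * ‖z‖ < r then 0 else 2 * M) := by
          split_ifs with hz
          · have := hfr (a := x - h i • z) (b := x) (by
              rw [dist_eq_norm, sub_sub_cancel_left, norm_neg, norm_smul, Real.norm_eq_abs,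
                abs_of_pos (hpos i hi0)]
              exact hz)
            rw [Real.dist_eq] at this
            linarith
          · have : 0 < ε / (4 * (I + 1)) := by positivity
            linarith [hdiff (x - h i • z) x]
        have := mul_le_mul_of_nonneg_left this (sq_nonneg (κ z))
        simp only [Pi.add_apply]
        linarith
    simp only [Pi.add_apply] at h1
    rw [integral_add (hκ.integrable_sq.mul_const _) hg, integral_mul_const] at h1
    have h2 : I * (ε / (4 * (I + 1))) ≤ ε / 4 := by
      rw [mul_div_assoc', div_le_div_iff₀ (by positivity) (by norm_num)]
      nlinarith
    have h3 : (∫ z, κ z ^ 2) = I := rfl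
    rw [h3] at h1
    linarith
  have hnn : 0 ≤ ⨆ x, ∫ z, κ z ^ 2 * |f (x - h i • z) - f x| :=
    Real.iSup_nonneg fun x => integral_nonneg fun z => by positivity
  rw [Real.dist_eq, sub_zero, abs_of_nonneg hnn]
  exact (ciSup_le hbound).trans_lt (by linarith)

variable {Ω : Type*} [MeasurableSpace Ω] {μ : Measure Ω} [IsProbabilityMeasure μ]
  {X : ℕ → Ω → E d} {f : E d → ℝ}

/-- Two-sided bounds for the centered cumulant of a rescaled kernel. -/
theorem exists_cgf_bounds (hκ : NiceKernel κ R) (hX : IIDWithDensity μ X f) (B : ℝ) :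
    ∃ C, 0 ≤ C ∧ ∀ (h c : ℝ) (i : ℕ) (x : E d), 0 < h → |c| ≤ B → 1 ≤ i →
      cgf (fun ω => κ (h⁻¹ • (x - X i ω))) μ c - c * ∫ ω, κ (h⁻¹ • (x - X i ω)) ∂μ ≤
        h ^ d * c ^ 2 * ∫ z, κ z ^ 2 * expRem (c * κ z) * f (x - h • z) ∧
      h ^ d * c ^ 2 * ((∫ z, κ z ^ 2 * expRem (c * κ z) * f (x - h • z)) - C * h ^ d) ≤
        cgf (fun ω => κ (h⁻¹ • (x - X i ω))) μ c - c * ∫ ω, κ (h⁻¹ • (x - X i ω)) ∂μ := by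
  obtain ⟨M, hM⟩ := hX.bounded
  have hM0 : 0 ≤ M := (abs_nonneg _).trans (hM 0)
  obtain ⟨D, hD, hDb⟩ := exists_expRem_le (B * R)
  set a1 := M * ∫ z, |κ z|
  set a2 := D * M * ∫ z, κ z ^ 2
  have ha1 : 0 ≤ a1 := mul_nonneg hM0 (integral_nonneg fun _ => abs_nonneg _)
  have ha2 : 0 ≤ a2 := mul_nonneg (by positivity) (integral_nonneg fun _ => sq_nonneg _)
  -- The first summand pays for the error 2x² in log(1 + x) when |x| ≤ 1/2. The second handles |x| >
  -- 1/2, where h^d is bounded below.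
  refine ⟨2 * (a1 + |B| * a2) ^ 2 + 2 * a2 * (|B| * (a1 + |B| * a2)), by positivity,
    fun h c i x hh hc hi => ?_⟩
  have hB0 : |B| = B := abs_of_nonneg ((abs_nonneg _).trans hc)
  rw [hB0]
  have hB := (abs_nonneg _).trans hc
  have hfm := hX.measurable_f
  have hκm := hκ.continuous.measurable
  have hXm := hX.measurable_X i hi
  have hZ : Measurable fun ω => κ (h⁻¹ • (x - X i ω)) := by fun_prop
  have hR : ∀ ω, |κ (h⁻¹ • (x - X i ω))| ≤ R := fun ω => hκ.abs_le _
  have e1 : ∫ ω, κ (h⁻¹ • (x - X i ω)) ∂μ = h ^ d * ∫ z, κ z * f (x - h • z) :=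
    hX.integral_comp_scaled hi hκm x hh
  set J := ∫ z, κ z ^ 2 * expRem (c * κ z) * f (x - h • z) with hJ
  have e2 : ∫ ω, (c * κ (h⁻¹ • (x - X i ω))) ^ 2 * expRem (c * κ (h⁻¹ • (x - X i ω))) ∂μ =
      h ^ d * c ^ 2 * J := by
    rw [hX.integral_comp_scaled hi (G := fun z => (c * κ z) ^ 2 * expRem (c * κ z))
      (((measurable_const.mul hκm).pow_const 2).mul (hκ.measurable_expRem c)) x hh, mul_assoc,
      hJ, ← integral_const_mul (c ^ 2)]
    simp only [mul_pow, mul_assoc]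
  have p1 := cgf_sub_le (μ := μ) hZ hR c
  rw [e2] at p1
  refine ⟨p1, ?_⟩
  have hJ0 : 0 ≤ J := integral_nonneg fun z =>
    mul_nonneg (mul_nonneg (sq_nonneg _) (expRem_nonneg _)) (hX.nonneg _)
  have hJ2 : J ≤ a2 := by
    rw [hJ]
    have : a2 = ∫ z, κ z ^ 2 * (D * M) := by rw [integral_mul_const]; ring
    rw [this]
    refine integral_mono_of_nonneg (ae_of_all _ fun z => ?_)
      (hκ.integrable_sq.mul_const _) (ae_of_all _ fun z => ?_)
    · exact mul_nonneg (mul_nonneg (sq_nonneg _) (expRem_nonneg _)) (hX.nonneg _)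
    · have q1 := hDb _ (hκ.abs_mul_le hc z)
      have q2 := (le_abs_self _).trans (hM (x - h • z))
      have q3 := expRem_nonneg (c * κ z)
      have q4 := hX.nonneg (x - h • z)
      simp only [mul_assoc]
      gcongr
  have hm : |∫ z, κ z * f (x - h • z)| ≤ a1 := by
    have : a1 = ∫ z, |κ z| * M := by rw [integral_mul_const]; ring
    rw [this]
    refine (abs_integral_le_integral_abs).trans (integral_mono_of_nonneg
      (ae_of_all _ fun z => abs_nonneg _) (hκ.integrable.abs.mul_const _) (ae_of_all _ fun z => ?_))
    simp only [abs_mul]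
    exact mul_le_mul_of_nonneg_left (hM _) (abs_nonneg _)
  set m := ∫ z, κ z * f (x - h • z)
  have hhd : 0 < h ^ d := by positivity
  have hxa : |m + c * J| ≤ a1 + B * a2 := by
    refine (abs_add_le _ _).trans (add_le_add hm ?_)
    rw [abs_mul, abs_of_nonneg hJ0]
    exact mul_le_mul hc hJ2 hJ0 hB
  have hx : |c * (h ^ d * m) + h ^ d * c ^ 2 * J| ≤ h ^ d * (B * (a1 + B * a2)) := by
    have : c * (h ^ d * m) + h ^ d * c ^ 2 * J = h ^ d * (c * (m + c * J)) := by ring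
    rw [this, abs_mul, abs_mul, abs_of_pos hhd]
    exact mul_le_mul_of_nonneg_left (mul_le_mul hc hxa (abs_nonneg _) hB) hhd.le
  by_cases hs : |c * (h ^ d * m) + h ^ d * c ^ 2 * J| ≤ 1 / 2
  · have p2 := le_cgf_sub (μ := μ) hZ hR c (by rw [e1, e2]; exact hs)
    rw [e1, e2] at p2
    rw [e1]
    refine le_trans ?_ p2
    have h1 : (c * (h ^ d * m) + h ^ d * c ^ 2 * J) ^ 2 =
        h ^ d * c ^ 2 * h ^ d * (m + c * J) ^ 2 := by ring
    have h2 : (m + c * J) ^ 2 ≤ (a1 + B * a2) ^ 2 := by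
      rw [← sq_abs]; exact pow_le_pow_left₀ (abs_nonneg _) hxa 2
    have h3 : 0 ≤ h ^ d * c ^ 2 * h ^ d := by positivity
    have h4 := mul_le_mul_of_nonneg_left h2 h3
    have h5 : 0 ≤ h ^ d * c ^ 2 * h ^ d * (2 * a2 * (B * (a1 + B * a2))) := by positivity
    rw [h1]
    nlinarith
  -- Now h^d exceeds a fixed constant, so C h^d ≥ J and the claimed lower bound is at most 0, while
  -- Jensen makes the centered cumulant nonnegative.
  · push Not at hs
    have p2 := mul_integral_le_cgf (μ := μ) hZ hR c
    have h1 : 1 / 2 < h ^ d * (B * (a1 + B * a2)) := hs.trans_le hx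
    have h2 : J ≤ (2 * (a1 + B * a2) ^ 2 + 2 * a2 * (B * (a1 + B * a2))) * h ^ d := by
      have h3 : a2 * (1 / 2) ≤ a2 * (h ^ d * (B * (a1 + B * a2))) :=
        mul_le_mul_of_nonneg_left h1.le ha2
      have h4 : 0 ≤ 2 * (a1 + B * a2) ^ 2 * h ^ d := by positivity
      nlinarith
    have h3 : h ^ d * c ^ 2 *
        (J - (2 * (a1 + B * a2) ^ 2 + 2 * a2 * (B * (a1 + B * a2))) * h ^ d) ≤ 0 :=
      mul_nonpos_of_nonneg_of_nonpos (by positivity) (by linarith)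
    linarith

end NiceKernel

end RecKernel

end

/-! ### Scaled cumulants of the centered estimator -/

noncomputable section

namespace RecKernel

variable {d : ℕ} {Ω : Type*} [MeasurableSpace Ω] {μ : Measure Ω} {X : ℕ → Ω → E d}
  {f K : E d → ℝ} {α : Fin d → ℕ} {a : ℝ} {h v : ℕ → ℝ} {ℓ R : ℝ}

/-- The centered and normalised estimator. -/
def centered (μ : Measure Ω) (X : ℕ → Ω → E d) (K : E d → ℝ) (α : Fin d → ℕ) (h v : ℕ → ℝ)
    (n : ℕ) (x : E d) (ω : Ω) : ℝ :=
  v n * (estimator α K h X n ω x - ∫ ω', estimator α K h X n ω' x ∂μ)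

theorem measurable_summand (hX : IIDWithDensity μ X f) (hκ : NiceKernel (mderiv α K) R) {i : ℕ}
    (hi : 1 ≤ i) (r : ℝ) (x : E d) :
    Measurable fun ω => mderiv α K (r • (x - X i ω)) := by
  have h1 := hκ.continuous.measurable
  have h2 := hX.measurable_X i hi
  fun_prop

theorem integrable_summand [IsProbabilityMeasure μ] (hX : IIDWithDensity μ X f)
    (hκ : NiceKernel (mderiv α K) R) {i : ℕ} (hi : 1 ≤ i) (r : ℝ) (x : E d) :
    Integrable (fun ω => mderiv α K (r • (x - X i ω))) μ :=
  Integrable.of_bound (measurable_summand hX hκ hi r x).aestronglyMeasurable R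
    (ae_of_all _ fun _ => hκ.abs_le _)

theorem integral_estimator [IsProbabilityMeasure μ] (hX : IIDWithDensity μ X f)
    (hκ : NiceKernel (mderiv α K) R) (n : ℕ) (x : E d) :
    ∫ ω, estimator α K h X n ω x ∂μ = (1 / (n : ℝ)) * ∑ i ∈ Finset.Icc 1 n,
      (1 / h i ^ (d + mlen α)) * ∫ ω, mderiv α K ((h i)⁻¹ • (x - X i ω)) ∂μ := by
  simp only [estimator]
  rw [integral_const_mul, integral_finsetSum]
  · simp only [integral_const_mul]
  · exact fun i hi => (integrable_summand hX hκ (Finset.mem_Icc.1 hi).1 _ x).const_mul _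

theorem centered_eq_sum [IsProbabilityMeasure μ] (hX : IIDWithDensity μ X f)
    (hκ : NiceKernel (mderiv α K) R) (n : ℕ) (x : E d) :
    centered μ X K α h v n x = ∑ k ∈ Finset.range n, fun ω =>
      (v n / n / h (k + 1) ^ (d + mlen α)) * (mderiv α K ((h (k + 1))⁻¹ • (x - X (k + 1) ω)) -
        ∫ ω', mderiv α K ((h (k + 1))⁻¹ • (x - X (k + 1) ω')) ∂μ) := by
  ext ω
  rw [Finset.sum_apply, centered, integral_estimator hX hκ, estimator, ← mul_sub,
    ← Finset.sum_sub_distrib, Finset.mul_sum, Finset.mul_sum, Finset.range_eq_Ico,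
    Finset.sum_Ico_add' (fun i => (v n / n / h i ^ (d + mlen α)) *
      (mderiv α K ((h i)⁻¹ • (x - X i ω)) - ∫ ω', mderiv α K ((h i)⁻¹ • (x - X i ω')) ∂μ)) 0 n 1]
  refine Finset.sum_congr (by rfl) fun i _ => ?_
  ring

theorem measurable_centered [IsProbabilityMeasure μ] (hX : IIDWithDensity μ X f)
    (hκ : NiceKernel (mderiv α K) R) (n : ℕ) (x : E d) :
    Measurable (centered μ X K α h v n x) := by
  rw [centered_eq_sum hX hκ, Finset.sum_fn]
  exact Finset.measurable_sum _ fun k _ =>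
    ((measurable_summand hX hκ (Nat.le_add_left 1 _) _ x).sub_const _).const_mul _

theorem exists_abs_centered_le [IsProbabilityMeasure μ] (hX : IIDWithDensity μ X f)
    (hκ : NiceKernel (mderiv α K) R) (n : ℕ) (x : E d) :
    ∃ D, ∀ ω, |centered μ X K α h v n x ω| ≤ D := by
  rw [centered_eq_sum hX hκ]
  refine ⟨∑ k ∈ Finset.range n, |v n / n / h (k + 1) ^ (d + mlen α)| *
    (R + |∫ ω', mderiv α K ((h (k + 1))⁻¹ • (x - X (k + 1) ω')) ∂μ|), fun ω => ?_⟩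
  rw [Finset.sum_apply]
  refine (Finset.abs_sum_le_sum_abs _ _).trans (Finset.sum_le_sum fun k _ => ?_)
  rw [abs_mul]
  exact mul_le_mul_of_nonneg_left ((abs_sub _ _).trans (by gcongr; exact hκ.abs_le _))
    (abs_nonneg _)

theorem integrable_exp_centered [IsProbabilityMeasure μ] (hX : IIDWithDensity μ X f)
    (hκ : NiceKernel (mderiv α K) R) (n : ℕ) (x : E d) (t : ℝ) :
    Integrable (fun ω => Real.exp (t * centered μ X K α h v n x ω)) μ := by
  obtain ⟨D, hD⟩ := exists_abs_centered_le (h := h) (v := v) hX hκ n x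
  exact integrable_comp_of_abs_le (measurable_centered hX hκ n x) hD
    (G := fun y => Real.exp (t * y)) (by fun_prop)

theorem cgf_const_mul_sub [IsProbabilityMeasure μ] {Z : Ω → ℝ}
    (hZ : ∀ t, Integrable (fun ω => Real.exp (t * Z ω)) μ) (b m t : ℝ) :
    cgf (fun ω => b * (Z ω - m)) μ t = cgf Z μ (t * b) - t * b * m := by
  have h1 : mgf (fun ω => b * (Z ω - m)) μ t = mgf Z μ (t * b) * Real.exp (-(t * b * m)) := by
    rw [mgf_const_mul (X := fun ω => Z ω - m)]
    simp only [sub_eq_add_neg]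
    rw [mgf_add_const, mul_comm b t, mul_neg]
  rw [cgf, h1, Real.log_mul (mgf_pos (hZ _)).ne' (Real.exp_pos _).ne', Real.log_exp, cgf]
  ring

/-- Independence makes the cumulant additive. The argument speed · θ times the factor v_n / (n
h_i^{d+|α|}) of the i-th summand is exactly `coef`; the shift by 1 matches the indexing of the
independent family. -/
theorem cgf_centered [IsProbabilityMeasure μ] (H : ScaleHyp α a h v ℓ)
    (hX : IIDWithDensity μ X f) (hκ : NiceKernel (mderiv α K) R) (n : ℕ) (x : E d) (θ : ℝ) :
    cgf (centered μ X K α h v n x) μ (speed α h v n * θ) = ∑ i ∈ Finset.Icc 1 n,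
      (cgf (fun ω => mderiv α K ((h i)⁻¹ • (x - X i ω))) μ (coef α h v θ n i) -
        coef α h v θ n i * ∫ ω, mderiv α K ((h i)⁻¹ • (x - X i ω)) ∂μ) := by
  have hexp : ∀ (k : ℕ) (t : ℝ), Integrable (fun ω =>
      Real.exp (t * mderiv α K ((h (k + 1))⁻¹ • (x - X (k + 1) ω)))) μ := fun k t =>
    integrable_comp_of_abs_le (measurable_summand hX hκ (by omega) _ x) (fun ω => hκ.abs_le _)
      (G := fun y => Real.exp (t * y)) (by fun_prop)
  have hκm := hκ.continuous.measurable
  have hind := hX.indep.comp (fun (k : ℕ) (y : E d) =>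
      (v n / n / h (k + 1) ^ (d + mlen α)) * (mderiv α K ((h (k + 1))⁻¹ • (x - y)) -
        ∫ ω', mderiv α K ((h (k + 1))⁻¹ • (x - X (k + 1) ω')) ∂μ)) (fun k => by fun_prop)
  rw [centered_eq_sum hX hκ]
  have := hind.cgf_sum (t := speed α h v n * θ) (s := Finset.range n) (fun k =>
    ((measurable_summand hX hκ (by omega) _ x).sub_const _).const_mul _) (fun k _ => by
      have := integrable_comp_of_abs_le (μ := μ) (measurable_summand hX hκ
        (by omega : 1 ≤ k + 1) (h (k + 1))⁻¹ x) (fun ω => hκ.abs_le _)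
        (G := fun y => Real.exp (speed α h v n * θ * ((v n / n / h (k + 1) ^ (d + mlen α)) *
          (y - ∫ ω', mderiv α K ((h (k + 1))⁻¹ • (x - X (k + 1) ω')) ∂μ)))) (by fun_prop)
      exact this)
  refine this.trans ?_
  have h2 := Finset.sum_Ico_add' (fun i =>
    (cgf (fun ω => mderiv α K ((h i)⁻¹ • (x - X i ω))) μ (coef α h v θ n i) -
        coef α h v θ n i * ∫ ω, mderiv α K ((h i)⁻¹ • (x - X i ω)) ∂μ)) 0 n 1
  rw [← Finset.range_eq_Ico] at h2
  refine Eq.trans (Finset.sum_congr rfl fun k hk => ?_) h2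
  have hn : 1 ≤ n := by have := Finset.mem_range.1 hk; omega
  have hvn := (H.v_pos n hn).ne'
  have hn0 : (n : ℝ) ≠ 0 := by positivity
  have hk0 := (H.reg.pos (k + 1) (by omega)).ne'
  have hc : speed α h v n * θ * (v n / n / h (k + 1) ^ (d + mlen α)) = coef α h v θ n (k + 1) := by
    rw [speed, coef]
    field_simp
  rw [← hc]
  exact cgf_const_mul_sub (hexp k) _ _ _

theorem tendsto_inv_mul_sum_Icc {e : ℕ → ℝ} (he : Tendsto e atTop (𝓝 0)) :
    Tendsto (fun n : ℕ => (n : ℝ)⁻¹ * ∑ i ∈ Finset.Icc 1 n, e i) atTop (𝓝 0) := by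
  have h1 := ((tendsto_add_atTop_iff_nat 1).2 he).cesaro
  refine h1.congr fun n => ?_
  rw [Finset.range_eq_Ico, Finset.sum_Ico_add' e 0 n 1]
  rfl

/-- The scaled cumulants of the centered estimator converge uniformly on `ℝ^d`. -/
theorem eventually_abs_cgf_centered_sub_le [IsProbabilityMeasure μ] (H : ScaleHyp α a h v ℓ)
    (hX : IIDWithDensity μ X f) (hf : UniformContinuous f) (hκ : NiceKernel (mderiv α K) R)
    (θ : ℝ) {ε : ℝ} (hε : 0 < ε) :
    ∀ᶠ n in atTop, ∀ x, |(speed α h v n)⁻¹ *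
      cgf (centered μ X K α h v n x) μ (speed α h v n * θ) -
      f x * ScaleHyp.limitFun α a ℓ (kernelRem (mderiv α K)) θ| ≤ ε := by
  obtain ⟨B, hB, hb⟩ := H.exists_bound θ
  obtain ⟨M, hM⟩ := hX.bounded
  have hM0 : 0 ≤ M := (abs_nonneg _).trans (hM 0)
  obtain ⟨D, hD, hDb⟩ := exists_expRem_le (B * R)
  obtain ⟨e, he, heb⟩ := hκ.exists_tendsto_zero hf hM H.reg.pos (H.reg.tendsto_zero H.a_pos)
  obtain ⟨C, hC, hCb⟩ := hκ.exists_cgf_bounds hX B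
  set κ := mderiv α K
  have hdpos := H.d_ne_zero
  have hlim := H.tendsto_sum_weight θ hκ.continuous_kernelRem
  -- The error of the i-th term: oscillation of f at scale h_i, plus the second order error of the
  -- logarithm. The weights are at most B/n, so Cesàro averaging makes the total error vanish,
  -- uniformly in x.
  have hr : Tendsto (fun i => D * e i + C * h i ^ d) atTop (𝓝 0) := by
    have := (he.const_mul D).add (((H.reg.tendsto_zero H.a_pos).pow d).const_mul C)
    simpa [hdpos] using this
  have hces := (tendsto_inv_mul_sum_Icc hr).const_mul B
  rw [mul_zero] at hces
  filter_upwards [eventually_ge_atTop 1, hces.eventually_le_const (half_pos hε),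
    (Metric.tendsto_nhds.1 hlim) (ε / (2 * (M + 1))) (by positivity)] with n hn h1 h2 x
  have hsp := H.speed_pos hn
  rw [cgf_centered H hX hκ, Finset.mul_sum]
  have hfm := hX.measurable_f
  have hJ : ∀ i ∈ Finset.Icc 1 n, |(∫ z, κ z ^ 2 * expRem (coef α h v θ n i * κ z) *
      f (x - h i • z)) - f x * kernelRem κ (coef α h v θ n i)| ≤ D * e i := by
    intro i hi
    obtain ⟨hi1, hin⟩ := Finset.mem_Icc.1 hi
    have hc := (hb n i hi1 hin).1
    have i1 : Integrable fun z => κ z ^ 2 * expRem (coef α h v θ n i * κ z) *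
        f (x - h i • z) := by
      have := hκ.integrable_sq_mul (G := fun z => expRem (coef α h v θ n i * κ z) *
        f (x - h i • z)) ((hκ.measurable_expRem _).mul (by fun_prop)) (D := D * M) fun z => by
          rw [abs_mul, abs_of_nonneg (expRem_nonneg _)]
          exact mul_le_mul (hDb _ (hκ.abs_mul_le hc z)) (hM _) (abs_nonneg _) hD
      simpa only [mul_assoc] using this
    have i2 : Integrable fun z => f x * (κ z ^ 2 * expRem (coef α h v θ n i * κ z)) := by
      refine (hκ.integrable_sq_mul (hκ.measurable_expRem _) (D := D) fun z => ?_).const_mul _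
      rw [abs_of_nonneg (expRem_nonneg _)]
      exact hDb _ (hκ.abs_mul_le hc z)
    rw [kernelRem, ← integral_const_mul, ← integral_sub i1 i2]
    refine (abs_integral_le_integral_abs).trans ?_
    refine le_trans ?_ (mul_le_mul_of_nonneg_left (heb i x) hD)
    rw [← integral_const_mul]
    refine integral_mono_of_nonneg (ae_of_all _ fun z => abs_nonneg _) ?_ (ae_of_all _ fun z => ?_)
    · refine (hκ.integrable_sq_mul (G := fun z => |f (x - h i • z) - f x|) (by fun_prop)
        (D := M + M) fun z => ?_).const_mul _
      rw [abs_abs]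
      exact (abs_sub _ _).trans (add_le_add (hM _) (hM _))
    · simp only
      have e1 : κ z ^ 2 * expRem (coef α h v θ n i * κ z) * f (x - h i • z) -
          f x * (κ z ^ 2 * expRem (coef α h v θ n i * κ z)) =
          expRem (coef α h v θ n i * κ z) * (κ z ^ 2 * (f (x - h i • z) - f x)) := by ring
      rw [e1, abs_mul, abs_of_nonneg (expRem_nonneg _), abs_mul, abs_of_nonneg (sq_nonneg _)]
      exact mul_le_mul_of_nonneg_right (hDb _ (hκ.abs_mul_le hc z)) (by positivity)
  have hterm : ∀ i ∈ Finset.Icc 1 n, |(speed α h v n)⁻¹ *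
      (cgf (fun ω => κ ((h i)⁻¹ • (x - X i ω))) μ (coef α h v θ n i) -
        coef α h v θ n i * ∫ ω, κ ((h i)⁻¹ • (x - X i ω)) ∂μ) -
      f x * (weight α h v θ n i * kernelRem κ (coef α h v θ n i))| ≤
      B * ((n : ℝ)⁻¹ * (D * e i + C * h i ^ d)) := by
    intro i hi
    have hJi := abs_le.1 (hJ i hi)
    obtain ⟨hi1, hin⟩ := Finset.mem_Icc.1 hi
    obtain ⟨hc, hw⟩ := hb n i hi1 hin
    obtain ⟨c1, c2⟩ := hCb (h i) (coef α h v θ n i) i x (H.reg.pos i hi1) hc hi1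
    set J := ∫ z, κ z ^ 2 * expRem (coef α h v θ n i * κ z) * f (x - h i • z)
    set Δ := cgf (fun ω => κ ((h i)⁻¹ • (x - X i ω))) μ (coef α h v θ n i) -
        coef α h v θ n i * ∫ ω, κ ((h i)⁻¹ • (x - X i ω)) ∂μ
    have hw0 := H.weight_nonneg θ hi1 hin
    have c1' := mul_le_mul_of_nonneg_left c1 (inv_pos.2 hsp).le
    have c2' := mul_le_mul_of_nonneg_left c2 (inv_pos.2 hsp).le
    have w1 : (speed α h v n)⁻¹ * (h i ^ d * coef α h v θ n i ^ 2 * J) =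
      weight α h v θ n i * J := by rw [weight]; ring
    have w2 : (speed α h v n)⁻¹ * (h i ^ d * coef α h v θ n i ^ 2 * (J - C * h i ^ d)) =
      weight α h v θ n i * (J - C * h i ^ d) := by rw [weight]; ring
    rw [w1] at c1'
    rw [w2] at c2'
    have hhd := pow_pos (H.reg.pos i hi1) d
    have hrnn : 0 ≤ D * e i + C * h i ^ d := by
      have : 0 ≤ D * e i := by linarith
      positivity
    have hfin : weight α h v θ n i * (D * e i + C * h i ^ d) ≤
        B * ((n : ℝ)⁻¹ * (D * e i + C * h i ^ d)) := by
      rw [← mul_assoc, ← div_eq_mul_inv]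
      exact mul_le_mul_of_nonneg_right hw hrnn
    have hCh : 0 ≤ weight α h v θ n i * (C * h i ^ d) := by positivity
    have hj1 := mul_le_mul_of_nonneg_left hJi.1 hw0
    have hj2 := mul_le_mul_of_nonneg_left hJi.2 hw0
    rw [abs_le]
    constructor <;> nlinarith
  have htot : |∑ i ∈ Finset.Icc 1 n, (speed α h v n)⁻¹ *
      (cgf (fun ω => κ ((h i)⁻¹ • (x - X i ω))) μ (coef α h v θ n i) -
        coef α h v θ n i * ∫ ω, κ ((h i)⁻¹ • (x - X i ω)) ∂μ) -
      f x * ∑ i ∈ Finset.Icc 1 n, weight α h v θ n i * kernelRem κ (coef α h v θ n i)| ≤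
      ε / 2 := by
    rw [Finset.mul_sum, ← Finset.sum_sub_distrib]
    refine (Finset.abs_sum_le_sum_abs _ _).trans ((Finset.sum_le_sum hterm).trans ?_)
    rw [← Finset.mul_sum, ← Finset.mul_sum]
    exact h1
  have hf2 : |f x * ∑ i ∈ Finset.Icc 1 n, weight α h v θ n i * kernelRem κ (coef α h v θ n i) -
      f x * ScaleHyp.limitFun α a ℓ (kernelRem κ) θ| ≤ ε / 2 := by
    rw [← mul_sub, abs_mul]
    rw [Real.dist_eq] at h2
    refine (mul_le_mul (hM x) h2.le (abs_nonneg _) hM0).trans ?_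
    rw [mul_div_assoc', div_le_div_iff₀ (by positivity) (by norm_num)]
    nlinarith
  exact (abs_sub_le _ _ _).trans (by linarith)

end RecKernel

end

noncomputable section

namespace RecKernel

/-! ### Iterated partial derivatives and convolutions -/

/-- The successive directions of differentiation in `mderiv α`, outermost first. -/
def directions {d : ℕ} (α : Fin d → ℕ) : List (Fin d) :=
  (List.finRange d).flatMap fun j => List.replicate (α j) j

theorem foldr_replicate_pderiv {d : ℕ} (j : Fin d) (k : ℕ) (g : E d → ℝ) :
    (List.replicate k j).foldr pderiv g = (pderiv j)^[k] g := by
  induction k with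
  | zero => rfl
  | succ k ih => rw [List.replicate_succ, List.foldr_cons, ih, Function.iterate_succ_apply']

theorem mderiv_eq_foldr {d : ℕ} (α : Fin d → ℕ) (g : E d → ℝ) :
    mderiv α g = (directions α).foldr pderiv g := by
  unfold mderiv directions
  induction List.finRange d with
  | nil => rfl
  | cons j L ih =>
    rw [List.foldr_cons, List.flatMap_cons, List.foldr_append, ← ih, foldr_replicate_pderiv]

theorem length_directions {d : ℕ} (α : Fin d → ℕ) : (directions α).length = mlen α := by
  rw [directions, List.length_flatMap, mlen, Fin.sum_univ_def]
  simp

/-- Each line derivative of an evaluated differential is the next differential with one more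
argument in front. The order of the directions is kept, so no symmetry of mixed derivatives is
needed and the top differential need not be continuous. -/
theorem foldr_pderiv_eq {d : ℕ} (l : List (Fin d)) {g : E d → ℝ} (hg : TimesDiff l.length g) :
    l.foldr pderiv g = fun x => iteratedFDeriv ℝ l.length g x
      fun i => EuclideanSpace.single (l.get i) 1 := by
  induction l with
  | nil => ext x; simp
  | cons j l ih =>
    rw [List.foldr_cons, ih fun k hk => hg k (hk.trans (Nat.lt_succ_self _))]
    ext x
    have hd : DifferentiableAt ℝ (iteratedFDeriv ℝ l.length g) x := hg _ (Nat.lt_succ_self _) x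
    have h1 : HasFDerivAt (fun y => iteratedFDeriv ℝ l.length g y
        fun i => EuclideanSpace.single (l.get i) (1 : ℝ))
        ((ContinuousMultilinearMap.apply ℝ (fun _ : Fin l.length => E d) ℝ
          fun i => EuclideanSpace.single (l.get i) (1 : ℝ)).comp
          (fderiv ℝ (iteratedFDeriv ℝ l.length g) x)) x :=
      (ContinuousMultilinearMap.apply ℝ (fun _ : Fin l.length => E d) ℝ
        fun i => EuclideanSpace.single (l.get i) (1 : ℝ)).hasFDerivAt.comp x hd.hasFDerivAt
    rw [pderiv, (h1.hasLineDerivAt _).lineDeriv]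
    exact (iteratedFDeriv_succ_apply_left (𝕜 := ℝ) (f := g) (x := x) (n := l.length)
      fun i => EuclideanSpace.single ((j :: l).get i) (1 : ℝ)).symm

theorem differentiable_foldr_pderiv {d : ℕ} (l : List (Fin d)) {g : E d → ℝ}
    (hg : TimesDiff (l.length + 1) g) : Differentiable ℝ (l.foldr pderiv g) := by
  rw [foldr_pderiv_eq l fun k hk => hg k (hk.trans (Nat.lt_succ_self _))]
  exact fun x => ((ContinuousMultilinearMap.apply ℝ (fun _ : Fin l.length => E d) ℝ
    fun i => EuclideanSpace.single (l.get i) (1 : ℝ)).differentiableAt).comp x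
      (hg _ (Nat.lt_succ_self _) x)

theorem abs_foldr_pderiv_le {d : ℕ} (l : List (Fin d)) {g : E d → ℝ}
    (hg : TimesDiff l.length g) (x : E d) :
    |l.foldr pderiv g x| ≤ ‖iteratedFDeriv ℝ l.length g x‖ := by
  rw [foldr_pderiv_eq l hg]
  refine ((iteratedFDeriv ℝ l.length g x).le_opNorm _).trans ?_
  simp

/-- All intermediate derivatives along `l` exist and are bounded and continuous. -/
structure DerivChain {d : ℕ} (l : List (Fin d)) (g : E d → ℝ) : Prop where
  continuous : ∀ l', l' <:+ l → Continuous (l'.foldr pderiv g)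
  bounded : ∀ l', l' <:+ l → Bdd (l'.foldr pderiv g)
  differentiable : ∀ l', l' <:+ l → l'.length < l.length → Differentiable ℝ (l'.foldr pderiv g)

/-- `foldr` applies the end of the list first, so suffixes index the intermediate derivatives. The
proper ones are controlled by the norms of the differentials; only the full derivative needs
continuity and boundedness as hypotheses. -/
theorem derivChain_directions {d : ℕ} {α : Fin d → ℕ} {g : E d → ℝ}
    (hg : TimesDiff (mlen α) g) (hb : ∀ j < mlen α, ∃ C : ℝ, ∀ x, ‖iteratedFDeriv ℝ j g x‖ ≤ C)
    (hc : Continuous (mderiv α g)) (hm : Bdd (mderiv α g)) : DerivChain (directions α) g := by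
  have hlt : ∀ l', l' <:+ directions α → l' = directions α ∨ l'.length < mlen α := fun l' hl => by
    rw [← length_directions]
    rcases hl.length_le.eq_or_lt with h | h
    · exact Or.inl (hl.eq_of_length h)
    · exact Or.inr h
  have hT : ∀ k, k ≤ mlen α → TimesDiff k g := fun k hk j hj => hg j (hj.trans_le hk)
  refine ⟨fun l' hl => ?_, fun l' hl => ?_, fun l' hl h => ?_⟩
  · rcases hlt l' hl with rfl | h
    · rwa [← mderiv_eq_foldr]
    · exact (differentiable_foldr_pderiv l' (hT _ h)).continuous
  · rcases hlt l' hl with rfl | h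
    · rwa [← mderiv_eq_foldr]
    · obtain ⟨C, hC⟩ := hb _ h
      exact ⟨C, fun x => (abs_foldr_pderiv_le l' (hT _ h.le) x).trans (hC x)⟩
  · rw [length_directions] at h
    exact differentiable_foldr_pderiv l' (hT _ h)

theorem integrable_mul_comp {d : ℕ} {ρ : E d → ℝ} (hρ : Integrable ρ) {G : E d → ℝ}
    (hG : Continuous G) (hb : Bdd G) {τ : E d → E d} (hτ : Continuous τ) :
    Integrable fun z => ρ z * G (τ z) := by
  obtain ⟨C, hC⟩ := hb
  exact hρ.mul_bdd (c := C) (hG.comp hτ).aestronglyMeasurable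
    (ae_of_all _ fun z => by simpa using hC _)

/-- Differentiation under the integral sign along a coordinate line, dominated by a multiple of |ρ|.
The affine form r • x + τ z is preserved by each derivative and covers both ways of writing a
convolution. -/
theorem pderiv_integral {d : ℕ} {ρ : E d → ℝ} (hρ : Integrable ρ) (j : Fin d) {G : E d → ℝ}
    (hG : Differentiable ℝ G) (hb : Bdd G) (hc' : Continuous (pderiv j G))
    (hb' : Bdd (pderiv j G)) (r c : ℝ) {τ : E d → E d} (hτ : Continuous τ) :
    pderiv j (fun x => c * ∫ z, ρ z * G (r • x + τ z)) =
      fun x => r * c * ∫ z, ρ z * pderiv j G (r • x + τ z) := by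
  ext x
  obtain ⟨C, hC⟩ := hb'
  set e : E d := EuclideanSpace.single j 1
  have hder : ∀ (z : E d) (t : ℝ), HasDerivAt (fun t : ℝ => ρ z * G (r • (x + t • e) + τ z))
      (ρ z * (r * pderiv j G (r • (x + t • e) + τ z))) t := by
    intro z t
    have h1 : HasDerivAt (fun t : ℝ => r • (x + t • e) + τ z) (r • e) t := by
      have : HasDerivAt (fun t : ℝ => t • e) ((1 : ℝ) • e) t := (hasDerivAt_id t).smul_const e
      rw [one_smul] at this
      exact ((this.const_add x).const_smul r).add_const _
    have h2 := (hG (r • (x + t • e) + τ z)).hasFDerivAt.comp_hasDerivAt t h1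
    rw [map_smul, smul_eq_mul, ← (hG _).lineDeriv_eq_fderiv] at h2
    exact h2.const_mul _
  have hτx : ∀ t : ℝ, Continuous fun z => r • (x + t • e) + τ z := fun t => by fun_prop
  have key := hasDerivAt_integral_of_dominated_loc_of_deriv_le (μ := (volume : Measure (E d)))
    (F := fun t z => ρ z * G (r • (x + t • e) + τ z))
    (F' := fun t z => ρ z * (r * pderiv j G (r • (x + t • e) + τ z)))
    (bound := fun z => |ρ z| * (|r| * C)) (x₀ := (0 : ℝ)) (s := univ) univ_mem
    (Eventually.of_forall fun t =>
      (integrable_mul_comp hρ hG.continuous hb (hτx t)).aestronglyMeasurable)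
    (integrable_mul_comp hρ hG.continuous hb (hτx 0))
    (hρ.aestronglyMeasurable.mul
      (((hc'.comp (hτx 0)).const_mul r).aestronglyMeasurable))
    (ae_of_all _ fun z t _ => by
      rw [Real.norm_eq_abs, abs_mul, abs_mul]
      gcongr
      exact hC _) (hρ.abs.mul_const _) (ae_of_all _ fun z t _ => hder z t)
  have h3 := key.2.const_mul c
  have h4 : HasLineDerivAt ℝ (fun x => c * ∫ z, ρ z * G (r • x + τ z)) _ x e := h3
  rw [pderiv, h4.lineDeriv]
  simp only [zero_smul, add_zero]
  rw [mul_comm r c, mul_assoc, ← integral_const_mul r]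
  congr 2
  refine funext fun z => ?_
  ring

theorem foldr_pderiv_integral {d : ℕ} {ρ : E d → ℝ} (hρ : Integrable ρ) {l : List (Fin d)}
    {g : E d → ℝ} (hg : DerivChain l g) (r : ℝ) {τ : E d → E d} (hτ : Continuous τ) :
    l.foldr pderiv (fun x => ∫ z, ρ z * g (r • x + τ z)) =
      fun x => r ^ l.length * ∫ z, ρ z * l.foldr pderiv g (r • x + τ z) := by
  induction l with
  | nil => simp
  | cons j l ih =>
    have hs : l <:+ j :: l := List.suffix_cons j l
    rw [List.foldr_cons, ih ⟨fun l' h => hg.continuous l' (h.trans hs),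
      fun l' h => hg.bounded l' (h.trans hs), fun l' h hlt =>
        hg.differentiable l' (h.trans hs) (hlt.trans (Nat.lt_succ_self _))⟩]
    rw [pderiv_integral hρ j (hg.differentiable l hs (Nat.lt_succ_self _)) (hg.bounded l hs)
      (hg.continuous (j :: l) List.suffix_rfl) (hg.bounded (j :: l) List.suffix_rfl) r _ hτ]
    simp only [List.length_cons, List.foldr_cons, pow_succ']

/-- Derivatives of a convolution may be computed on either factor. -/
theorem integral_mderiv_eq {d : ℕ} {α : Fin d → ℕ} {K f : E d → ℝ} (hK : Integrable K)
    (hf : Integrable f) (hKc : DerivChain (directions α) K) (hfc : DerivChain (directions α) f)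
    {h : ℝ} (hh : 0 < h) (x : E d) :
    h ^ d * ∫ z, mderiv α K z * f (x - h • z) =
      h ^ (d + mlen α) * ∫ z, K z * mderiv α f (x - h • z) := by
  -- The convolution of f with the rescaled K is differentiated twice over: in `e1` every derivative
  -- falls on K and costs a factor 1/h, in `e2` every derivative falls on f.
  have e1 := foldr_pderiv_integral hf hKc h⁻¹ (τ := fun y => -(h⁻¹ • y)) (by fun_prop)
  have e2 := foldr_pderiv_integral (hK.const_mul (h ^ d)) hfc 1 (τ := fun z => -(h • z))
    (by fun_prop)
  have hsub : ∀ (G : E d → ℝ) (x : E d), ∫ y, f y * G (h⁻¹ • x + -(h⁻¹ • y)) =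
      h ^ d * ∫ z, G z * f (x - h • z) := by
    intro G x
    rw [integral_comp_sub_smul _ x hh]
    congr 2
    refine funext fun z => ?_
    rw [← sub_eq_add_neg, ← smul_sub, sub_sub_cancel, smul_smul, inv_mul_cancel₀ hh.ne', one_smul,
      mul_comm]
  have e3 : (fun x => ∫ y, f y * K (h⁻¹ • x + -(h⁻¹ • y))) =
      fun x => ∫ z, h ^ d * K z * f ((1 : ℝ) • x + -(h • z)) := by
    ext x
    rw [hsub, ← integral_const_mul]
    simp only [one_smul, ← sub_eq_add_neg, mul_assoc]
  rw [e3, e2] at e1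
  have e4 := congrFun e1 x
  simp only [length_directions, ← mderiv_eq_foldr] at e4
  rw [hsub, one_pow, one_mul] at e4
  simp only [one_smul, ← sub_eq_add_neg, mul_assoc] at e4
  rw [integral_const_mul] at e4
  have hne : h ^ mlen α ≠ 0 := by positivity
  rw [pow_add, mul_comm (h ^ d) (h ^ mlen α), mul_assoc (h ^ mlen α), e4, ← mul_assoc, ← mul_pow,
    mul_inv_cancel₀ hh.ne', one_pow, one_mul]

end RecKernel

end

noncomputable section

namespace RecKernel

/-! ### The bias -/

/-- Induction on q by the mean value inequality: the remainder's derivative is the remainder of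
order q - 1 for the shifted family. The top derivative is only assumed bounded, and the constant M,
without the factorial, suffices. -/
theorem abs_sub_taylor_le {q : ℕ} {φ : ℕ → ℝ → ℝ} {M : ℝ}
    (hφ : ∀ s < q, ∀ t, HasDerivAt (φ s) (φ (s + 1) t) t) (hM : ∀ t, |φ q t| ≤ M) (t : ℝ) :
    |φ 0 t - ∑ s ∈ Finset.range q, φ s 0 / s.factorial * t ^ s| ≤ M * |t| ^ q := by
  induction q generalizing φ t with
  | zero => simpa using hM t
  | succ q ih =>
    have hder : ∀ u, HasDerivAt
        (fun t => φ 0 t - ∑ s ∈ Finset.range (q + 1), φ s 0 / s.factorial * t ^ s)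
        (φ 1 u - ∑ s ∈ Finset.range q, φ (s + 1) 0 / s.factorial * u ^ s) u := by
      intro u
      refine (hφ 0 (Nat.succ_pos _) u).sub ?_
      have h1 : HasDerivAt (fun t => ∑ s ∈ Finset.range (q + 1), φ s 0 / s.factorial * t ^ s)
          (∑ s ∈ Finset.range (q + 1), φ s 0 / s.factorial * (s * u ^ (s - 1))) u :=
        HasDerivAt.fun_sum fun s _ => (hasDerivAt_pow s u).const_mul _
      have e : ∑ s ∈ Finset.range q, φ (s + 1) 0 / s.factorial * u ^ s =
          ∑ s ∈ Finset.range (q + 1), φ s 0 / s.factorial * (s * u ^ (s - 1)) := by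
        rw [Finset.sum_range_succ']
        simp only [Nat.cast_zero, zero_mul, mul_zero, add_zero]
        refine Finset.sum_congr rfl fun s _ => ?_
        rw [Nat.factorial_succ]
        have : ((s.factorial : ℕ) : ℝ) ≠ 0 := by positivity
        push_cast
        field_simp
      rw [e]
      exact h1
    have hM0 : 0 ≤ M := (abs_nonneg _).trans (hM 0)
    have hb : ∀ u ∈ segment ℝ 0 t,
        ‖φ 1 u - ∑ s ∈ Finset.range q, φ (s + 1) 0 / s.factorial * u ^ s‖ ≤ M * |t| ^ q := by
      intro u hu
      have h1 := ih (φ := fun s => φ (s + 1)) (fun s hs => hφ (s + 1) (by omega)) hM u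
      refine h1.trans (mul_le_mul_of_nonneg_left (pow_le_pow_left₀ (abs_nonneg _) ?_ _) hM0)
      rw [segment_eq_image] at hu
      obtain ⟨r, hr, rfl⟩ := hu
      simp only [smul_eq_mul, mul_zero, zero_add, abs_mul, abs_of_nonneg hr.1]
      exact mul_le_of_le_one_left (abs_nonneg _) hr.2
    have := (convex_segment (0 : ℝ) t).norm_image_sub_le_of_norm_hasDerivWithin_le
      (fun u _ => (hder u).hasDerivWithinAt) hb (left_mem_segment ℝ 0 t) (right_mem_segment ℝ 0 t)
    rw [Finset.sum_range_succ' (fun s => φ s 0 / s.factorial * (0 : ℝ) ^ s)] at this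
    simp only [pow_succ, mul_zero, Finset.sum_const_zero, Real.norm_eq_abs] at this
    simpa [mul_assoc, pow_succ] using this

/-- The Taylor polynomial of degree q - 1, minus its constant term, integrates to zero against k;
only the remainder is left. -/
theorem abs_integral_mul_sub_le {q : ℕ} (hq : 1 ≤ q) {φ : ℕ → ℝ → ℝ} {M : ℝ}
    (hφ : ∀ s < q, ∀ t, HasDerivAt (φ s) (φ (s + 1) t) t) (hM : ∀ t, |φ q t| ≤ M)
    {k : ℝ → ℝ} (hk : Integrable k) (hkq : Integrable fun t => |t ^ q * k t|)
    (hmom : ∀ s : ℕ, 1 ≤ s → s ≤ q - 1 → ∫ t, t ^ s * k t = 0) :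
    |∫ t, k t * (φ 0 t - φ 0 0)| ≤ M * ∫ t, |t ^ q * k t| := by
  have hint : ∀ s ≤ q, Integrable fun t => t ^ s * k t := by
    intro s hs
    refine (hk.abs.add hkq).mono'
      ((continuous_pow s).aestronglyMeasurable.mul hk.aestronglyMeasurable)
      (ae_of_all _ fun t => ?_)
    simp only [Pi.add_apply, Real.norm_eq_abs, abs_mul, abs_pow]
    -- The intermediate moments exist because k and t^q k are both integrable.
    have : |t| ^ s ≤ 1 + |t| ^ q := by
      rcases le_total |t| 1 with h | h
      · have := pow_le_one₀ (n := s) (abs_nonneg t) h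
        have := pow_nonneg (abs_nonneg t) q
        linarith
      · have := pow_le_pow_right₀ h hs
        linarith
    nlinarith [abs_nonneg (k t)]
  set r : ℝ → ℝ := fun t => φ 0 t - ∑ s ∈ Finset.range q, φ s 0 / s.factorial * t ^ s
  have hr : ∀ t, |r t| ≤ M * |t| ^ q := abs_sub_taylor_le hφ hM
  have hφc : Continuous (φ 0) :=
    continuous_iff_continuousAt.2 fun t => (hφ 0 (by omega) t).continuousAt
  have hkr : ∀ t, ‖k t * r t‖ ≤ M * |t ^ q * k t| := fun t => by
    rw [Real.norm_eq_abs, abs_mul, abs_mul, abs_pow]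
    nlinarith [hr t, abs_nonneg (k t)]
  have hrc : Continuous r := by fun_prop
  have hkri : Integrable fun t => k t * r t :=
    (hkq.const_mul M).mono' (hk.aestronglyMeasurable.mul hrc.aestronglyMeasurable)
      (ae_of_all _ hkr)
  obtain ⟨p, rfl⟩ : ∃ p, q = p + 1 := ⟨q - 1, by omega⟩
  have hsplit : ∀ t, k t * (φ 0 t - φ 0 0) = k t * r t +
      ∑ s ∈ Finset.range p, φ (s + 1) 0 / (s + 1).factorial * (t ^ (s + 1) * k t) := by
    intro t
    simp only [r]
    rw [Finset.sum_range_succ']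
    have : ∑ s ∈ Finset.range p, φ (s + 1) 0 / (s + 1).factorial * (t ^ (s + 1) * k t) =
      k t * ∑ s ∈ Finset.range p, φ (s + 1) 0 / (s + 1).factorial * t ^ (s + 1) := by
      rw [Finset.mul_sum]
      exact Finset.sum_congr rfl fun s _ => by ring
    rw [this]
    simp
    ring
  have hsum : Integrable fun t =>
      ∑ s ∈ Finset.range p, φ (s + 1) 0 / (s + 1).factorial * (t ^ (s + 1) * k t) :=
    integrable_finsetSum _ fun s hs =>
      (hint (s + 1) (by have := Finset.mem_range.1 hs; omega)).const_mul _
  simp_rw [hsplit]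
  rw [integral_add hkri hsum, integral_finsetSum _ fun s hs =>
      (hint (s + 1) (by have := Finset.mem_range.1 hs; omega)).const_mul _]
  have hz : ∑ s ∈ Finset.range p,
      ∫ t, φ (s + 1) 0 / (s + 1).factorial * (t ^ (s + 1) * k t) = 0 :=
    Finset.sum_eq_zero fun s hs => by
      rw [integral_const_mul, hmom (s + 1) (by omega)
        (by have := Finset.mem_range.1 hs; omega), mul_zero]
  rw [hz, add_zero, ← integral_const_mul]
  exact norm_integral_le_of_norm_le (hkq.const_mul M) (ae_of_all _ hkr)

theorem hasDerivAt_iteratedFDeriv_line {d q : ℕ} {g : E d → ℝ} (hg : TimesDiff q g) {s : ℕ}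
    (hs : s < q) (w u : E d) (t : ℝ) :
    HasDerivAt (fun t : ℝ => iteratedFDeriv ℝ s g (w + t • u) fun _ => u)
      (iteratedFDeriv ℝ (s + 1) g (w + t • u) fun _ => u) t := by
  have h1 : HasDerivAt (fun t : ℝ => w + t • u) u t := by
    have : HasDerivAt (fun t : ℝ => t • u) ((1 : ℝ) • u) t := (hasDerivAt_id t).smul_const u
    rw [one_smul] at this
    exact this.const_add w
  have h2 := ((ContinuousMultilinearMap.apply ℝ (fun _ : Fin s => E d) ℝ
    fun _ => u).hasFDerivAt.comp _ (hg s hs (w + t • u)).hasFDerivAt).comp_hasDerivAt t h1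
  rw [iteratedFDeriv_succ_apply_left]
  exact h2

/-- The vector `z` with its coordinates of index at least `k` replaced by `0`. -/
def truncCoord {d : ℕ} (k : ℕ) (z : E d) : E d :=
  WithLp.toLp 2 fun i => if (i : ℕ) < k then z i else 0

theorem continuous_truncCoord {d : ℕ} (k : ℕ) : Continuous (truncCoord (d := d) k) := by
  refine (PiLp.continuous_toLp 2 _).comp (continuous_pi fun i => ?_)
  split_ifs <;> fun_prop

theorem truncCoord_succ {d : ℕ} (j : Fin d) (z : E d) :
    truncCoord (j + 1) z = truncCoord j z + z j • EuclideanSpace.single j 1 := by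
  ext i
  by_cases hij : i = j
  · subst hij; simp [truncCoord]
  · have h2 : i ≤ j ↔ i < j := ⟨fun h => lt_of_le_of_ne h hij, le_of_lt⟩
    simp [truncCoord, h2, hij]

/-- Only the j-th coordinate changes between the two arguments of g. By Fubini the one-dimensional
bound applies on almost every line parallel to the j-th axis, to g along the vector -h e_j, whose
norm gives the factor h^q. -/
theorem abs_integral_coord_le {d q : ℕ} {K g : E d → ℝ} {M C h : ℝ} (hq : 1 ≤ q)
    (hK : Integrable K) (hg : TimesDiff q g) (hM : ∀ x, ‖iteratedFDeriv ℝ q g x‖ ≤ M)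
    (hC : ∀ x, |g x| ≤ C) (hh : 0 < h) (j : Fin d)
    (hint : Integrable fun y : E d => |(y j) ^ q * K y|)
    (hmom : ∀ s : ℕ, 1 ≤ s → s ≤ q - 1 →
      ∀ᵐ y : E d, ∫ t : ℝ, t ^ s * K (setCoord y j t) = 0) (x : E d) :
    |∫ z, K z * (g (x - h • truncCoord (j + 1) z) - g (x - h • truncCoord j z))| ≤
      M * h ^ q * ∫ z, |(z j) ^ q * K z| := by
  obtain ⟨m, rfl⟩ : ∃ m, d = m + 1 := ⟨d - 1, by have := j.pos; omega⟩
  have hgc : Continuous g := by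
    have := (hg 0 (by omega)).continuous
    have h2 : g = fun x => iteratedFDeriv ℝ 0 g x 0 := by ext x; simp
    rw [h2]
    exact (ContinuousMultilinearMap.apply ℝ (fun _ : Fin 0 => E (m + 1)) ℝ 0).continuous.comp this
  set e : E (m + 1) ≃ᵐ ℝ × (Fin m → ℝ) :=
    (MeasurableEquiv.toLp 2 (Fin (m + 1) → ℝ)).symm.trans
      (MeasurableEquiv.piFinSuccAbove (fun _ => ℝ) j)
  have he : MeasurePreserving e.symm (volume.prod volume) volume :=
    ((EuclideanSpace.volume_preserving_symm_measurableEquiv_toLp (Fin (m + 1))).trans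
      (volume_preserving_piFinSuccAbove (fun _ => ℝ) j)).symm
  have hes : ∀ p, e.symm p = WithLp.toLp 2 (j.insertNth p.1 p.2) := fun p => rfl
  have hset : ∀ p t, setCoord (e.symm p) j t = e.symm (t, p.2) := by
    intro p t
    rw [hes, hes, setCoord]
    congr 1
    exact Fin.update_insertNth (α := fun _ => ℝ) j p.1 t p.2
  have hcoord : ∀ p, (e.symm p) j = p.1 := fun p => by
    rw [hes]; exact Fin.insertNth_apply_same (α := fun _ => ℝ) j p.1 p.2
  have htr : ∀ p, truncCoord j (e.symm p) = truncCoord j (e.symm (0, p.2)) := by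
    intro p
    ext i
    simp only [truncCoord]
    split_ifs with hi
    · have hij : i ≠ j := fun h => by subst h; exact lt_irrefl _ hi
      rw [hes, hes]
      obtain ⟨i', rfl⟩ := Fin.exists_succAbove_eq hij
      simp
    · rfl
  set F : E (m + 1) → ℝ := fun z =>
    K z * (g (x - h • truncCoord (j + 1) z) - g (x - h • truncCoord j z)) with hF
  have hFi : Integrable F := by
    refine hK.mul_bdd (c := C + C) (Continuous.aestronglyMeasurable ?_) (ae_of_all _ fun z => ?_)
    · have h1 := continuous_truncCoord (d := m + 1) (j + 1)
      have h2 := continuous_truncCoord (d := m + 1) j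
      fun_prop
    · exact (abs_sub _ _).trans (add_le_add (hC _) (hC _))
  have hFe : Integrable (F ∘ e.symm) (volume.prod volume) := he.integrable_comp_of_integrable hFi
  have hKe : Integrable (K ∘ e.symm) (volume.prod volume) := he.integrable_comp_of_integrable hK
  have hQe : Integrable ((fun y : E (m + 1) => |(y j) ^ q * K y|) ∘ e.symm)
      (volume.prod volume) := he.integrable_comp_of_integrable hint
  have i1 : ∫ z, F z = ∫ y, ∫ t, F (e.symm (t, y)) := by
    rw [← he.integral_comp e.symm.measurableEmbedding]
    exact integral_prod_symm _ hFe
  have i2 : ∫ z : E (m + 1), |(z j) ^ q * K z| = ∫ y, ∫ t, |t ^ q * K (e.symm (t, y))| := by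
    rw [← he.integral_comp e.symm.measurableEmbedding]
    refine (integral_prod_symm _ hQe).trans ?_
    simp only [Function.comp, hcoord]
  -- The moment condition holds for almost every y in ℝ^d but does not involve y_j. By Fubini it
  -- holds, for some value of y_j, for almost every choice of the other coordinates.
  have hmom' : ∀ s : ℕ, 1 ≤ s → s ≤ q - 1 →
      ∀ᵐ y : Fin m → ℝ, ∫ t : ℝ, t ^ s * K (e.symm (t, y)) = 0 := by
    intro s h1 h2
    have h3 := he.quasiMeasurePreserving.ae (hmom s h1 h2)
    simp only [hset] at h3
    obtain ⟨t, ht⟩ := (Measure.ae_ae_of_ae_prod h3).exists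
    exact ht
  have hmom'' : ∀ᵐ y : Fin m → ℝ, ∀ s : ℕ, 1 ≤ s → s ≤ q - 1 →
      ∫ t : ℝ, t ^ s * K (e.symm (t, y)) = 0 := by
    rw [ae_all_iff]; intro s
    by_cases h1 : 1 ≤ s ∧ s ≤ q - 1
    · filter_upwards [hmom' s h1.1 h1.2] with y hy _ _ using hy
    · exact ae_of_all _ fun y h2 h3 => absurd ⟨h2, h3⟩ h1
  rw [i1, i2, ← integral_const_mul, ← Real.norm_eq_abs]
  have hQi := hQe.swap.integral_prod_left
  refine norm_integral_le_of_norm_le (Integrable.const_mul ?_ _) ?_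
  · simpa only [Function.comp, Prod.swap, hcoord] using hQi
  · filter_upwards [hmom'', hKe.prod_left_ae, hQe.prod_left_ae] with y h1 h2 h3
    set w := x - h • truncCoord j (e.symm (0, y))
    set u : E (m + 1) := -h • EuclideanSpace.single j 1
    have hu : ‖u‖ = h := by simp [u, norm_smul, abs_of_pos hh]
    have hFt : ∀ t, F (e.symm (t, y)) = K (e.symm (t, y)) *
        (iteratedFDeriv ℝ 0 g (w + t • u) (fun _ => u) -
          iteratedFDeriv ℝ 0 g (w + (0 : ℝ) • u) (fun _ => u)) := by
      intro t
      rw [hF]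
      simp only [iteratedFDeriv_zero_apply, truncCoord_succ, hcoord, htr (t, y), zero_smul,
        add_zero]
      congr 3
      simp only [w, u]
      rw [smul_add, smul_smul, neg_smul, smul_neg, smul_smul, mul_comm h t]
      abel
    simp_rw [hFt]
    simp only [Function.comp, hcoord] at h3
    refine abs_integral_mul_sub_le hq
      (φ := fun s t => iteratedFDeriv ℝ s g (w + t • u) fun _ => u)
      (fun s hs t => hasDerivAt_iteratedFDeriv_line hg hs w u t) (fun t => ?_) h2 h3 h1
    refine ((iteratedFDeriv ℝ q g (w + t • u)).le_opNorm _).trans ?_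
    rw [Finset.prod_const, Finset.card_univ, Fintype.card_fin, hu]
    exact mul_le_mul_of_nonneg_right (hM _) (by positivity)

/-- Telescoping over coordinates: z is switched on one coordinate at a time, from `truncCoord` 0,
where the integral is g x because K has integral one, to `truncCoord` d, which is z. -/
theorem abs_integral_mul_comp_sub_le {d q : ℕ} {K g : E d → ℝ} {M C : ℝ} (hq : 1 ≤ q)
    (hK : Integrable K) (hK1 : ∫ z, K z = 1) (hg : TimesDiff q g)
    (hM : ∀ x, ‖iteratedFDeriv ℝ q g x‖ ≤ M) (hC : ∀ x, |g x| ≤ C)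
    (hint : ∀ j, Integrable fun y : E d => |(y j) ^ q * K y|)
    (hmom : ∀ s : ℕ, 1 ≤ s → s ≤ q - 1 → ∀ j : Fin d,
      ∀ᵐ y : E d, ∫ t : ℝ, t ^ s * K (setCoord y j t) = 0) {h : ℝ} (hh : 0 < h) (x : E d) :
    |(∫ z, K z * g (x - h • z)) - g x| ≤
      (M * ∑ j, ∫ z, |(z j) ^ q * K z|) * h ^ q := by
  have hgc : Continuous g := by
    have := (hg 0 (by omega)).continuous
    have h2 : g = fun x => iteratedFDeriv ℝ 0 g x 0 := by ext x; simp
    rw [h2]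
    exact (ContinuousMultilinearMap.apply ℝ (fun _ : Fin 0 => E d) ℝ 0).continuous.comp this
  have hi : ∀ τ : E d → E d, Continuous τ → Integrable fun z => K z * g (τ z) := fun τ hτ =>
    integrable_mul_comp hK hgc ⟨C, hC⟩ hτ
  have htc : ∀ k, Continuous fun z : E d => x - h • truncCoord k z := fun k => by
    have := continuous_truncCoord (d := d) k
    fun_prop
  have hij : ∀ j : Fin d, ∫ z, K z * (g (x - h • truncCoord (j + 1) z) -
      g (x - h • truncCoord j z)) = (∫ z, K z * g (x - h • truncCoord (j + 1) z)) -
        ∫ z, K z * g (x - h • truncCoord j z) := fun j => by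
    rw [← integral_sub (hi _ (htc _)) (hi _ (htc _))]
    simp only [mul_sub]
  have hd : ∀ z : E d, truncCoord d z = z := fun z => by
    ext i; simp [truncCoord]
  have h0 : ∀ z : E d, truncCoord 0 z = 0 := fun z => by
    ext i; simp [truncCoord]
  have htel : (∫ z, K z * g (x - h • z)) - g x = ∑ j : Fin d,
      ∫ z, K z * (g (x - h • truncCoord (j + 1) z) - g (x - h • truncCoord j z)) := by
    simp_rw [hij]
    rw [Fin.sum_univ_eq_sum_range (fun j => (∫ z, K z * g (x - h • truncCoord (j + 1) z)) -
      ∫ z, K z * g (x - h • truncCoord j z)) d, Finset.sum_range_sub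
      (fun k => ∫ z, K z * g (x - h • truncCoord k z))]
    simp only [hd, h0, smul_zero, sub_zero]
    rw [integral_mul_const, hK1, one_mul]
  rw [htel]
  refine (Finset.abs_sum_le_sum_abs _ _).trans ?_
  rw [Finset.mul_sum, Finset.sum_mul]
  refine Finset.sum_le_sum fun j _ => ?_
  refine (abs_integral_coord_le hq hK hg hM hC hh j (hint j)
    (fun s h1 h2 => hmom s h1 h2 j) x).trans_eq ?_
  ring

end RecKernel

end

/-! ### Consequences of the hypotheses: regularity, scales, negligible bias -/

noncomputable section

namespace RecKernel

theorem mderiv_of_mlen_eq_zero {d : ℕ} {α : Fin d → ℕ} (hα : mlen α = 0) (g : E d → ℝ) :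
    mderiv α g = g := by
  rw [mderiv_eq_foldr, List.length_eq_zero_iff.1 ((length_directions α).trans hα)]
  rfl

theorem TimesDiff.continuous {d q : ℕ} {g : E d → ℝ} (hg : TimesDiff q g) (hq : 1 ≤ q) :
    Continuous g := by
  simpa using (differentiable_foldr_pderiv [] (g := g)
    fun j hj => hg j (hj.trans_le hq)).continuous

namespace UniformHyp

variable {d : ℕ} {Ω : Type*} [MeasurableSpace Ω] {μ : Measure Ω}
  {X : ℕ → Ω → E d} {f K : E d → ℝ} {α : Fin d → ℕ} {a : ℝ} {h v : ℕ → ℝ}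

theorem continuous_mderiv_kernel (hyp : UniformHyp μ X f K α a h v) :
    Continuous (mderiv α K) := by
  obtain ⟨C, r, hr, hC⟩ := hyp.kernelRegular.holder
  exact hC.continuous hr

theorem exists_niceKernel (hyp : UniformHyp μ X f K α a h v) :
    ∃ R, NiceKernel (mderiv α K) R := by
  have hb : Bdd (mderiv α K) ∧ Integrable (mderiv α K) := by
    rcases hyp.regime with ⟨h0, -⟩ | ⟨-, -, hK, -⟩
    · rw [mderiv_of_mlen_eq_zero h0]
      exact ⟨hyp.kernel.bounded, hyp.kernel.integrable⟩
    · exact ⟨hK.bounded, hK.integrable⟩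
  obtain ⟨⟨R, hR⟩, hi⟩ := hb
  exact ⟨R, hyp.continuous_mderiv_kernel, hR, hi⟩

theorem continuous_mderiv_density (hyp : UniformHyp μ X f K α a h v) :
    Continuous (mderiv α f) := by
  obtain ⟨q, hq⟩ := hyp.bias
  exact hq.diff.continuous (one_le_two.trans hq.two_le)

theorem bdd_mderiv_density (hyp : UniformHyp μ X f K α a h v) : Bdd (mderiv α f) := by
  obtain ⟨η, hη, C, hC⟩ := hyp.tail.density
  obtain ⟨D, hD⟩ := (isCompact_closedBall (0 : E d) 1).exists_bound_of_continuousOn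
    hyp.continuous_mderiv_density.continuousOn
  refine ⟨max C D, fun x => ?_⟩
  rcases le_total ‖x‖ 1 with hx | hx
  · exact (hD x (by simpa using hx)).trans (le_max_right _ _)
  · refine le_trans ?_ ((hC x).trans (le_max_left _ _))
    rw [abs_mul, abs_of_nonneg (Real.rpow_nonneg (norm_nonneg x) η)]
    exact le_mul_of_one_le_left (abs_nonneg _) (Real.one_le_rpow hx hη.le)

theorem derivChain_kernel (hyp : UniformHyp μ X f K α a h v) :
    DerivChain (directions α) K := by
  obtain ⟨R, hR⟩ := hyp.exists_niceKernel
  have hd : TimesDiff (mlen α) K ∧ ∀ j < mlen α, ∃ C : ℝ, ∀ x, ‖iteratedFDeriv ℝ j K x‖ ≤ C := by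
    rcases hyp.regime with ⟨h0, -⟩ | ⟨-, -, hK, -⟩
    · rw [h0]
      exact ⟨fun j hj => absurd hj (Nat.not_lt_zero _), fun j hj => absurd hj (Nat.not_lt_zero _)⟩
    · refine ⟨hK.diff, fun j hj => ?_⟩
      have h1 := (hK.vanishes j hj).eventually_le_const zero_lt_one
      obtain ⟨s, hs, hs1⟩ := mem_cocompact.1 h1
      obtain ⟨D, hD⟩ := hs.exists_bound_of_continuousOn (hK.diff j hj).continuous.continuousOn
      refine ⟨max 1 D, fun x => ?_⟩
      by_cases hx : x ∈ s
      · exact (hD x hx).trans (le_max_right _ _)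
      · exact (hs1 hx : ‖iteratedFDeriv ℝ j K x‖ ≤ 1).trans (le_max_left _ _)
  exact derivChain_directions hd.1 hd.2 hyp.continuous_mderiv_kernel ⟨R, hR.abs_le⟩

theorem derivChain_density (hyp : UniformHyp μ X f K α a h v) :
    DerivChain (directions α) f := by
  have hd : TimesDiff (mlen α) f ∧ ∀ j < mlen α, ∃ C : ℝ, ∀ x, ‖iteratedFDeriv ℝ j f x‖ ≤ C := by
    rcases hyp.regime with ⟨h0, -⟩ | ⟨-, -, -, hf⟩
    · rw [h0]
      exact ⟨fun j hj => absurd hj (Nat.not_lt_zero _), fun j hj => absurd hj (Nat.not_lt_zero _)⟩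
    · exact ⟨hf.diff, hf.bounded⟩
  exact derivChain_directions hd.1 hd.2 hyp.continuous_mderiv_density hyp.bdd_mderiv_density

/-- All regimes are covered by one parameter: ℓ = 1 is the large deviations case |α| = 0, v_n = 1;
in every other case h_n^{|α|} / v_n → 0 and the limit is Gaussian. -/
theorem exists_scaleHyp (hyp : UniformHyp μ X f K α a h v) : ∃ ℓ, ScaleHyp α a h v ℓ ∧
    ((ℓ = 1 ∧ mlen α = 0 ∧ IsOne v ∧ PowerBandwidth d a h) ∨
      (ℓ = 0 ∧ ¬(mlen α = 0 ∧ IsOne v) ∧ KernelDiff α K)) := by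
  rcases hyp.regime with ⟨h0, h1, hP⟩ | ⟨hcase, hR, hK, -⟩
  · obtain ⟨ha, had, c, hc, hh⟩ := hP
    refine ⟨1, ⟨?_, ?_, ha, ?_, hyp.v_pos, ?_⟩, Or.inl ⟨rfl, h0, h1, ha, had, c, hc, hh⟩⟩
    · rintro rfl
      -- For d = 0 the bound 1/d is 0 by convention, which contradicts 0 < a.
      simp only [Nat.cast_zero, div_zero] at had
      linarith
    · exact RegularlyVarying.regVarSeq (G := fun x => x ^ (-a) * c)
        ⟨fun _ => c, slowlyVarying_const hc, fun x _ => rfl⟩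
        fun n hn => by rw [hh n hn, mul_comm]
    · have hd : (0 : ℝ) < d := by
        rcases Nat.eq_zero_or_pos d with rfl | hd
        · simp only [Nat.cast_zero, div_zero] at had
          linarith
        · exact_mod_cast hd
      rw [h0, mul_zero, add_zero]
      rwa [lt_div_iff₀ hd] at had
    · refine tendsto_const_nhds.congr' ?_
      filter_upwards [eventually_ge_atTop 1] with n hn
      rw [h0, pow_zero, h1 n hn, div_one]
  · obtain ⟨ha, had, η, -, hη, hh⟩ := hR
    have hreg := hη.regVarSeq hh
    have hz := hreg.tendsto_zero ha
    have hx : (0 : ℝ) < (d : ℝ) + 2 * (mlen α : ℝ) := by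
      by_contra! hcon
      have := div_nonpos_of_nonneg_of_nonpos zero_le_one hcon
      linarith
    refine ⟨0, ⟨?_, hreg, ha, ?_, hyp.v_pos, ?_⟩, Or.inr ⟨rfl, ?_, hK⟩⟩
    · rintro rfl
      simp [mlen] at hx
    · push_cast
      rwa [lt_div_iff₀ hx] at had
    · rcases hcase with ⟨hm, h1⟩ | hM
      · have := hz.pow (mlen α)
        rw [zero_pow (by omega)] at this
        refine this.congr' ?_
        filter_upwards [eventually_ge_atTop 1] with n hn
        rw [h1 n hn, div_one]
      · exact (hz.pow (mlen α)).div_atTop hM.tendsto_atTop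
    -- A moderate scale tends to infinity, so it is never the constant 1; hence `gU` takes its
    -- Gaussian branch.
    · rintro ⟨hm, h1⟩
      rcases hcase with ⟨hm', -⟩ | hM
      · omega
      · obtain ⟨n, hn, hn1⟩ := ((hM.tendsto_atTop.eventually_gt_atTop 1).and
          (eventually_ge_atTop 1)).exists
        rw [h1 n hn1] at hn
        exact lt_irrefl _ hn

/-- The bias is negligible, uniformly on `ℝ^d`. -/
theorem eventually_bias_le [IsProbabilityMeasure μ] (hyp : UniformHyp μ X f K α a h v) {ε : ℝ} (hε : 0 < ε) :
    ∀ᶠ n in atTop, ∀ x, |v n * (∫ ω, estimator α K h X n ω x ∂μ - mderiv α f x)| ≤ ε := by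
  obtain ⟨q, hq⟩ := hyp.bias
  obtain ⟨ℓ, H, -⟩ := hyp.exists_scaleHyp
  obtain ⟨R, hκ⟩ := hyp.exists_niceKernel
  obtain ⟨M, hM⟩ := hq.bounded
  obtain ⟨C, hC⟩ := hyp.bdd_mderiv_density
  set D := M * ∑ j, ∫ z, |(z j) ^ q * K z|
  have hb : ∀ i, 1 ≤ i → ∀ x, |(1 / h i ^ (d + mlen α)) *
      ∫ ω, mderiv α K ((h i)⁻¹ • (x - X i ω)) ∂μ - mderiv α f x| ≤ D * h i ^ q := by
    intro i hi x
    have hhi := H.reg.pos i hi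
    -- The derivatives pass from K to f, the powers of h_i cancel, and the mean becomes an average
    -- of ∂^α f against K.
    rw [hyp.sample.integral_comp_scaled hi hκ.continuous.measurable x hhi,
      integral_mderiv_eq hyp.kernel.integrable hyp.sample.integrable hyp.derivChain_kernel
        hyp.derivChain_density hhi, one_div, inv_mul_cancel_left₀ (by positivity)]
    exact abs_integral_mul_comp_sub_le (one_le_two.trans hq.two_le) hyp.kernel.integrable
      hyp.kernel.integral_eq_one hq.diff hM hC hq.integrable hq.moments hhi x
  have hlim := hq.bandwidth.const_mul D
  rw [mul_zero] at hlim
  filter_upwards [hlim.eventually_le_const hε, eventually_ge_atTop 1] with n hn hn1 x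
  refine le_trans ?_ hn
  have hn0 : (0 : ℝ) < n := by positivity
  have hv := hyp.v_pos n hn1
  have e : ∫ ω, estimator α K h X n ω x ∂μ - mderiv α f x = (1 / (n : ℝ)) *
      ∑ i ∈ Finset.Icc 1 n, ((1 / h i ^ (d + mlen α)) *
        ∫ ω, mderiv α K ((h i)⁻¹ • (x - X i ω)) ∂μ - mderiv α f x) := by
    rw [integral_estimator hyp.sample hκ, Finset.sum_sub_distrib]
    simp
    field_simp
  rw [e, abs_mul, abs_mul, abs_of_pos hv, abs_of_pos (by positivity)]
  have h2 := (Finset.abs_sum_le_sum_abs _ _).trans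
    (Finset.sum_le_sum fun i (hi : i ∈ Finset.Icc 1 n) => hb i (Finset.mem_Icc.1 hi).1 x)
  rw [← Finset.mul_sum] at h2
  calc _ ≤ v n * (1 / n * (D * ∑ i ∈ Finset.Icc 1 n, h i ^ q)) := by gcongr
    _ = _ := by ring

end UniformHyp

end RecKernel

end

noncomputable section

namespace RecKernel

/-! ### Finite nets -/

/-- The space is cut into cubes of side ρ/d, and one point of U is chosen in each cube that meets U.
The net must lie in U, since f is bounded by its supremum over U only there. -/
theorem exists_finset_net {d : ℕ} (hd : d ≠ 0) (U : Set (E d)) {W ρ : ℝ} (hρ : 0 < ρ)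
    (hW : ρ ≤ W) :
    ∃ T : Finset (E d), (∀ t ∈ T, t ∈ U) ∧ (∀ x ∈ U, ‖x‖ ≤ W → ∃ t ∈ T, ‖x - t‖ ≤ ρ) ∧
      (T.card : ℝ) ≤ (5 * d * (W / ρ)) ^ d := by
  classical
  have hd0 : (0 : ℝ) < d := by positivity
  set c : E d → Fin d → ℤ := fun x i => ⌊x i * (d / ρ)⌋
  set N : ℤ := ⌈W * (d / ρ)⌉
  set B : Finset (Fin d → ℤ) := Fintype.piFinset fun _ => Finset.Icc (-N) N
  set B' := B.filter fun k => ∃ x ∈ U, c x = k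
  have hB' : ∀ k ∈ B', ∃ x ∈ U, c x = k := fun k hk => (Finset.mem_filter.1 hk).2
  choose! p hpU hpc using hB'
  -- With Y = W d / ρ ≥ 1 there are at most 2⌈Y⌉ + 1 ≤ 2Y + 3 ≤ 5Y cubes per coordinate.
  have hone : 1 ≤ W * (d / ρ) := by
    rw [mul_div_assoc', le_div_iff₀ hρ, one_mul]
    have : (1 : ℝ) ≤ d := by exact_mod_cast Nat.one_le_iff_ne_zero.2 hd
    nlinarith
  refine ⟨B'.image p, ?_, fun x hx hxW => ?_, ?_⟩
  · intro t ht
    obtain ⟨k, hk, rfl⟩ := Finset.mem_image.1 ht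
    exact hpU k hk
  · have hk : c x ∈ B' := by
      refine Finset.mem_filter.2 ⟨Fintype.mem_piFinset.2 fun i => ?_, x, hx, rfl⟩
      have h1 : |x i| ≤ W := by
        have := PiLp.norm_apply_le x i
        rw [Real.norm_eq_abs] at this
        exact this.trans hxW
      have h2 := abs_le.1 h1
      have hp : 0 < d / ρ := by positivity
      have h3 := Int.le_ceil (W * (d / ρ))
      rw [Finset.mem_Icc]
      constructor
      · rw [Int.le_floor]
        push_cast
        nlinarith
      · refine Int.floor_le_ceil _ |>.trans (Int.ceil_le_ceil ?_)
        exact mul_le_mul_of_nonneg_right h2.2 hp.le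
    refine ⟨p (c x), Finset.mem_image_of_mem _ hk, ?_⟩
    have hcc := hpc _ hk
    have hi : ∀ i, ‖(x - p (c x)) i‖ ≤ ρ / d := by
      intro i
      have h1 : ⌊x i * (d / ρ)⌋ = ⌊p (c x) i * (d / ρ)⌋ := (congrFun hcc i).symm
      have h2 := Int.abs_sub_lt_one_of_floor_eq_floor h1
      rw [← sub_mul, abs_mul, abs_of_pos (by positivity : (0 : ℝ) < d / ρ),
        ← lt_div_iff₀ (by positivity), one_div_div] at h2
      exact h2.le
    calc ‖x - p (c x)‖ = ‖∑ i, (x - p (c x)) i • EuclideanSpace.single i (1 : ℝ)‖ := by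
          congr 1
          ext j
          simp [Finset.sum_apply, Pi.single_apply]
      _ ≤ ∑ i : Fin d, ρ / d := by
          refine norm_sum_le_of_le _ fun i _ => ?_
          rw [norm_smul]
          simpa using hi i
      _ = ρ := by
          rw [Finset.sum_const, Finset.card_univ, Fintype.card_fin, nsmul_eq_mul]
          field_simp
  · have h1 : (B'.image p).card ≤ B.card :=
      Finset.card_image_le.trans (Finset.card_filter_le _ _)
    have h2 : (B.card : ℝ) = (2 * N + 1 : ℤ) ^ d := by
      have hN : 0 ≤ N := Int.ceil_nonneg (by linarith)
      rw [Fintype.card_piFinset, Finset.prod_const, Finset.card_univ, Fintype.card_fin,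
        Int.card_Icc]
      push_cast
      have : (((N + 1 - -N).toNat : ℕ) : ℝ) = 2 * N + 1 := by
        have h3 : (((N + 1 - -N).toNat : ℕ) : ℤ) = 2 * N + 1 := by omega
        exact_mod_cast h3
      rw [this]
    have h3 : ((B'.image p).card : ℝ) ≤ B.card := by exact_mod_cast h1
    refine h3.trans ?_
    rw [h2]
    have h4 := Int.ceil_lt_add_one (W * (d / ρ))
    have hN : 0 ≤ N := Int.ceil_nonneg (by linarith)
    have hN' : (0 : ℝ) ≤ N := by exact_mod_cast hN
    push_cast
    refine pow_le_pow_left₀ (by positivity) ?_ d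
    have h5 : 5 * (d : ℝ) * (W / ρ) = 5 * (W * (d / ρ)) := by ring
    rw [h5]
    linarith

namespace UniformHyp

variable {d : ℕ} {Ω : Type*} [MeasurableSpace Ω] {μ : Measure Ω}
  {X : ℕ → Ω → E d} {f K : E d → ℝ} {α : Fin d → ℕ} {a : ℝ} {h v : ℕ → ℝ} {ℓ : ℝ}

/-! ### Growth of the speed -/

theorem tendsto_log_inv_div_speed (hyp : UniformHyp μ X f K α a h v) :
    Tendsto (fun n => Real.log (1 / h n) / speed α h v n) atTop (𝓝 0) := by
  refine hyp.logScale.bandwidth.congr fun n => ?_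
  rw [speed, div_div_eq_mul_div, mul_comm]

theorem tendsto_log_scale_div_speed (hyp : UniformHyp μ X f K α a h v) :
    Tendsto (fun n => Real.log (v n) / speed α h v n) atTop (𝓝 0) := by
  refine hyp.logScale.scale.congr fun n => ?_
  rw [speed, div_div_eq_mul_div, mul_comm]

theorem tendsto_log_inv (H : ScaleHyp α a h v ℓ) :
    Tendsto (fun n => Real.log (1 / h n)) atTop atTop := by
  have h1 : Tendsto h atTop (𝓝[>] 0) := tendsto_nhdsWithin_iff.2
    ⟨H.reg.tendsto_zero H.a_pos, by
      filter_upwards [eventually_ge_atTop 1] with n hn using H.reg.pos n hn⟩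
  simp only [one_div]
  exact Real.tendsto_log_atTop.comp (tendsto_inv_nhdsGT_zero.comp h1)

/-- The speed eventually dominates log(1/h_n), which tends to infinity. -/
theorem tendsto_speed (hyp : UniformHyp μ X f K α a h v) (H : ScaleHyp α a h v ℓ) :
    Tendsto (speed α h v) atTop atTop := by
  refine tendsto_atTop_mono' _ ?_ (tendsto_log_inv H)
  filter_upwards [hyp.tendsto_log_inv_div_speed.eventually_le_const zero_lt_one,
    eventually_ge_atTop 1] with n hn hn1
  rwa [div_le_one (H.speed_pos hn1)] at hn

/-- As h_n ≤ C n^{-a/2}, log n is at most (2/a)(log(1/h_n) + log C), which is negligible against the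
speed. -/
theorem tendsto_log_nat_div_speed (hyp : UniformHyp μ X f K α a h v) (H : ScaleHyp α a h v ℓ) :
    Tendsto (fun n : ℕ => Real.log n / speed α h v n) atTop (𝓝 0) := by
  obtain ⟨C, hC, hb⟩ := H.reg.exists_le_rpow H.a_pos
  have ha := H.a_pos
  have h1 := (hyp.tendsto_log_inv_div_speed.add
    ((tendsto_const_nhds (x := Real.log C)).div_atTop (hyp.tendsto_speed H))).const_mul (2 / a)
  rw [add_zero, mul_zero] at h1
  refine squeeze_zero' ?_ ?_ h1
  · filter_upwards [eventually_ge_atTop 1] with n hn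
    exact div_nonneg (Real.log_nonneg (by exact_mod_cast hn)) (H.speed_pos hn).le
  · filter_upwards [eventually_ge_atTop 1] with n hn
    have hs := H.speed_pos hn
    have hn0 : (0 : ℝ) < n := by exact_mod_cast hn
    have h2 := Real.log_le_log (H.reg.pos n hn) (hb n hn)
    rw [Real.log_mul hC.ne' (by positivity), Real.log_rpow hn0] at h2
    rw [← add_div, ← mul_div_assoc]
    refine div_le_div_of_nonneg_right ?_ hs.le
    rw [one_div, Real.log_inv]
    rw [div_mul_eq_mul_div, le_div_iff₀ ha]
    linarith

theorem eventually_le_exp_of_log_div {u s : ℕ → ℝ} (hu : ∀ᶠ n in atTop, 0 < u n)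
    (hs : ∀ᶠ n in atTop, 0 < s n) (h : Tendsto (fun n => Real.log (u n) / s n) atTop (𝓝 0))
    {η : ℝ} (hη : 0 < η) : ∀ᶠ n in atTop, u n ≤ Real.exp (η * s n) := by
  filter_upwards [hu, hs, h.eventually_le_const hη] with n h1 h2 h3
  rw [← Real.log_le_iff_le_exp h1]
  rwa [div_le_iff₀ h2] at h3

theorem eventually_growth (hyp : UniformHyp μ X f K α a h v) (H : ScaleHyp α a h v ℓ)
    {η : ℝ} (hη : 0 < η) : ∀ᶠ n : ℕ in atTop, v n ≤ Real.exp (η * speed α h v n) ∧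
      (h n)⁻¹ ≤ Real.exp (η * speed α h v n) ∧ (n : ℝ) ≤ Real.exp (η * speed α h v n) := by
  have hs : ∀ᶠ n in atTop, 0 < speed α h v n := by
    filter_upwards [eventually_ge_atTop 1] with n hn using H.speed_pos hn
  have h2 := hyp.tendsto_log_inv_div_speed
  simp only [one_div] at h2
  refine (eventually_le_exp_of_log_div ?_ hs hyp.tendsto_log_scale_div_speed hη).and
    ((eventually_le_exp_of_log_div ?_ hs h2 hη).and
      (eventually_le_exp_of_log_div ?_ hs (hyp.tendsto_log_nat_div_speed H) hη))
  · filter_upwards [eventually_ge_atTop 1] with n hn using H.v_pos n hn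
  · filter_upwards [eventually_ge_atTop 1] with n hn using inv_pos.2 (H.reg.pos n hn)
  · filter_upwards [eventually_ge_atTop 1] with n hn
    exact_mod_cast hn

/-- A polynomial in `v_n` and `1 / h_n` is negligible with respect to `exp (-η speed)`. -/
theorem tendsto_growth_mul_exp (hyp : UniformHyp μ X f K α a h v) (H : ScaleHyp α a h v ℓ)
    {p η : ℝ} (hp : 0 ≤ p) (hη : 0 < η) :
    Tendsto (fun n => v n * ((h n)⁻¹) ^ p * Real.exp (-(η * speed α h v n))) atTop (𝓝 0) := by
  have hs := hyp.tendsto_speed H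
  have h1 : Tendsto (fun n => Real.exp (-(η / 2 * speed α h v n))) atTop (𝓝 0) :=
    Real.tendsto_exp_neg_atTop_nhds_zero.comp (hs.const_mul_atTop (half_pos hη))
  refine squeeze_zero' ?_ ?_ h1
  · filter_upwards [eventually_ge_atTop 1] with n hn
    have := H.v_pos n hn
    have := H.reg.pos n hn
    positivity
  · filter_upwards [hyp.eventually_growth H (η := η / (2 * (1 + p))) (by positivity),
      eventually_ge_atTop 1] with n ⟨g1, g2, _⟩ hn
    have h2 := H.v_pos n hn
    have h3 := inv_pos.2 (H.reg.pos n hn)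
    calc _ ≤ Real.exp (η / (2 * (1 + p)) * speed α h v n) *
          (Real.exp (η / (2 * (1 + p)) * speed α h v n)) ^ p *
          Real.exp (-(η * speed α h v n)) := by gcongr
      _ = _ := by
        rw [← Real.exp_mul, ← Real.exp_add, ← Real.exp_add]
        congr 1
        field_simp
        ring

end UniformHyp

end RecKernel

end

/-! ### Reduction of the supremum to a finite net -/

noncomputable section

namespace RecKernel

variable {d : ℕ} {Ω : Type*} [MeasurableSpace Ω] {μ : Measure Ω}
  {X : ℕ → Ω → E d} {f K : E d → ℝ} {α : Fin d → ℕ} {a : ℝ} {h v : ℕ → ℝ} {ℓ R : ℝ}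

theorem integrable_estimator [IsProbabilityMeasure μ] (hX : IIDWithDensity μ X f)
    (hκ : NiceKernel (mderiv α K) R) (n : ℕ) (x : E d) :
    Integrable (fun ω => estimator α K h X n ω x) μ :=
  (integrable_finsetSum _ fun _ hi =>
    (integrable_summand hX hκ (Finset.mem_Icc.1 hi).1 _ x).const_mul _).const_mul _

/-- An average of terms `h_i^{-k} u_i` with `|u_i| ≤ D`. -/
theorem abs_average_le {C₀ D : ℝ} (hpos : ∀ i, 1 ≤ i → 0 < h i) {n : ℕ}
    (hn : 1 ≤ n) (hC : ∀ i, 1 ≤ i → i ≤ n → h n / h i ≤ C₀) (k : ℕ) {u : ℕ → ℝ}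
    (hu : ∀ i, 1 ≤ i → i ≤ n → |u i| ≤ D) :
    |(1 / (n : ℝ)) * ∑ i ∈ Finset.Icc 1 n, (1 / h i ^ k) * u i| ≤
      (C₀ * (h n)⁻¹) ^ k * D := by
  have hn0 : (0 : ℝ) < n := by positivity
  have hhn := hpos n hn
  have hb : ∀ i ∈ Finset.Icc 1 n, |(1 / h i ^ k) * u i| ≤ (C₀ * (h n)⁻¹) ^ k * D := by
    intro i hi
    obtain ⟨hi1, hin⟩ := Finset.mem_Icc.1 hi
    have hhi := hpos i hi1
    have h1 : (h i)⁻¹ ≤ C₀ * (h n)⁻¹ := by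
      have := hC i hi1 hin
      rw [div_eq_mul_inv] at this
      rw [le_mul_inv_iff₀ hhn]
      linarith
    have h2 : 0 ≤ (h i)⁻¹ := by positivity
    rw [abs_mul, one_div, ← inv_pow, abs_of_nonneg (by positivity)]
    exact mul_le_mul (pow_le_pow_left₀ h2 h1 k) (hu i hi1 hin) (abs_nonneg _)
      (pow_nonneg (h2.trans h1) k)
  rw [abs_mul, abs_of_pos (by positivity)]
  calc _ ≤ 1 / (n : ℝ) * ∑ i ∈ Finset.Icc 1 n, (C₀ * (h n)⁻¹) ^ k * D := by
        gcongr
        exact (Finset.abs_sum_le_sum_abs _ _).trans (Finset.sum_le_sum hb)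
    _ = _ := by
      rw [Finset.sum_const, Nat.card_Icc, nsmul_eq_mul]
      simp
      field_simp

theorem abs_centered_sub_le [IsProbabilityMeasure μ] (hX : IIDWithDensity μ X f)
    (hκ : NiceKernel (mderiv α K) R) {n : ℕ} (hv : 0 ≤ v n) {x y : E d} {D : ℝ}
    (hD : ∀ ω, |estimator α K h X n ω x - estimator α K h X n ω y| ≤ D) (ω : Ω) :
    |centered μ X K α h v n x ω - centered μ X K α h v n y ω| ≤ v n * (2 * D) := by
  have h1 : |∫ ω, estimator α K h X n ω x ∂μ - ∫ ω, estimator α K h X n ω y ∂μ| ≤ D := by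
    rw [← integral_sub (integrable_estimator hX hκ n x) (integrable_estimator hX hκ n y),
      ← Real.norm_eq_abs]
    refine (norm_integral_le_of_norm_le_const (ae_of_all _ hD)).trans_eq ?_
    simp
  rw [centered, centered, ← mul_sub, abs_mul, abs_of_nonneg hv]
  refine mul_le_mul_of_nonneg_left ?_ hv
  rw [sub_sub_sub_comm]
  refine (abs_sub _ _).trans ?_
  linarith [hD ω]

namespace UniformHyp

/-- If κ is Hölder with exponent r, a displacement e^{-η s} changes the estimator by at most a
constant times v_n h_n^{-(d+|α|+r)} e^{-η r s}; the polynomial factor is subexponential in the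
speed. -/
theorem eventually_abs_centered_sub_le [IsProbabilityMeasure μ]
    (hyp : UniformHyp μ X f K α a h v) (H : ScaleHyp α a h v ℓ) {η ε : ℝ} (hη : 0 < η)
    (hε : 0 < ε) : ∀ᶠ n in atTop, ∀ x y : E d, ‖x - y‖ ≤ Real.exp (-(η * speed α h v n)) →
      ∀ ω, |centered μ X K α h v n x ω - centered μ X K α h v n y ω| ≤ ε := by
  obtain ⟨R, hκ⟩ := hyp.exists_niceKernel
  obtain ⟨C, r, hr, hC⟩ := hyp.kernelRegular.holder
  obtain ⟨C₀, hC₀, hCb⟩ := H.reg.exists_div_le H.a_pos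
  have hr0 : (0 : ℝ) < r := by exact_mod_cast hr
  have hlim := (hyp.tendsto_growth_mul_exp H (p := (d + mlen α : ℕ) + r) (by positivity)
    (mul_pos hη hr0)).const_mul (2 * C * C₀ ^ (d + mlen α) * C₀ ^ (r : ℝ))
  rw [mul_zero] at hlim
  filter_upwards [hlim.eventually_le_const hε, eventually_ge_atTop 1] with n hn hn1 x y hxy ω
  have hhn := H.reg.pos n hn1
  have hv := H.v_pos n hn1
  refine (abs_centered_sub_le hyp.sample hκ hv.le (D := (C₀ * (h n)⁻¹) ^ (d + mlen α) *
    (C * (C₀ * (h n)⁻¹ * Real.exp (-(η * speed α h v n))) ^ (r : ℝ))) (fun ω => ?_) ω).trans ?_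
  · rw [estimator, estimator, ← mul_sub, ← Finset.sum_sub_distrib]
    simp only [← mul_sub]
    refine abs_average_le H.reg.pos hn1 (fun i hi hin => hCb i n hi hin) _ fun i hi hin => ?_
    have hhi := H.reg.pos i hi
    have h1 := hC.dist_le ((h i)⁻¹ • (x - X i ω)) ((h i)⁻¹ • (y - X i ω))
    rw [Real.dist_eq] at h1
    refine h1.trans ?_
    gcongr
    rw [dist_eq_norm, ← smul_sub, sub_sub_sub_cancel_right, norm_smul, Real.norm_eq_abs,
      abs_of_pos (inv_pos.2 hhi)]
    have h2 : (h i)⁻¹ ≤ C₀ * (h n)⁻¹ := by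
      have := hCb i n hi hin
      rw [div_eq_mul_inv] at this
      rw [le_mul_inv_iff₀ hhn]
      linarith
    gcongr
  · refine le_trans (le_of_eq ?_) hn
    have h3 : ((h n)⁻¹) ^ (((d + mlen α : ℕ) : ℝ) + r) =
        ((h n)⁻¹) ^ (d + mlen α) * ((h n)⁻¹) ^ (r : ℝ) := by
      rw [Real.rpow_add (inv_pos.2 hhn), Real.rpow_natCast]
    have h4 : Real.exp (-(η * r * speed α h v n)) =
        Real.exp (-(η * speed α h v n)) ^ (r : ℝ) := by
      rw [← Real.exp_mul]; ring_nf
    rw [h3, h4, Real.mul_rpow (by positivity) (by positivity),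
      Real.mul_rpow (by positivity) (by positivity), mul_pow]
    ring

/-- With w = e^{η s}, observations of norm at most w/2 and ‖x‖ > w put every argument (x - X_i)/h_i
at norm at least w/(2B), where B bounds h. Power decay of ∂^α K and ∂^α f then gains negative powers
of w, which beat v_n and h_n^{-(d+|α|)}. -/
theorem eventually_abs_le_of_norm_gt (hyp : UniformHyp μ X f K α a h v)
    (H : ScaleHyp α a h v ℓ) {η ε : ℝ} (hη : 0 < η) (hε : 0 < ε) :
    ∀ᶠ n in atTop, ∀ ω, (∀ i, 1 ≤ i → i ≤ n → ‖X i ω‖ ≤ Real.exp (η * speed α h v n) / 2) →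
      ∀ x : E d, Real.exp (η * speed α h v n) < ‖x‖ →
        v n * |estimator α K h X n ω x - mderiv α f x| ≤ ε := by
  obtain ⟨γ, hγ, C, hC⟩ := hyp.kernelRegular.decay
  obtain ⟨ζ, hζ, C', hC'⟩ := hyp.tail.density
  obtain ⟨C₀, hC₀, hCb⟩ := H.reg.exists_div_le H.a_pos
  obtain ⟨B, hB⟩ := (H.reg.tendsto_zero H.a_pos).bddAbove_range
  have hB' : ∀ i, h i ≤ B := fun i => hB ⟨i, rfl⟩
  have hB0 : 0 < B := (H.reg.pos 1 le_rfl).trans_le (hB' 1)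
  have hC0 : 0 ≤ C := (abs_nonneg _).trans (hC 0)
  have hlim1 := (hyp.tendsto_growth_mul_exp H (p := (d + mlen α : ℕ)) (by positivity)
    (mul_pos hη hγ)).const_mul (C₀ ^ (d + mlen α) * (C * (2 * B) ^ γ))
  have hlim2 := (hyp.tendsto_growth_mul_exp H (p := 0) le_rfl (mul_pos hη hζ)).const_mul C'
  rw [mul_zero] at hlim1 hlim2
  filter_upwards [hlim1.eventually_le_const (half_pos hε),
    hlim2.eventually_le_const (half_pos hε), eventually_ge_atTop 1] with n h1 h2 hn ω hω x hx
  have hhn := H.reg.pos n hn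
  have hv := H.v_pos n hn
  set w := Real.exp (η * speed α h v n)
  have hw : 0 < w := Real.exp_pos _
  have hwγ : ∀ q : ℝ, Real.exp (-(η * q * speed α h v n)) = w ^ (-q) := fun q => by
    rw [← Real.exp_mul]; ring_nf
  have hx0 : 0 < ‖x‖ := hw.trans hx
  have e1 : |mderiv α f x| ≤ C' * w ^ (-ζ) := by
    have := hC' x
    rw [abs_mul, abs_of_nonneg (Real.rpow_nonneg (norm_nonneg x) ζ)] at this
    rw [Real.rpow_neg hw.le, ← div_eq_mul_inv, le_div_iff₀ (by positivity)]
    refine le_trans ?_ this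
    rw [mul_comm]
    gcongr
  have e2 : |estimator α K h X n ω x| ≤
      (C₀ * (h n)⁻¹) ^ (d + mlen α) * (C * (2 * B) ^ γ * w ^ (-γ)) := by
    rw [estimator]
    refine abs_average_le H.reg.pos hn (fun i hi hin => hCb i n hi hin) _ fun i hi hin => ?_
    have hhi := H.reg.pos i hi
    set z := (h i)⁻¹ • (x - X i ω)
    have hz : w / (2 * B) ≤ ‖z‖ := by
      rw [norm_smul, Real.norm_eq_abs, abs_of_pos (inv_pos.2 hhi)]
      have n1 : w / 2 ≤ ‖x - X i ω‖ := by
        have := norm_sub_norm_le x (X i ω)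
        have := hω i hi hin
        linarith
      calc w / (2 * B) = B⁻¹ * (w / 2) := by field_simp
        _ ≤ _ := by
          gcongr
          exact hB' i
    have h3 := hC z
    rw [abs_mul, abs_of_nonneg (Real.rpow_nonneg (norm_nonneg z) γ)] at h3
    have h4 : (w / (2 * B)) ^ γ ≤ ‖z‖ ^ γ := by gcongr
    have h5 : (w / (2 * B)) ^ γ * |mderiv α K z| ≤ C :=
      (mul_le_mul_of_nonneg_right h4 (abs_nonneg _)).trans h3
    rw [Real.div_rpow hw.le (by positivity)] at h5
    have h6 : 0 < w ^ γ := by positivity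
    have h7 : 0 < (2 * B) ^ γ := by positivity
    rw [Real.rpow_neg hw.le, ← div_eq_mul_inv, le_div_iff₀ h6]
    rw [div_mul_eq_mul_div, div_le_iff₀ h7] at h5
    linarith
  calc _ ≤ v n * ((C₀ * (h n)⁻¹) ^ (d + mlen α) * (C * (2 * B) ^ γ * w ^ (-γ)) +
        C' * w ^ (-ζ)) := by
        gcongr
        exact (abs_sub _ _).trans (add_le_add e2 e1)
    _ = C₀ ^ (d + mlen α) * (C * (2 * B) ^ γ) * (v n * (h n)⁻¹ ^ ((d + mlen α : ℕ) : ℝ) *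
          Real.exp (-(η * γ * speed α h v n))) +
        C' * (v n * (h n)⁻¹ ^ (0 : ℝ) * Real.exp (-(η * ζ * speed α h v n))) := by
      rw [hwγ, hwγ, Real.rpow_natCast, Real.rpow_zero, mul_pow]
      ring
    _ ≤ ε := by linarith

end UniformHyp

/-- Markov's inequality for the moment of order ξ. -/
theorem IIDWithDensity.measure_norm_gt_le (hX : IIDWithDensity μ X f) {ξ : ℝ}
    (hξ : 0 < ξ) (hmom : Integrable fun x => ‖x‖ ^ ξ * f x) {i : ℕ} (hi : 1 ≤ i) {w : ℝ}
    (hw : 0 < w) :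
    μ {ω | w < ‖X i ω‖} ≤ ENNReal.ofReal (w ^ (-ξ) * ∫ x, ‖x‖ ^ ξ * f x) := by
  have hs : MeasurableSet {y : E d | w < ‖y‖} := measurableSet_lt measurable_const (by fun_prop)
  have h1 : μ {ω | w < ‖X i ω‖} = (μ.map (X i)) {y : E d | w < ‖y‖} := by
    rw [Measure.map_apply (hX.measurable_X i hi) hs]
    rfl
  rw [h1, hX.law i hi, withDensity_apply _ hs, ← integral_const_mul,
    ofReal_integral_eq_lintegral_ofReal (hmom.const_mul _) (ae_of_all _ fun x => by
      have := hX.nonneg x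
      positivity)]
  refine le_trans ?_ (setLIntegral_le_lintegral {y : E d | w < ‖y‖} _)
  refine setLIntegral_mono' hs fun y hy => ENNReal.ofReal_le_ofReal ?_
  have hy' : w < ‖y‖ := hy
  rw [← mul_assoc]
  refine le_mul_of_one_le_left (hX.nonneg y) ?_
  rw [Real.rpow_neg hw.le, inv_mul_eq_div, one_le_div (by positivity)]
  gcongr

namespace UniformHyp

theorem eventually_measure_exists_norm_gt_le (hyp : UniformHyp μ X f K α a h v)
    (H : ScaleHyp α a h v ℓ)
    (hmom : ∀ ξ : ℝ, 0 < ξ → Integrable (fun x => ‖x‖ ^ ξ * f x)) {η : ℝ} (hη : 0 < η) (A : ℝ) :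
    ∀ᶠ n in atTop, μ {ω | ∃ i, 1 ≤ i ∧ i ≤ n ∧ Real.exp (η * speed α h v n) / 2 < ‖X i ω‖} ≤
      ENNReal.ofReal (Real.exp (-(A * speed α h v n))) := by
  -- With this order the tail of one observation is about e^{-(|A|+2)s}. The number n of
  -- observations and the moment constant each use up one e^{s}. For fixed η, large A needs a high
  -- moment, whence the assumption on all moments.
  set ξ := (|A| + 2) / η
  have hξ : 0 < ξ := by positivity
  set m := ∫ x, ‖x‖ ^ ξ * f x
  have hm : 0 ≤ m := integral_nonneg fun x => by
    have := hyp.sample.nonneg x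
    positivity
  have hs := hyp.tendsto_speed H
  have h1 : Tendsto (fun n => 2 ^ ξ * m * Real.exp (-(speed α h v n))) atTop
      (𝓝 (2 ^ ξ * m * 0)) :=
    (Real.tendsto_exp_neg_atTop_nhds_zero.comp hs).const_mul _
  rw [mul_zero] at h1
  filter_upwards [hyp.eventually_growth H one_pos, h1.eventually_le_const one_pos,
    hs.eventually_ge_atTop 0] with n ⟨_, _, hn⟩ h2 hs0
  set w := Real.exp (η * speed α h v n)
  have hw : 0 < w := Real.exp_pos _
  have hsub : {ω | ∃ i, 1 ≤ i ∧ i ≤ n ∧ w / 2 < ‖X i ω‖} ⊆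
      ⋃ i ∈ Finset.Icc 1 n, {ω | w / 2 < ‖X i ω‖} := by
    rintro ω ⟨i, hi, hin, hlt⟩
    exact mem_biUnion (Finset.mem_coe.2 (Finset.mem_Icc.2 ⟨hi, hin⟩)) hlt
  refine (measure_mono hsub).trans ((measure_biUnion_finset_le _ _).trans ?_)
  refine (Finset.sum_le_sum fun i hi => hyp.sample.measure_norm_gt_le hξ (hmom ξ hξ)
    (Finset.mem_Icc.1 hi).1 (half_pos hw)).trans ?_
  rw [Finset.sum_const, Nat.card_Icc, Nat.add_sub_cancel, nsmul_eq_mul, ← ENNReal.ofReal_natCast,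
    ← ENNReal.ofReal_mul (Nat.cast_nonneg _)]
  refine ENNReal.ofReal_le_ofReal ?_
  have e1 : (w / 2) ^ (-ξ) = 2 ^ ξ * Real.exp (-((|A| + 2) * speed α h v n)) := by
    rw [Real.div_rpow hw.le zero_le_two, Real.rpow_neg zero_le_two, div_inv_eq_mul, mul_comm,
      ← Real.exp_mul]
    congr 2
    simp only [ξ]
    field_simp
  rw [e1]
  calc (n : ℝ) * (2 ^ ξ * Real.exp (-((|A| + 2) * speed α h v n)) * m)
      ≤ Real.exp (1 * speed α h v n) * (2 ^ ξ * Real.exp (-((|A| + 2) * speed α h v n)) * m) := by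
        gcongr
    _ = (2 ^ ξ * m * Real.exp (-speed α h v n)) *
        (Real.exp (1 * speed α h v n) * Real.exp (speed α h v n) *
          Real.exp (-((|A| + 2) * speed α h v n))) := by
        have : Real.exp (-speed α h v n) * Real.exp (speed α h v n) = 1 := by
          rw [← Real.exp_add]; simp
        linear_combination (-(2 ^ ξ * m * Real.exp (1 * speed α h v n) *
          Real.exp (-((|A| + 2) * speed α h v n)))) * this
    _ ≤ 1 * (Real.exp (1 * speed α h v n) * Real.exp (speed α h v n) *
          Real.exp (-((|A| + 2) * speed α h v n))) := by gcongr
    _ ≤ _ := by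
      rw [one_mul, ← Real.exp_add, ← Real.exp_add, Real.exp_le_exp]
      nlinarith [le_abs_self A]

/-- Reduction of the uniform deviations to deviations on a finite net. -/
theorem eventually_measure_supDev_le [IsProbabilityMeasure μ]
    (hyp : UniformHyp μ X f K α a h v) (H : ScaleHyp α a h v ℓ)
    (hmom : ∀ ξ : ℝ, 0 < ξ → Integrable (fun x => ‖x‖ ^ ξ * f x)) (U : Set (E d))
    {δ ε η : ℝ} (hε : 0 < ε) (hεδ : ε ≤ δ) (hη : 0 < η) (A : ℝ) :
    ∀ᶠ n in atTop, ∃ T : Finset (E d), (∀ t ∈ T, t ∈ U) ∧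
      (T.card : ℝ) ≤ Real.exp (η * speed α h v n) ∧
      μ {ω | (δ : EReal) ≤ supDev X f K α h v U n ω} ≤
        ENNReal.ofReal (Real.exp (-(A * speed α h v n))) +
        ∑ t ∈ T, μ {ω | δ - ε ≤ |centered μ X K α h v n t ω|} := by
  have hd := H.d_ne_zero
  have hd0 : (0 : ℝ) < d := by positivity
  -- With w = e^{ρs}, the ball of radius w and mesh 1/w give at most (5d w²)^d points, and 5d ≤ w
  -- eventually, so at most w^{3d} = e^{ηs}.
  set ρ := η / (3 * d)
  have hρ : 0 < ρ := by positivity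
  have hs := hyp.tendsto_speed H
  filter_upwards [hyp.eventually_measure_exists_norm_gt_le H hmom hρ A,
    hyp.eventually_abs_le_of_norm_gt H hρ (half_pos (hε.trans_le hεδ)),
    hyp.eventually_abs_centered_sub_le H hρ (ε := ε / 3) (by positivity),
    hyp.eventually_bias_le (ε := ε / 3) (by positivity),
    hs.eventually_ge_atTop 0, hs.eventually_ge_atTop (Real.log (5 * d) / ρ),
    eventually_ge_atTop 1] with n h1 h2 h3 h4 hs0 hs1 hn
  have hv := H.v_pos n hn
  set w := Real.exp (ρ * speed α h v n)
  obtain ⟨T, hTU, hTnet, hTcard⟩ := exists_finset_net hd U (ρ := Real.exp (-(ρ * speed α h v n)))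
    (W := w) (Real.exp_pos _) (Real.exp_le_exp.2 (by have := mul_nonneg hρ.le hs0; linarith))
  refine ⟨T, hTU, hTcard.trans ?_, ?_⟩
  · have e1 : 5 * (d : ℝ) ≤ w := by
      rw [← Real.log_le_iff_le_exp (by positivity)]
      rw [div_le_iff₀ hρ] at hs1
      linarith
    calc _ ≤ (w * (w / Real.exp (-(ρ * speed α h v n)))) ^ d := by gcongr
      _ = _ := by
        rw [← Real.exp_sub, ← Real.exp_add, ← Real.exp_nat_mul]
        congr 1
        simp only [ρ]
        field_simp
        ring
  · have hsub : {ω | (δ : EReal) ≤ supDev X f K α h v U n ω} ⊆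
        {ω | ∃ i, 1 ≤ i ∧ i ≤ n ∧ w / 2 < ‖X i ω‖} ∪
          ⋃ t ∈ T, {ω | δ - ε ≤ |centered μ X K α h v n t ω|} := by
      intro ω hω
      by_contra hcon
      rw [mem_union, not_or] at hcon
      obtain ⟨c1, c2⟩ := hcon
      have c1' : ∀ i, 1 ≤ i → i ≤ n → ‖X i ω‖ ≤ w / 2 := fun i hi hin => by
        by_contra! hlt
        exact c1 ⟨i, hi, hin, hlt⟩
      have c2' : ∀ t ∈ T, |centered μ X K α h v n t ω| < δ - ε := fun t ht => by
        by_contra! hle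
        exact c2 (mem_biUnion (Finset.mem_coe.2 ht) hle)
      -- The supremum need not be attained, so a margin below δ is required. Inside the ball: ε/3
      -- for oscillation, δ - ε on the net, ε/3 for bias. Outside it: δ/2, which is at most δ - ε/3
      -- since ε ≤ δ.
      have hle : supDev X f K α h v U n ω ≤ ((δ - ε / 3 : ℝ) : EReal) := by
        refine iSup₂_le fun x hx => EReal.coe_le_coe_iff.2 ?_
        rcases lt_or_ge w ‖x‖ with hxw | hxw
        · have := h2 ω c1' x hxw
          linarith
        · obtain ⟨t, ht, htx⟩ := hTnet x hx hxw
          have b1 := h3 x t htx ω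
          have b2 := c2' t ht
          have b3 := h4 x
          have b4 : v n * |estimator α K h X n ω x - mderiv α f x| =
              |(centered μ X K α h v n x ω - centered μ X K α h v n t ω) +
                centered μ X K α h v n t ω +
                v n * (∫ ω, estimator α K h X n ω x ∂μ - mderiv α f x)| := by
            rw [sub_add_cancel, centered, ← mul_add, abs_mul, abs_of_pos hv]
            congr 2
            ring
          rw [b4]
          have := abs_add_three (centered μ X K α h v n x ω - centered μ X K α h v n t ω)
            (centered μ X K α h v n t ω)
            (v n * (∫ ω, estimator α K h X n ω x ∂μ - mderiv α f x))
          linarith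
      have hω' : (δ : EReal) ≤ ((δ - ε / 3 : ℝ) : EReal) := le_trans hω hle
      rw [EReal.coe_le_coe_iff] at hω'
      linarith
    refine (measure_mono hsub).trans ((measure_union_le _ _).trans (add_le_add h1 ?_))
    exact measure_biUnion_finset_le _ _

end UniformHyp

end RecKernel

end

/-! ### Upper and lower deviation bounds, and the deviation principle -/

noncomputable section

namespace RecKernel

variable {d : ℕ} {Ω : Type*} [MeasurableSpace Ω] {μ : Measure Ω}
  {X : ℕ → Ω → E d} {f K : E d → ℝ} {α : Fin d → ℕ} {a : ℝ} {h v : ℕ → ℝ} {ℓ R : ℝ}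

/-- The limit of the scaled cumulants of the estimator, per unit of density. -/
def cumulant {d : ℕ} (α : Fin d → ℕ) (a ℓ : ℝ) (κ : E d → ℝ) (θ : ℝ) : ℝ :=
  ScaleHyp.limitFun α a ℓ (kernelRem κ) θ

theorem cumulant_zero (α : Fin d → ℕ) (a ℓ : ℝ) (κ : E d → ℝ) : cumulant α a ℓ κ 0 = 0 := by
  simp [cumulant, ScaleHyp.limitFun]

/-- This sign, due to the centering, is what allows f(x) to be replaced by its supremum over U in
Chernoff's bound. -/
theorem cumulant_nonneg (H : ScaleHyp α a h v ℓ) (κ : E d → ℝ) (θ : ℝ) :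
    0 ≤ cumulant α a ℓ κ θ := by
  refine setIntegral_nonneg measurableSet_Ioc fun s hs => ?_
  have h1 : 0 < 1 - a * (d + 2 * mlen α : ℕ) := sub_pos.2 H.lt_one
  have h2 := NiceKernel.kernelRem_nonneg κ
    (θ * ℓ / (1 - a * (d + 2 * mlen α : ℕ)) * s ^ (a * (d + mlen α : ℕ)))
  have h3 := hs.1
  positivity

theorem supOn_nonneg (U : Set (E d)) (f : E d → ℝ) : 0 ≤ supOn U f :=
  Real.iSup_nonneg fun _ => abs_nonneg _

theorem IIDWithDensity.le_supOn (hX : IIDWithDensity μ X f) {U : Set (E d)} {x : E d}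
    (hx : x ∈ U) : f x ≤ supOn U f := by
  obtain ⟨C, hC⟩ := hX.bounded
  have hb : BddAbove (range fun x : U => |f x|) := ⟨C, forall_mem_range.2 fun x => hC x⟩
  exact (le_abs_self _).trans (le_ciSup hb ⟨x, hx⟩)

namespace UniformHyp

variable [IsProbabilityMeasure μ]

theorem tendsto_cgf_centered (hyp : UniformHyp μ X f K α a h v) (H : ScaleHyp α a h v ℓ)
    (x : E d) (θ : ℝ) : Tendsto (fun n => (speed α h v n)⁻¹ *
      cgf (centered μ X K α h v n x) μ (speed α h v n * θ)) atTop
      (𝓝 (f x * cumulant α a ℓ (mderiv α K) θ)) := by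
  obtain ⟨R, hκ⟩ := hyp.exists_niceKernel
  rw [Metric.tendsto_nhds]
  intro ε hε
  filter_upwards [eventually_abs_cgf_centered_sub_le H hyp.sample
    hyp.density.uniformContinuous hκ θ (half_pos hε)] with n hn
  rw [Real.dist_eq]
  exact (hn x).trans_lt (by linarith)

/-- Upper bound for the uniform deviations. -/
theorem eventually_measure_le (hyp : UniformHyp μ X f K α a h v) (H : ScaleHyp α a h v ℓ)
    (hmom : ∀ ξ : ℝ, 0 < ξ → Integrable (fun x => ‖x‖ ^ ξ * f x)) (U : Set (E d))
    {δ : ℝ} (hδ : 0 < δ) {θ₁ θ₂ r : ℝ} (hθ₁ : 0 ≤ θ₁) (hθ₂ : 0 ≤ θ₂)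
    (h₁ : r < θ₁ * δ - supOn U f * cumulant α a ℓ (mderiv α K) θ₁)
    (h₂ : r < θ₂ * δ - supOn U f * cumulant α a ℓ (mderiv α K) (-θ₂)) :
    ∀ᶠ n in atTop, μ {ω | (δ : EReal) ≤ supDev X f K α h v U n ω} ≤
      ENNReal.ofReal (Real.exp (-(r * speed α h v n))) := by
  obtain ⟨R, hκ⟩ := hyp.exists_niceKernel
  set Ψ := cumulant α a ℓ (mderiv α K)
  set b := supOn U f
  -- The margin 4g is spent as follows: g on the error of the cumulant, g on replacing δ by δ - ε, g
  -- on the cardinality of the net, and g on the factor 3 from the two tails and the exceptional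
  -- event.
  obtain ⟨g, hg, hg₁, hg₂⟩ : ∃ g > 0, r + 4 * g ≤ θ₁ * δ - b * Ψ θ₁ ∧
      r + 4 * g ≤ θ₂ * δ - b * Ψ (-θ₂) := by
    refine ⟨min (θ₁ * δ - b * Ψ θ₁ - r) (θ₂ * δ - b * Ψ (-θ₂) - r) / 4, ?_, ?_, ?_⟩
    · have := lt_min (sub_pos.2 h₁) (sub_pos.2 h₂)
      linarith
    · have := min_le_left (θ₁ * δ - b * Ψ θ₁ - r) (θ₂ * δ - b * Ψ (-θ₂) - r)
      linarith
    · have := min_le_right (θ₁ * δ - b * Ψ θ₁ - r) (θ₂ * δ - b * Ψ (-θ₂) - r)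
      linarith
  set ε := min δ (g / (θ₁ + θ₂ + 1))
  have hε : 0 < ε := by positivity
  have hεg : (θ₁ + θ₂ + 1) * ε ≤ g := by
    have := min_le_right δ (g / (θ₁ + θ₂ + 1))
    rw [le_div_iff₀ (by positivity)] at this
    linarith
  have hs := hyp.tendsto_speed H
  filter_upwards [hyp.eventually_measure_supDev_le H hmom U hε (min_le_left _ _) hg (r + g),
    eventually_abs_cgf_centered_sub_le H hyp.sample hyp.density.uniformContinuous hκ θ₁ hg,
    eventually_abs_cgf_centered_sub_le H hyp.sample hyp.density.uniformContinuous hκ (-θ₂) hg,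
    hs.eventually_gt_atTop 0, hs.eventually_ge_atTop (Real.log 3 / g)] with n hn c₁ c₂ hs0 hs1
  obtain ⟨T, hTU, hTc, hT⟩ := hn
  refine hT.trans ?_
  set s := speed α h v n
  have hcgf : ∀ θ x, |s⁻¹ * cgf (centered μ X K α h v n x) μ (s * θ) - f x * Ψ θ| ≤ g →
      x ∈ U → cgf (centered μ X K α h v n x) μ (s * θ) ≤ s * (b * Ψ θ + g) := by
    intro θ x hx hxU
    have e1 : cgf (centered μ X K α h v n x) μ (s * θ) =
        s * (s⁻¹ * cgf (centered μ X K α h v n x) μ (s * θ)) := by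
      rw [mul_inv_cancel_left₀ hs0.ne']
    have e2 : f x * Ψ θ ≤ b * Ψ θ :=
      mul_le_mul_of_nonneg_right (hyp.sample.le_supOn hxU) (cumulant_nonneg H _ _)
    rw [e1]
    exact mul_le_mul_of_nonneg_left (by linarith [(abs_le.1 hx).2]) hs0.le
  have hterm : ∀ t ∈ T, μ {ω | δ - ε ≤ |centered μ X K α h v n t ω|} ≤
      ENNReal.ofReal (2 * Real.exp (-((r + 2 * g) * s))) := by
    intro t ht
    have hint := integrable_exp_centered (h := h) (v := v) hyp.sample hκ n t
    have p1 := measure_ge_le_exp_cgf (μ := μ) (δ - ε) (mul_nonneg hs0.le hθ₁) (hint (s * θ₁))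
    have p2 := measure_le_le_exp_cgf (μ := μ) (-(δ - ε))
      (t := s * -θ₂) (mul_nonpos_of_nonneg_of_nonpos hs0.le (by linarith)) (hint (s * -θ₂))
    have q1 := hcgf θ₁ t (c₁ t) (hTU t ht)
    have q2 := hcgf (-θ₂) t (c₂ t) (hTU t ht)
    have p1' : μ.real {ω | δ - ε ≤ centered μ X K α h v n t ω} ≤
        Real.exp (-((r + 2 * g) * s)) := by
      refine p1.trans (Real.exp_le_exp.2 ?_)
      have : s * (r + 2 * g) ≤ s * (θ₁ * (δ - ε) - (b * Ψ θ₁ + g)) :=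
        mul_le_mul_of_nonneg_left (by nlinarith) hs0.le
      linarith
    have p2' : μ.real {ω | centered μ X K α h v n t ω ≤ -(δ - ε)} ≤
        Real.exp (-((r + 2 * g) * s)) := by
      refine p2.trans (Real.exp_le_exp.2 ?_)
      have : s * (r + 2 * g) ≤ s * (θ₂ * (δ - ε) - (b * Ψ (-θ₂) + g)) :=
        mul_le_mul_of_nonneg_left (by nlinarith) hs0.le
      linarith
    have hsub : {ω | δ - ε ≤ |centered μ X K α h v n t ω|} ⊆
        {ω | δ - ε ≤ centered μ X K α h v n t ω} ∪
          {ω | centered μ X K α h v n t ω ≤ -(δ - ε)} := by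
      intro ω hω
      rcases le_abs.1 (show δ - ε ≤ |centered μ X K α h v n t ω| from hω) with h1 | h1
      · exact Or.inl h1
      · exact Or.inr (show centered μ X K α h v n t ω ≤ -(δ - ε) by linarith)
    rw [ENNReal.le_ofReal_iff_toReal_le (measure_ne_top _ _) (by positivity)]
    refine (measureReal_mono hsub).trans ((measureReal_union_le _ _).trans ?_)
    linarith
  calc _ ≤ ENNReal.ofReal (Real.exp (-((r + g) * s))) +
        ∑ t ∈ T, ENNReal.ofReal (2 * Real.exp (-((r + 2 * g) * s))) :=
        add_le_add le_rfl (Finset.sum_le_sum hterm)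
    _ = ENNReal.ofReal (Real.exp (-((r + g) * s)) +
        T.card * (2 * Real.exp (-((r + 2 * g) * s)))) := by
        rw [Finset.sum_const, nsmul_eq_mul, ← ENNReal.ofReal_natCast,
          ← ENNReal.ofReal_mul (Nat.cast_nonneg _),
          ← ENNReal.ofReal_add (by positivity) (by positivity)]
    _ ≤ _ := by
        refine ENNReal.ofReal_le_ofReal ?_
        have e1 : (T.card : ℝ) * (2 * Real.exp (-((r + 2 * g) * s))) ≤
            2 * Real.exp (-((r + g) * s)) := by
          calc _ ≤ Real.exp (g * s) * (2 * Real.exp (-((r + 2 * g) * s))) := by gcongr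
            _ = 2 * Real.exp (-((r + g) * s)) := by
              rw [mul_left_comm, ← Real.exp_add]
              ring_nf
        have e2 : (3 : ℝ) ≤ Real.exp (g * s) := by
          rw [← Real.log_le_iff_le_exp (by norm_num)]
          rw [div_le_iff₀ hg] at hs1
          linarith
        have e3 : Real.exp (-(r * s)) = Real.exp (g * s) * Real.exp (-((r + g) * s)) := by
          rw [← Real.exp_add]
          ring_nf
        rw [e3]
        have := mul_le_mul_of_nonneg_right e2 (Real.exp_pos (-((r + g) * s))).le
        linarith

/-- Lower bound for the uniform deviations, from the deviations at a single point. -/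
theorem eventually_le_measure (hyp : UniformHyp μ X f K α a h v) (H : ScaleHyp α a h v ℓ)
    {U : Set (E d)} {x : E d} (hx : x ∈ U) {δ σ θ y r : ℝ} (hσ : |σ| = 1) (hθ : 0 ≤ θ)
    (hy : HasDerivAt (fun θ => cumulant α a ℓ (mderiv α K) (σ * θ)) y θ) (hδ : δ < f x * y)
    (hr : θ * (f x * y) - f x * cumulant α a ℓ (mderiv α K) (σ * θ) < r) :
    ∀ᶠ n in atTop, ENNReal.ofReal (Real.exp (-(r * speed α h v n))) ≤
      μ {ω | (δ : EReal) ≤ supDev X f K α h v U n ω} := by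
  obtain ⟨R, hκ⟩ := hyp.exists_niceKernel
  set Ψ := cumulant α a ℓ (mderiv α K)
  -- The first bound leaves room for the window and for the bias above δ; the second keeps the
  -- exponent, perturbed by (θ + 1) ε, below r.
  set ε := min ((f x * y - δ) / 2) ((r - (θ * (f x * y) - f x * Ψ (σ * θ))) / (θ + 1))
  have hε : 0 < ε := lt_min (by linarith) (div_pos (by linarith) (by linarith))
  have hε1 : 2 * ε ≤ f x * y - δ := by
    have := min_le_left ((f x * y - δ) / 2)
      ((r - (θ * (f x * y) - f x * Ψ (σ * θ))) / (θ + 1))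
    linarith
  have hε2 : ε * (θ + 1) ≤ r - (θ * (f x * y) - f x * Ψ (σ * θ)) := by
    have := min_le_right ((f x * y - δ) / 2)
      ((r - (θ * (f x * y) - f x * Ψ (σ * θ))) / (θ + 1))
    rwa [le_div_iff₀ (by linarith)] at this
  have hs := hyp.tendsto_speed H
  have key := eventually_exp_le_measureReal (μ := μ) hs
    (S := fun n ω => σ * centered μ X K α h v n x ω) (Λ := fun θ => f x * Ψ (σ * θ))
    (Eventually.of_forall fun n => (measurable_centered hyp.sample hκ n x).const_mul σ)
    (Eventually.of_forall fun n t => by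
      simpa only [mul_assoc] using
        integrable_exp_centered (h := h) (v := v) hyp.sample hκ n x (t * σ)) (fun θ => by
      refine (hyp.tendsto_cgf_centered H x (σ * θ)).congr fun n => ?_
      rw [cgf, cgf, mgf_const_mul]
      ring_nf) hθ (hy.const_mul (f x)) hε
  filter_upwards [key, hyp.eventually_bias_le hε, hs.eventually_gt_atTop 0,
    eventually_ge_atTop 1] with n hn hbias hs0 hn1
  have hv := H.v_pos n hn1
  have h1 : Real.exp (-(r * speed α h v n)) ≤
      μ.real {ω | f x * y - ε ≤ σ * centered μ X K α h v n x ω} := by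
    refine le_trans (Real.exp_le_exp.2 (neg_le_neg ?_)) hn
    rw [mul_comm r]
    exact mul_le_mul_of_nonneg_left (by linarith) hs0.le
  refine le_trans (ENNReal.ofReal_le_of_le_toReal h1) (measure_mono fun ω hω => ?_)
  have hω' : f x * y - ε ≤ σ * centered μ X K α h v n x ω := hω
  have h2 : f x * y - ε ≤ |centered μ X K α h v n x ω| := by
    refine hω'.trans ((le_abs_self _).trans_eq ?_)
    rw [abs_mul, hσ, one_mul]
  have h3 := hbias x
  have h4 : centered μ X K α h v n x ω = v n * (estimator α K h X n ω x - mderiv α f x) -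
      v n * (∫ ω, estimator α K h X n ω x ∂μ - mderiv α f x) := by
    rw [centered]; ring
  have h5 : δ ≤ v n * |estimator α K h X n ω x - mderiv α f x| := by
    have h6 := abs_sub (v n * (estimator α K h X n ω x - mderiv α f x))
      (v n * (∫ ω, estimator α K h X n ω x ∂μ - mderiv α f x))
    rw [← h4, abs_mul, abs_of_pos hv] at h6
    linarith
  exact (EReal.coe_le_coe_iff.2 h5).trans (le_iSup₂ (f := fun x (_ : x ∈ U) =>
    ((v n * |estimator α K h X n ω x - mderiv α f x| : ℝ) : EReal)) x hx)

end UniformHyp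

/-- Quantitative strict convexity of a function on `[0, ∞)`, with vanishing derivative
at `0`. -/
def Steep (Φ : ℝ → ℝ) : Prop :=
  ∃ Φ' : ℝ → ℝ, (∀ θ, HasDerivAt Φ (Φ' θ) θ) ∧ Continuous Φ' ∧ Φ' 0 = 0 ∧
    ∃ c > 0, ∀ θ₁ θ₂, 0 ≤ θ₁ → θ₁ ≤ θ₂ → c * (θ₂ - θ₁) ≤ Φ' θ₂ - Φ' θ₁

/-- The derivative of Φ grows at least linearly, so it takes the value δ/b at some θ₀, where the
exponent is below r. Moving slightly to the right makes the slope strictly larger and keeps the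
exponent below r. Both conditions are then open in b, hence hold at a point where f is close to its
supremum. -/
theorem Steep.exists_of_forall_lt {Φ : ℝ → ℝ} (hΦ : Steep Φ) {b δ r : ℝ} (hb : 0 < b)
    (hδ : 0 < δ) (hr : ∀ θ, θ * δ - b * Φ θ < r) :
    ∃ θ y, 0 ≤ θ ∧ HasDerivAt Φ y θ ∧
      ∀ᶠ b' in 𝓝 b, δ < b' * y ∧ θ * (b' * y) - b' * Φ θ < r := by
  obtain ⟨Φ', hd, hc, h0, c, hc0, hmono⟩ := hΦ
  have hΦc : Continuous Φ := continuous_iff_continuousAt.2 fun θ => (hd θ).continuousAt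
  obtain ⟨θ₀, hθ₀, hθ₀'⟩ : ∃ θ₀, 0 ≤ θ₀ ∧ Φ' θ₀ = δ / b := by
    have h1 : δ / b ∈ Icc (Φ' 0) (Φ' (δ / (b * c))) := by
      have h2 := hmono 0 (δ / (b * c)) le_rfl (by positivity)
      refine ⟨by rw [h0]; positivity, ?_⟩
      rw [h0, sub_zero, sub_zero] at h2
      refine le_trans (le_of_eq ?_) h2
      field_simp
    obtain ⟨θ, hθ, h3⟩ := intermediate_value_Icc (show 0 ≤ δ / (b * c) by positivity)
      hc.continuousOn h1
    exact ⟨θ, hθ.1, h3⟩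
  have hF : Continuous fun θ => θ * (b * Φ' θ) - b * Φ θ := by fun_prop
  have h4 : ∀ᶠ θ in 𝓝 θ₀, θ * (b * Φ' θ) - b * Φ θ < r := by
    refine (hF.tendsto θ₀).eventually_lt_const ?_
    have := hr θ₀
    rw [hθ₀', mul_div_cancel₀ _ hb.ne']
    exact this
  obtain ⟨θ, hθ, hlt⟩ := ((h4.filter_mono nhdsWithin_le_nhds).and
    (self_mem_nhdsWithin (s := Ioi θ₀) (a := θ₀))).exists
  have hlt' : θ₀ < θ := hlt
  have h5 : δ < b * Φ' θ := by
    have := hmono θ₀ θ hθ₀ hlt'.le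
    have h6 : 0 < c * (θ - θ₀) := mul_pos hc0 (by linarith)
    have h7 : δ / b < Φ' θ := by linarith
    rw [div_lt_iff₀ hb] at h7
    linarith
  refine ⟨θ, Φ' θ, hθ₀.trans hlt'.le, hd θ, ?_⟩
  have c1 : Continuous fun b' : ℝ => b' * Φ' θ := by fun_prop
  have c2 : Continuous fun b' : ℝ => θ * (b' * Φ' θ) - b' * Φ θ := by fun_prop
  exact ((c1.tendsto b).eventually_const_lt h5).and ((c2.tendsto b).eventually_lt_const hθ)

/-- The uniform deviation principle in terms of the limiting cumulant. -/
theorem UniformHyp.tendsto_log_measure [IsProbabilityMeasure μ]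
    (hyp : UniformHyp μ X f K α a h v) (H : ScaleHyp α a h v ℓ)
    (hmom : ∀ ξ : ℝ, 0 < ξ → Integrable (fun x => ‖x‖ ^ ξ * f x)) (U : Set (E d))
    {δ : ℝ} (hδ : 0 < δ)
    (hpos : Steep fun θ => cumulant α a ℓ (mderiv α K) (1 * θ))
    (hneg : (Steep fun θ => cumulant α a ℓ (mderiv α K) (-1 * θ)) ∨
      ∀ θ, 0 ≤ θ → cumulant α a ℓ (mderiv α K) (-θ) ≤ cumulant α a ℓ (mderiv α K) θ) :
    Tendsto (fun n : ℕ => ((v n ^ 2 / hsum α h n : ℝ) : EReal) *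
        ENNReal.log (μ {ω | (δ : EReal) ≤ supDev X f K α h v U n ω})) atTop
      (𝓝 (-(min (⨆ θ : ℝ, ((θ * δ - supOn U f * cumulant α a ℓ (mderiv α K) θ : ℝ) : EReal))
        (⨆ θ : ℝ, ((θ * -δ - supOn U f * cumulant α a ℓ (mderiv α K) θ : ℝ) : EReal))))) := by
  set Ψ := cumulant α a ℓ (mderiv α K)
  set b := supOn U f
  have hb : 0 ≤ b := supOn_nonneg U f
  have hΨ : ∀ θ, 0 ≤ Ψ θ := cumulant_nonneg H _
  have hΨ0 : Ψ 0 = 0 := cumulant_zero _ _ _ _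
  have hsp : ∀ n : ℕ, v n ^ 2 / hsum α h n = (speed α h v n)⁻¹ := fun n => by
    rw [speed, inv_div]
  have hs := hyp.tendsto_speed H
  have hlog : ∀ r n, 0 < speed α h v n → (((speed α h v n)⁻¹ : ℝ) : EReal) *
      ENNReal.log (ENNReal.ofReal (Real.exp (-(r * speed α h v n)))) = ((-r : ℝ) : EReal) := by
    intro r n hn
    rw [ENNReal.log_ofReal_of_pos (Real.exp_pos _), Real.log_exp, ← EReal.coe_mul]
    congr 1
    field_simp
  simp only [hsp]
  rw [tendsto_order]
  constructor
  · intro c hc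
    rw [EReal.lt_neg_comm] at hc
    obtain ⟨r, hr1, hr2⟩ := EReal.lt_iff_exists_real_btwn.1 hc
    have hcr : c < ((-r : ℝ) : EReal) := by
      rw [EReal.coe_neg]
      exact EReal.lt_neg_comm.1 hr2
    suffices hev : ∀ᶠ n in atTop, ENNReal.ofReal (Real.exp (-(r * speed α h v n))) ≤
        μ {ω | (δ : EReal) ≤ supDev X f K α h v U n ω} by
      filter_upwards [hev, hs.eventually_gt_atTop 0] with n hn hn0
      refine hcr.trans_le ?_
      rw [← hlog r n hn0]
      exact mul_le_mul_of_nonneg_left (ENNReal.log_le_log hn)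
        (by exact_mod_cast (inv_pos.2 hn0).le)
    have hside : ∀ σ : ℝ, |σ| = 1 → (Steep fun θ => Ψ (σ * θ)) →
        (∀ θ, θ * δ - b * Ψ (σ * θ) < r) →
        ∀ᶠ n in atTop, ENNReal.ofReal (Real.exp (-(r * speed α h v n))) ≤
          μ {ω | (δ : EReal) ≤ supDev X f K α h v U n ω} := by
      intro σ hσ hst hlt
      -- If b = 0 the Legendre transform is infinite: θ = r/δ already attains r, so no real r can
      -- dominate it.
      have hb0 : 0 < b := by
        rcases hb.eq_or_lt with h0 | h0
        · have := hlt (r / δ)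
          rw [← h0, zero_mul, sub_zero, div_mul_cancel₀ _ hδ.ne'] at this
          exact absurd this (lt_irrefl _)
        · exact h0
      obtain ⟨θ, y, hθ, hy, hev⟩ := hst.exists_of_forall_lt hb0 hδ hlt
      obtain ⟨ε, hε, hball⟩ := Metric.eventually_nhds_iff.1 hev
      have hne : Nonempty U := by
        by_contra hcon
        rw [not_nonempty_iff] at hcon
        simp only [b, supOn, Real.iSup_of_isEmpty] at hb0
        exact lt_irrefl _ hb0
      obtain ⟨⟨x, hx⟩, hxb⟩ := exists_lt_of_lt_ciSup
        (show b - ε < ⨆ x : U, |f x| from sub_lt_self b hε)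
      rw [abs_of_nonneg (hyp.sample.nonneg _)] at hxb
      have hxle := hyp.sample.le_supOn hx
      have := hball (y := f x) (by
        rw [Real.dist_eq, abs_sub_comm, abs_of_nonneg (sub_nonneg.2 hxle)]
        simp only at hxb
        linarith)
      exact hyp.eventually_le_measure H hx hσ hθ hy this.1 this.2
    have hforall : ∀ τ : ℝ, (⨆ θ : ℝ, ((θ * τ - b * Ψ θ : ℝ) : EReal)) < r →
        ∀ θ, θ * τ - b * Ψ θ < r := fun τ h θ => by
      have := (le_iSup (fun θ : ℝ => ((θ * τ - b * Ψ θ : ℝ) : EReal)) θ).trans_lt h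
      exact_mod_cast this
    rcases min_lt_iff.1 hr1 with h1 | h1
    · refine hside 1 abs_one hpos fun θ => ?_
      rw [one_mul]
      exact hforall δ h1 θ
    · have h2 : ∀ θ, θ * δ - b * Ψ (-θ) < r := fun θ => by
        have := hforall (-δ) h1 (-θ)
        rwa [neg_mul_neg] at this
      rcases hneg with hst | hle
      · refine hside (-1) (by simp) hst fun θ => ?_
        rw [neg_one_mul]
        exact h2 θ
      -- Without steepness on the negative side, the inequality Ψ(-θ) ≤ Ψ(θ) shows that a bound r on
      -- the negative transform also bounds the positive one, so positive deviations give the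
      -- required lower bound.
      · refine hside 1 abs_one hpos fun θ => ?_
        rw [one_mul]
        rcases le_total 0 θ with h0 | h0
        · refine lt_of_le_of_lt ?_ (h2 θ)
          have := mul_le_mul_of_nonneg_left (hle θ h0) hb
          linarith
        · have h3 := h2 0
          rw [zero_mul, neg_zero, hΨ0, mul_zero, sub_zero] at h3
          have h4 := mul_nonpos_of_nonpos_of_nonneg h0 hδ.le
          have h5 := mul_nonneg hb (hΨ θ)
          linarith
  · intro c hc
    replace hc := EReal.neg_lt_comm.1 hc
    obtain ⟨r, hr1, hr2⟩ := EReal.lt_iff_exists_real_btwn.1 hc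
    have hcr : ((-r : ℝ) : EReal) < c := by
      rw [EReal.coe_neg]
      exact EReal.neg_lt_comm.1 hr1
    -- Chernoff's bound needs a tilt of the right sign. A tilt of the wrong sign has nonpositive
    -- value because Ψ ≥ 0, and may be replaced by 0.
    have hex : ∀ σ : ℝ, (σ = 1 ∨ σ = -1) →
        (r : EReal) < (⨆ θ : ℝ, ((θ * (σ * δ) - b * Ψ θ : ℝ) : EReal)) →
        ∃ θ, 0 ≤ θ ∧ r < θ * δ - b * Ψ (σ * θ) := by
      intro σ hσ hlt
      obtain ⟨θ, hθ⟩ := lt_iSup_iff.1 hlt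
      have hθ' : r < θ * (σ * δ) - b * Ψ θ := by exact_mod_cast hθ
      have hσ2 : σ * σ = 1 := by rcases hσ with rfl | rfl <;> norm_num
      rcases le_total 0 (σ * θ) with h0 | h0
      · refine ⟨σ * θ, h0, ?_⟩
        rw [← mul_assoc, hσ2, one_mul]
        linarith
      · refine ⟨0, le_rfl, ?_⟩
        rw [mul_zero, hΨ0, zero_mul, mul_zero, sub_zero]
        have h1 := mul_nonneg hb (hΨ θ)
        have h2 := mul_nonpos_of_nonpos_of_nonneg h0 hδ.le
        linarith
    obtain ⟨h1, h2⟩ := lt_min_iff.1 hr2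
    obtain ⟨θ₁, hθ₁, hr₁⟩ := hex 1 (Or.inl rfl) (by simpa only [one_mul] using h1)
    obtain ⟨θ₂, hθ₂, hr₂⟩ := hex (-1) (Or.inr rfl) (by simpa only [neg_one_mul] using h2)
    rw [one_mul] at hr₁
    rw [neg_one_mul] at hr₂
    filter_upwards [hyp.eventually_measure_le H hmom U hδ hθ₁ hθ₂ hr₁ hr₂,
      hs.eventually_gt_atTop 0] with n hn hn0
    refine lt_of_le_of_lt ?_ hcr
    rw [← hlog r n hn0]
    exact mul_le_mul_of_nonneg_left (ENNReal.log_le_log hn)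
      (by exact_mod_cast (inv_pos.2 hn0).le)

end RecKernel

end

/-! ### Suprema and Legendre transforms in the extended reals -/

noncomputable section

namespace RecKernel

/-- One inequality is monotonicity; the other is the same inequality for r⁻¹. -/
theorem coe_mul_iSup_coe {ι : Type*} {r : ℝ} (hr : 0 < r) (x : ι → ℝ) :
    (r : EReal) * ⨆ i, ((x i : ℝ) : EReal) = ⨆ i, ((r * x i : ℝ) : EReal) := by
  have key : ∀ {r : ℝ}, 0 < r → ∀ x : ι → ℝ,
      ⨆ i, ((r * x i : ℝ) : EReal) ≤ (r : EReal) * ⨆ i, ((x i : ℝ) : EReal) := by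
    intro r hr x
    refine iSup_le fun i => ?_
    rw [EReal.coe_mul]
    exact mul_le_mul_of_nonneg_left (le_iSup (fun i => ((x i : ℝ) : EReal)) i)
      (by exact_mod_cast hr.le)
  refine le_antisymm ?_ (key hr x)
  have h1 := key (inv_pos.2 hr) fun i => r * x i
  simp only [inv_mul_cancel_left₀ hr.ne'] at h1
  have h2 := mul_le_mul_of_nonneg_left h1 (show (0 : EReal) ≤ r by exact_mod_cast hr.le)
  rwa [← mul_assoc, ← EReal.coe_mul, mul_inv_cancel₀ hr.ne', EReal.coe_one, one_mul] at h2

theorem iSup_coe_mul_eq_top {δ : ℝ} (hδ : δ ≠ 0) : ⨆ θ : ℝ, ((θ * δ : ℝ) : EReal) = ⊤ := by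
  rw [iSup_eq_top]
  intro b hb
  obtain ⟨r, hr, -⟩ := EReal.lt_iff_exists_real_btwn.1 hb
  exact ⟨r / δ, by rwa [div_mul_cancel₀ _ hδ]⟩

theorem iSup_mul_sub_sq (δ : ℝ) {c : ℝ} (hc : 0 < c) :
    ⨆ θ : ℝ, ((θ * δ - c * θ ^ 2 : ℝ) : EReal) = ((δ ^ 2 / (4 * c) : ℝ) : EReal) := by
  refine le_antisymm (iSup_le fun θ => EReal.coe_le_coe_iff.2 ?_) ?_
  · rw [le_div_iff₀ (by positivity)]
    nlinarith [sq_nonneg (δ - 2 * c * θ)]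
  · refine le_of_eq_of_le ?_ (le_iSup _ (δ / (2 * c)))
    congr 1
    field_simp
    ring

/-! ### The Gaussian regime -/

theorem kernelRem_zero {d : ℕ} (κ : E d → ℝ) : kernelRem κ 0 = (∫ z, κ z ^ 2) / 2 := by
  have : expRem 0 = 2⁻¹ := by simp [expRem]
  simp only [kernelRem, zero_mul, this]
  rw [integral_mul_const, div_eq_mul_inv]

/-- When ℓ = 0 the exponential remainder is evaluated at 0, where it is 1/2. With A = a (d + 2|α|),
integrating s^A gives 1/(1 + A), whence the product (1 - A)(1 + A). -/
theorem cumulant_scale_zero {d : ℕ} {α : Fin d → ℕ} {a : ℝ} (ha : 0 < a) (κ : E d → ℝ) (θ : ℝ) :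
    cumulant α a 0 κ θ = (∫ z, κ z ^ 2) / (2 * (1 - a ^ 2 * ((d : ℝ) + 2 * mlen α) ^ 2)) *
      θ ^ 2 := by
  have hβ : (0 : ℝ) ≤ a * (d + 2 * mlen α : ℕ) := by positivity
  simp only [cumulant, ScaleHyp.limitFun, mul_zero, zero_div, zero_mul]
  rw [integral_mul_const, integral_const_mul, integral_Ioc_rpow (by linarith), kernelRem_zero]
  push_cast at hβ ⊢
  rw [show 1 - a ^ 2 * ((d : ℝ) + 2 * mlen α) ^ 2 =
    (1 - a * (d + 2 * mlen α)) * (a * (d + 2 * mlen α) + 1) by ring]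
  simp only [div_eq_mul_inv, mul_inv, one_mul]
  ring

theorem steep_mul_sq {c : ℝ} (hc : 0 < c) : Steep fun θ : ℝ => c * θ ^ 2 := by
  refine ⟨fun θ => 2 * c * θ, fun θ => ?_, by fun_prop, by simp, 2 * c, by positivity,
    fun θ₁ θ₂ _ _ => by linarith⟩
  have := (hasDerivAt_pow 2 θ).const_mul c
  refine this.congr_deriv ?_
  norm_num
  ring

/-! ### The large deviations regime -/

/-- The Lebesgue measure on `(0, 1] × ℝ^d`. -/
abbrev stripMeasure (d : ℕ) : Measure (ℝ × E d) :=
  ((volume : Measure ℝ).restrict (Ioc 0 1)).prod (volume : Measure (E d))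

theorem ae_stripMeasure (d : ℕ) : ∀ᵐ p ∂stripMeasure d, p.1 ∈ Ioc (0 : ℝ) 1 :=
  Measure.quasiMeasurePreserving_fst.ae (ae_restrict_mem measurableSet_Ioc)

section Large

variable {d : ℕ} {κ : E d → ℝ} {R A : ℝ}

/-- The integrand of the cumulant. -/
def stripRem (A : ℝ) (κ : E d → ℝ) (θ : ℝ) (p : ℝ × E d) : ℝ :=
  θ ^ 2 / (1 - A) * p.1 ^ A * (κ p.2 ^ 2 * expRem (θ / (1 - A) * p.1 ^ A * κ p.2))

/-- The derivative of the integrand of the cumulant. -/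
def stripDeriv (A : ℝ) (κ : E d → ℝ) (θ : ℝ) (p : ℝ × E d) : ℝ :=
  κ p.2 * (Real.exp (θ / (1 - A) * p.1 ^ A * κ p.2) - 1)

theorem NiceKernel.abs_exponent_le (hκ : NiceKernel κ R) (hA : 0 ≤ A) (hA1 : A < 1) (θ : ℝ)
    {p : ℝ × E d} (hp : p.1 ∈ Ioc (0 : ℝ) 1) :
    |θ / (1 - A) * p.1 ^ A * κ p.2| ≤ |θ| / (1 - A) * R := by
  have h1 : p.1 ^ A ≤ 1 := Real.rpow_le_one hp.1.le hp.2 hA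
  have h2 : 0 ≤ p.1 ^ A := Real.rpow_nonneg hp.1.le _
  have h3 : 0 < 1 - A := sub_pos.2 hA1
  refine hκ.abs_mul_le ?_ _
  rw [abs_mul, abs_div, abs_of_nonneg h2, abs_of_pos h3]
  exact mul_le_of_le_one_right (by positivity) h1

theorem NiceKernel.measurable_stripRem (hκ : NiceKernel κ R) (A θ : ℝ) :
    Measurable (stripRem A κ θ) := by
  have h1 := hκ.continuous.measurable
  have h2 : Measurable fun p : ℝ × E d => expRem (θ / (1 - A) * p.1 ^ A * κ p.2) :=
    continuous_expRem.measurable.comp (by fun_prop)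
  unfold stripRem
  fun_prop

theorem NiceKernel.measurable_stripDeriv (hκ : NiceKernel κ R) (A θ : ℝ) :
    Measurable (stripDeriv A κ θ) := by
  have h1 := hκ.continuous.measurable
  unfold stripDeriv
  fun_prop

theorem NiceKernel.integrable_stripRem (hκ : NiceKernel κ R) (hA : 0 ≤ A) (hA1 : A < 1)
    (θ : ℝ) : Integrable (stripRem A κ θ) (stripMeasure d) := by
  obtain ⟨D, hD, hDb⟩ := exists_expRem_le (|θ| / (1 - A) * R)
  have h3 : 0 < 1 - A := sub_pos.2 hA1
  refine ((hκ.integrable_sq.comp_snd (volume.restrict (Ioc (0 : ℝ) 1))).const_mul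
    (θ ^ 2 / (1 - A) * D)).mono' (hκ.measurable_stripRem A θ).aestronglyMeasurable ?_
  filter_upwards [ae_stripMeasure d] with p hp
  have h1 : p.1 ^ A ≤ 1 := Real.rpow_le_one hp.1.le hp.2 hA
  have h2 : 0 ≤ p.1 ^ A := Real.rpow_nonneg hp.1.le _
  have h4 := hDb _ (hκ.abs_exponent_le hA hA1 θ hp)
  have h5 := expRem_nonneg (θ / (1 - A) * p.1 ^ A * κ p.2)
  rw [stripRem, Real.norm_eq_abs, abs_of_nonneg (by positivity)]
  calc _ ≤ θ ^ 2 / (1 - A) * 1 * (κ p.2 ^ 2 * D) := by gcongr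
    _ = _ := by ring

theorem NiceKernel.cumulant_eq_integral (hκ : NiceKernel κ R) {α : Fin d → ℕ} {a : ℝ}
    (hα : mlen α = 0) (ha : 0 ≤ a * d) (ha1 : a * d < 1) (θ : ℝ) :
    cumulant α a 1 κ θ = ∫ p, stripRem (a * d) κ θ p ∂stripMeasure d := by
  rw [integral_prod _ (hκ.integrable_stripRem ha ha1 θ)]
  simp only [cumulant, ScaleHyp.limitFun, kernelRem, stripRem, hα, mul_zero, add_zero, mul_one,
    integral_const_mul]

theorem stripRem_eq {A θ : ℝ} (hA1 : A < 1) {p : ℝ × E d} (hp : 0 < p.1) :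
    stripRem A κ θ p = (p.1 ^ A / (1 - A))⁻¹ *
      (Real.exp (θ / (1 - A) * p.1 ^ A * κ p.2) - 1 - θ / (1 - A) * p.1 ^ A * κ p.2) := by
  have h2 : 0 < p.1 ^ A := Real.rpow_pos_of_pos hp _
  have h3 : 0 < 1 - A := sub_pos.2 hA1
  rw [← sq_mul_expRem, stripRem]
  field_simp

theorem hasDerivAt_stripRem {A : ℝ} (hA1 : A < 1) {p : ℝ × E d} (hp : 0 < p.1) (θ : ℝ) :
    HasDerivAt (fun θ => stripRem A κ θ p) (stripDeriv A κ θ p) θ := by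
  have h2 : 0 < p.1 ^ A := Real.rpow_pos_of_pos hp _
  have h3 : 0 < 1 - A := sub_pos.2 hA1
  simp only [stripRem_eq hA1 hp]
  have e : HasDerivAt (fun θ : ℝ => θ / (1 - A) * p.1 ^ A * κ p.2)
      (1 / (1 - A) * p.1 ^ A * κ p.2) θ :=
    (((hasDerivAt_id θ).div_const _).mul_const _).mul_const _
  refine (((e.exp.sub_const 1).sub e).const_mul _).congr_deriv ?_
  rw [stripDeriv]
  field_simp

theorem NiceKernel.abs_stripDeriv_le (hκ : NiceKernel κ R) (hA : 0 ≤ A) (hA1 : A < 1) {θ B : ℝ}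
    (hθ : |θ| ≤ B) {p : ℝ × E d} (hp : p.1 ∈ Ioc (0 : ℝ) 1) :
    |stripDeriv A κ θ p| ≤ (Real.exp (B / (1 - A) * R) + 1) * |κ p.2| := by
  have h1 := hκ.abs_exponent_le hA hA1 θ hp
  have h2 : |θ| / (1 - A) * R ≤ B / (1 - A) * R :=
    mul_le_mul_of_nonneg_right (div_le_div_of_nonneg_right hθ (sub_pos.2 hA1).le) hκ.nonneg
  have h3 := Real.exp_le_exp.2 ((le_abs_self _).trans (h1.trans h2))
  have h4 := abs_sub (Real.exp (θ / (1 - A) * p.1 ^ A * κ p.2)) 1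
  rw [Real.abs_exp, abs_one] at h4
  rw [stripDeriv, abs_mul, mul_comm]
  exact mul_le_mul_of_nonneg_right (by linarith) (abs_nonneg _)

theorem NiceKernel.integrable_stripDeriv (hκ : NiceKernel κ R) (hA : 0 ≤ A) (hA1 : A < 1)
    (θ : ℝ) : Integrable (stripDeriv A κ θ) (stripMeasure d) := by
  refine ((hκ.integrable.abs.comp_snd (volume.restrict (Ioc (0 : ℝ) 1))).const_mul
    (Real.exp (|θ| / (1 - A) * R) + 1)).mono'
    (hκ.measurable_stripDeriv A θ).aestronglyMeasurable ?_
  filter_upwards [ae_stripMeasure d] with p hp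
  exact hκ.abs_stripDeriv_le hA hA1 le_rfl hp

theorem NiceKernel.hasDerivAt_integral_stripRem (hκ : NiceKernel κ R) (hA : 0 ≤ A) (hA1 : A < 1)
    (θ : ℝ) : HasDerivAt (fun θ => ∫ p, stripRem A κ θ p ∂stripMeasure d)
      (∫ p, stripDeriv A κ θ p ∂stripMeasure d) θ := by
  refine (hasDerivAt_integral_of_dominated_loc_of_deriv_le (Metric.ball_mem_nhds θ one_pos)
    (Eventually.of_forall fun θ => (hκ.measurable_stripRem A θ).aestronglyMeasurable)
    (hκ.integrable_stripRem hA hA1 θ) (hκ.measurable_stripDeriv A θ).aestronglyMeasurable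
    (bound := fun p => (Real.exp ((|θ| + 1) / (1 - A) * R) + 1) * |κ p.2|) ?_ ?_ ?_).2
  · filter_upwards [ae_stripMeasure d] with p hp θ' hθ'
    refine hκ.abs_stripDeriv_le hA hA1 ?_ hp
    rw [Metric.mem_ball, Real.dist_eq] at hθ'
    have := abs_sub_abs_le_abs_sub θ' θ
    linarith
  · exact (hκ.integrable.abs.comp_snd (volume.restrict (Ioc (0 : ℝ) 1))).const_mul _
  · filter_upwards [ae_stripMeasure d] with p hp θ' _
    exact hasDerivAt_stripRem hA1 hp.1 θ'

theorem NiceKernel.continuous_integral_stripDeriv (hκ : NiceKernel κ R) (hA : 0 ≤ A)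
    (hA1 : A < 1) : Continuous fun θ => ∫ p, stripDeriv A κ θ p ∂stripMeasure d := by
  rw [continuous_iff_continuousAt]
  intro θ
  refine continuousAt_of_dominated
    (bound := fun p => (Real.exp ((|θ| + 1) / (1 - A) * R) + 1) * |κ p.2|)
    (Eventually.of_forall fun θ => (hκ.measurable_stripDeriv A θ).aestronglyMeasurable) ?_
    ((hκ.integrable.abs.comp_snd (volume.restrict (Ioc (0 : ℝ) 1))).const_mul _) ?_
  · have : ∀ᶠ θ' in 𝓝 θ, |θ'| ≤ |θ| + 1 :=
      (continuous_abs.tendsto θ).eventually_le_const (by linarith)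
    filter_upwards [this] with θ' hθ'
    filter_upwards [ae_stripMeasure d] with p hp
    exact hκ.abs_stripDeriv_le hA hA1 hθ' hp
  · refine ae_of_all _ fun p => Continuous.continuousAt ?_
    unfold stripDeriv
    fun_prop

/-- For k ≥ 0 use e^y ≥ 1 + y and e^{θ₁wk} ≥ 1. For k ≤ 0 the left side vanishes and monotonicity
suffices. -/
theorem mul_exp_sub_exp_ge {w k θ₁ θ₂ : ℝ} (hw : 0 ≤ w) (h₁ : 0 ≤ θ₁) (h₂ : θ₁ ≤ θ₂) :
    w * max k 0 ^ 2 * (θ₂ - θ₁) ≤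
      k * (Real.exp (θ₂ * (w * k)) - 1) - k * (Real.exp (θ₁ * (w * k)) - 1) := by
  have h0 : 0 ≤ θ₂ - θ₁ := sub_nonneg.2 h₂
  rcases le_total 0 k with hk | hk
  · rw [max_eq_left hk]
    have e : Real.exp (θ₂ * (w * k)) = Real.exp (θ₁ * (w * k)) *
        Real.exp ((θ₂ - θ₁) * (w * k)) := by rw [← Real.exp_add]; ring_nf
    have h3 : 1 ≤ Real.exp (θ₁ * (w * k)) := Real.one_le_exp (by positivity)
    have h4 := Real.add_one_le_exp ((θ₂ - θ₁) * (w * k))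
    have h5 : 0 ≤ (θ₂ - θ₁) * (w * k) := by positivity
    have h6 : (θ₂ - θ₁) * (w * k) ≤ Real.exp (θ₂ * (w * k)) - Real.exp (θ₁ * (w * k)) := by
      rw [e]; nlinarith
    have := mul_le_mul_of_nonneg_left h6 hk
    linarith
  · rw [max_eq_right hk]
    have h3 : w * k ≤ 0 := mul_nonpos_of_nonneg_of_nonpos hw hk
    have h4 : Real.exp (θ₂ * (w * k)) ≤ Real.exp (θ₁ * (w * k)) :=
      Real.exp_le_exp.2 (mul_le_mul_of_nonpos_right h₂ h3)
    have := mul_le_mul_of_nonpos_left h4 hk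
    linarith

/-- The derivative of the integrand grows at rate at least s^A / (1 - A) times the squared positive
part of κ, with A = ad. Since κ is continuous and positive somewhere, integration gives a positive
constant. -/
theorem NiceKernel.steep_cumulant (hκ : NiceKernel κ R) {α : Fin d → ℕ} {a : ℝ}
    (hα : mlen α = 0) (ha : 0 ≤ a * d) (ha1 : a * d < 1) (hpos : ∃ z, 0 < κ z) :
    Steep (cumulant α a 1 κ) := by
  have h3 : 0 < 1 - a * d := sub_pos.2 ha1
  have hsqi : Integrable fun z => max (κ z) 0 ^ 2 :=
    hκ.integrable_sq.mono' ((hκ.continuous.max continuous_const).pow 2).aestronglyMeasurable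
      (ae_of_all _ fun z => by
        rw [Real.norm_eq_abs, abs_of_nonneg (sq_nonneg _), ← sq_abs (κ z)]
        exact pow_le_pow_left₀ (le_max_right _ _) (max_le (le_abs_self _) (abs_nonneg _)) 2)
  have hsq : 0 < ∫ z, max (κ z) 0 ^ 2 := by
    obtain ⟨z, hz⟩ := hpos
    refine integral_pos_of_integrable_nonneg_nonzero (x := z)
      ((hκ.continuous.max continuous_const).pow 2) hsqi (fun _ => sq_nonneg _) ?_
    exact pow_ne_zero 2 (lt_max_of_lt_left hz).ne'
  have hint : Integrable (fun p : ℝ × E d => p.1 ^ (a * d) / (1 - a * d) * max (κ p.2) 0 ^ 2)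
      (stripMeasure d) :=
    ((integrableOn_Ioc_rpow (by linarith)).div_const _).mul_prod hsqi
  refine ⟨fun θ => ∫ p, stripDeriv (a * d) κ θ p ∂stripMeasure d, fun θ => ?_,
    hκ.continuous_integral_stripDeriv ha ha1, by simp [stripDeriv],
    (1 / (a * d + 1) / (1 - a * d)) * ∫ z, max (κ z) 0 ^ 2, by positivity,
    fun θ₁ θ₂ h₁ h₂ => ?_⟩
  · have : cumulant α a 1 κ = fun θ => ∫ p, stripRem (a * d) κ θ p ∂stripMeasure d :=
      funext fun θ => hκ.cumulant_eq_integral hα ha ha1 θ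
    rw [this]
    exact hκ.hasDerivAt_integral_stripRem ha ha1 θ
  · simp only
    rw [← integral_sub (hκ.integrable_stripDeriv ha ha1 θ₂) (hκ.integrable_stripDeriv ha ha1 θ₁)]
    have e : (1 / (a * d + 1) / (1 - a * d)) * (∫ z, max (κ z) 0 ^ 2) * (θ₂ - θ₁) =
        ∫ p, p.1 ^ (a * d) / (1 - a * d) * max (κ p.2) 0 ^ 2 * (θ₂ - θ₁) ∂stripMeasure d := by
      rw [integral_mul_const, integral_prod_mul (fun s : ℝ => s ^ (a * d) / (1 - a * d))
        (fun z => max (κ z) 0 ^ 2), integral_div, integral_Ioc_rpow (by linarith)]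
    rw [e]
    refine integral_mono_ae (hint.mul_const _) ((hκ.integrable_stripDeriv ha ha1 θ₂).sub
      (hκ.integrable_stripDeriv ha ha1 θ₁)) ?_
    filter_upwards [ae_stripMeasure d] with p hp
    have h2 : 0 ≤ p.1 ^ (a * d) := Real.rpow_nonneg hp.1.le _
    have := mul_exp_sub_exp_ge (w := p.1 ^ (a * d) / (1 - a * d)) (k := κ p.2)
      (by positivity) h₁ h₂
    refine this.trans (le_of_eq ?_)
    simp only [stripDeriv]
    ring_nf

/-- The cumulant is ψ without its first order term, up to the factor 1 - ad; that term integrates to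
u because κ has integral one. Replacing [0, 1] by (0, 1] removes a null set. -/
theorem NiceKernel.psi_eq (hκ : NiceKernel κ R) {α : Fin d → ℕ} {a : ℝ}
    (hα : mlen α = 0) (ha : 0 ≤ a * d) (ha1 : a * d < 1) (h1 : ∫ z, κ z = 1) (u : ℝ) :
    psi a κ u = (u + cumulant α a 1 κ u) / (1 - a * d) := by
  have h3 : 0 < 1 - a * d := sub_pos.2 ha1
  have hm : (volume : Measure (ℝ × E d)).restrict (Icc (0 : ℝ) 1 ×ˢ univ) = stripMeasure d := by
    rw [Measure.volume_eq_prod, ← Measure.prod_restrict, Measure.restrict_univ,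
      ← Measure.restrict_congr_set Ioc_ae_eq_Icc]
  have hi : Integrable (fun p : ℝ × E d => u * κ p.2) (stripMeasure d) :=
    (hκ.integrable.comp_snd _).const_mul u
  have hk : ∫ p : ℝ × E d, u * κ p.2 ∂stripMeasure d = u := by
    have := integral_prod_mul (μ := volume.restrict (Ioc (0 : ℝ) 1)) (ν := (volume : Measure (E d)))
      (fun _ => u) κ
    rw [this, h1]
    simp
  rw [psi, hm, hκ.cumulant_eq_integral hα ha ha1]
  nth_rw 2 [← hk]
  rw [← integral_add hi (hκ.integrable_stripRem ha ha1 u), ← integral_div]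
  refine integral_congr_ae ?_
  filter_upwards [ae_stripMeasure d] with p hp
  have h2 : 0 < p.1 ^ (a * d) := Real.rpow_pos_of_pos hp.1 _
  rw [stripRem_eq ha1 hp.1, Real.rpow_neg hp.1.le,
    show p.1 ^ (a * d) * (u / (1 - a * d)) * κ p.2 = u / (1 - a * d) * p.1 ^ (a * d) * κ p.2 by ring]
  field_simp
  ring

/-- Negative deviations for κ are positive deviations for -κ, so steepness on the negative side
needs κ to take a negative value. -/
theorem cumulant_neg_kernel (α : Fin d → ℕ) (a ℓ : ℝ) (κ : E d → ℝ) (θ : ℝ) :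
    cumulant α a ℓ (fun z => -κ z) θ = cumulant α a ℓ κ (-θ) := by
  simp only [cumulant, ScaleHyp.limitFun, kernelRem, neg_sq, neg_mul, mul_neg, neg_div]

theorem NiceKernel.neg (hκ : NiceKernel κ R) : NiceKernel (fun z => -κ z) R :=
  ⟨hκ.continuous.neg, fun z => by rw [abs_neg]; exact hκ.abs_le z, hκ.integrable.neg⟩

/-- After multiplication by y² this is y ≤ sinh y. -/
theorem expRem_neg_le {y : ℝ} (hy : 0 ≤ y) : expRem (-y) ≤ expRem y := by
  rcases hy.eq_or_lt with rfl | h0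
  · simp
  · have h1 := sq_mul_expRem y
    have h2 := sq_mul_expRem (-y)
    have h3 := Real.self_le_sinh_iff.2 hy
    rw [Real.sinh_eq] at h3
    rw [neg_sq] at h2
    refine le_of_mul_le_mul_left ?_ (pow_pos h0 2)
    linarith

/-- For κ ≥ 0 the slope of θ ↦ Ψ(-θ) on [0, ∞) stays below the integral of κ, so steepness fails
there; this comparison replaces it. -/
theorem NiceKernel.cumulant_neg_le (hκ : NiceKernel κ R) {α : Fin d → ℕ} {a : ℝ}
    (hα : mlen α = 0) (ha : 0 ≤ a * d) (ha1 : a * d < 1) (hnn : ∀ z, 0 ≤ κ z) {θ : ℝ}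
    (hθ : 0 ≤ θ) : cumulant α a 1 κ (-θ) ≤ cumulant α a 1 κ θ := by
  rw [hκ.cumulant_eq_integral hα ha ha1, hκ.cumulant_eq_integral hα ha ha1]
  refine integral_mono_ae (hκ.integrable_stripRem ha ha1 _) (hκ.integrable_stripRem ha ha1 _) ?_
  filter_upwards [ae_stripMeasure d] with p hp
  have h2 : 0 ≤ p.1 ^ (a * d) := Real.rpow_nonneg hp.1.le _
  have h3 : 0 < 1 - a * d := sub_pos.2 ha1
  have h4 := expRem_neg_le (y := θ / (1 - a * d) * p.1 ^ (a * d) * κ p.2)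
    (mul_nonneg (by positivity) (hnn _))
  simp only [stripRem, neg_sq, neg_div, neg_mul]
  gcongr

end Large

end RecKernel

end

/-! ### Identification of the rate function -/

noncomputable section

namespace RecKernel

variable {d : ℕ} {Ω : Type*} [MeasurableSpace Ω] {μ : Measure Ω}
  {X : ℕ → Ω → E d} {f K : E d → ℝ} {α : Fin d → ℕ} {a : ℝ} {h v : ℕ → ℝ}

theorem ScaleHyp.one_sub_sq_pos {ℓ : ℝ} (H : ScaleHyp α a h v ℓ) :
    0 < 1 - a ^ 2 * ((d : ℝ) + 2 * mlen α) ^ 2 := by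
  have h1 := H.lt_one
  push_cast at h1
  have h2 : 0 ≤ a * ((d : ℝ) + 2 * mlen α) := mul_nonneg H.a_pos.le (by positivity)
  nlinarith

theorem gU_eq_iSup_of_gaussian (H : ScaleHyp α a h v 0) (hnot : ¬(mlen α = 0 ∧ IsOne v))
    (hK : 0 < ∫ z, mderiv α K z ^ 2) (U : Set (E d)) {δ : ℝ} (hδ : δ ≠ 0) :
    gU f K α a v U δ =
      ⨆ θ : ℝ, ((θ * δ - supOn U f * cumulant α a 0 (mderiv α K) θ : ℝ) : EReal) := by
  unfold gU
  split_ifs with hb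
  · simp only [hb, zero_mul, sub_zero, iSup_coe_mul_eq_top hδ]
  · have hb0 : 0 < supOn U f := (supOn_nonneg U f).lt_of_ne' hb
    have hβ : 0 < 1 - a ^ 2 * ((d : ℝ) + 2 * mlen α) ^ 2 := H.one_sub_sq_pos
    simp only [cumulant_scale_zero H.a_pos, ← mul_assoc]
    rw [iSup_mul_sub_sq _ (by positivity)]
    congr 1
    field_simp
    ring

/-- The contribution of 1/(1 - ad) to the argument of I cancels the linear part of ψ. When the
supremum of f over U is zero, the convention +∞ agrees with the supremum of θδ over all θ. -/
theorem gU_eq_iSup_of_power {R : ℝ} (hκ : NiceKernel K R) (hα : mlen α = 0) (hv : IsOne v)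
    (ha : 0 ≤ a * d) (ha1 : a * d < 1) (h1 : ∫ z, K z = 1) (U : Set (E d)) {δ : ℝ}
    (hδ : δ ≠ 0) :
    gU f K α a v U δ = ⨆ θ : ℝ, ((θ * δ - supOn U f * cumulant α a 1 K θ : ℝ) : EReal) := by
  unfold gU
  by_cases hb : supOn U f = 0
  · simp only [if_true, if_neg hδ, hb, zero_mul, sub_zero, iSup_coe_mul_eq_top hδ]
  · have hb0 : 0 < supOn U f := (supOn_nonneg U f).lt_of_ne' hb
    have h3 : 0 < 1 - a * d := sub_pos.2 ha1
    rw [if_neg hb, if_pos ⟨hα, hv⟩, rateI, coe_mul_iSup_coe (by positivity)]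
    refine iSup_congr fun θ => ?_
    rw [hκ.psi_eq hα ha ha1 h1]
    congr 1
    field_simp
    ring

end RecKernel

end

theorem corollary1 {d : ℕ} {Ω : Type*} [MeasurableSpace Ω] (μ : Measure Ω)
    [IsProbabilityMeasure μ] (X : ℕ → Ω → RecKernel.E d) (f K : RecKernel.E d → ℝ)
    (α : Fin d → ℕ) (a : ℝ) (h v : ℕ → ℝ)
    (hyp : RecKernel.UniformHyp μ X f K α a h v)
    (hmom : ∀ ξ : ℝ, 0 < ξ → Integrable (fun x => ‖x‖ ^ ξ * f x))
    (U : Set (RecKernel.E d)) (δ : ℝ) (hδ : 0 < δ) :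
    Tendsto
      (fun n : ℕ => ((v n ^ 2 / RecKernel.hsum α h n : ℝ) : EReal) *
        ENNReal.log (μ {ω | (δ : EReal) ≤ RecKernel.supDev X f K α h v U n ω}))
      atTop (𝓝 (-(RecKernel.gUtilde f K α a v U δ))) := by
  obtain ⟨R, hκ⟩ := hyp.exists_niceKernel
  obtain ⟨ℓ, H, ⟨rfl, hα, hv, hpow⟩ | ⟨rfl, hnot, hKd⟩⟩ := hyp.exists_scaleHyp
  · have hK : RecKernel.mderiv α K = K := RecKernel.mderiv_of_mlen_eq_zero hα K
    have h1 := hyp.kernel.integral_eq_one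
    have ha1 : a * d < 1 := by simpa [hα] using H.lt_one
    have ha : 0 ≤ a * d := mul_nonneg H.a_pos.le (Nat.cast_nonneg d)
    have hκ' : RecKernel.NiceKernel K R := hK ▸ hκ
    have hpos : ∃ z, 0 < K z := by
      by_contra! hcon
      have := integral_nonpos (μ := volume) hcon
      linarith
    have key := hyp.tendsto_log_measure H hmom U hδ
      (by simpa only [one_mul, hK] using hκ'.steep_cumulant hα ha ha1 hpos) (by
        -- Either K takes a negative value and -K is steep, or K ≥ 0 and the two sides of the
        -- cumulant are comparable.
        by_cases hn : ∃ z, K z < 0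
        · obtain ⟨z, hz⟩ := hn
          have := hκ'.neg.steep_cumulant hα ha ha1 ⟨z, neg_pos.2 hz⟩
          refine Or.inl ?_
          simp only [hK, neg_one_mul, ← RecKernel.cumulant_neg_kernel]
          exact this
        · push Not at hn
          refine Or.inr fun θ hθ => ?_
          rw [hK]
          exact hκ'.cumulant_neg_le hα ha ha1 hn hθ)
    rwa [hK, ← RecKernel.gU_eq_iSup_of_power hκ' hα hv ha ha1 h1 U hδ.ne',
      ← RecKernel.gU_eq_iSup_of_power hκ' hα hv ha ha1 h1 U (neg_ne_zero.2 hδ.ne')] at key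
  · have hK : 0 < ∫ z, RecKernel.mderiv α K z ^ 2 :=
      (integral_nonneg fun _ => sq_nonneg _).lt_of_ne' hKd.integral_sq_ne_zero
    have hβ := H.one_sub_sq_pos
    have hst := RecKernel.steep_mul_sq
      (c := (∫ z, RecKernel.mderiv α K z ^ 2) /
        (2 * (1 - a ^ 2 * ((d : ℝ) + 2 * RecKernel.mlen α) ^ 2))) (by positivity)
    have key := hyp.tendsto_log_measure H hmom U hδ
      (by simpa only [RecKernel.cumulant_scale_zero H.a_pos, one_mul] using hst)
      (Or.inr fun θ _ => by simp only [RecKernel.cumulant_scale_zero H.a_pos, neg_sq, le_refl])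
    rwa [← RecKernel.gU_eq_iSup_of_gaussian H hnot hK U hδ.ne',
      ← RecKernel.gU_eq_iSup_of_gaussian H hnot hK U (neg_ne_zero.2 hδ.ne')] at key
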